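/- **Setting.** Let $\mathrm{Cob}_{/l}$ be the preadditive category whose objects are finite collections of circles and whose morphisms are formal $\mathbb{Z}$-linear combinations of compact oriented two-dimensional (abstract) cobordisms, up to homeomorphism rel boundary, modulo the local relations S (a surface with a sphere component is $0$), T (a torus component may be deleted at the price of a factor $2$) and 4TU ($C_{12}+C_{34}=C_{13}+C_{24}$, where $C_{ij}$ is obtained from a surface with four marked discs by joining the $i$-th and $j$-th discs by a tube). Let $\mathrm{Cob}^{\bullet}_{/l}$ be the category whose objects are finite collections of circles with one *special* circle, and whose morphisms are the morphisms of $\mathrm{Cob}_{/l}$ that are combinations of cobordisms whose two special boundary circles lie on the same component. For a preadditive category $\mathcal C$ let $\mathrm{Mat}(\mathcal C)$ be its category of finite columns of objects and matrices of morphisms. An oriented planar link diagram $D$ has a geometric complex $[[D]]$ over $\mathrm{Mat}(\mathrm{Cob}_{/l})$ (the signed, flattened cube of smoothings and saddles); if $p$ is a point of $D$ away from the crossings, then letting the circle through $p$ be special one gets a complex $[[D,p]]$ over $\mathrm{Mat}(\mathrm{Cob}^{\bullet}_{/l})$. An additive functor from $\mathrm{Cob}_{/l}$ or $\mathrm{Cob}^\bullet_{/l}$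 to an additive category $\mathcal A$ is applied to these complexes by means of its extension to columns and matrices. Let $A_H=\mathbb{Z}[H][X]/(X^2-HX)$, with $v_+=1$, $v_-=X$, counit $v_+\mapsto 0$, $v_-\mapsto 1$ and comultiplication $v_+\mapsto v_+\otimes v_-+v_-\otimes v_+-H\,v_+\otimes v_+$, $v_-\mapsto v_-\otimes v_-$. Let $F_H$ be the TQFT given by this Frobenius system over $\mathbb{Z}[H]$: it is an additive functor from $\mathrm{Cob}_{/l}$ to $\mathbb{Z}[H]$-modules which sends $n$ circles to $A_H^{\otimes n}$. Let the co-reduced theory $F_H^{co}$ be the functor from $\mathrm{Cob}^{\bullet}_{/l}$ to the category $\mathrm{Free}(\mathbb{Z}[H])$ of free $\mathbb{Z}[H]$-modules of finite rank which sends a collection of circles to the image of multiplication by $X$ on the tensor factor of the special circle, with the maps induced by $F_H$. **Theorem 6.2.** The functors $F_H$ and $F_H^{co}$ exist (that is, the assignments above are well defined, and additive), and $F_H^{co}$ is the universal link homology functor over $\mathbb{Z}$ and holds the maximal information: 1. For all link diagrams $D,D'$ with marked points $p,p'$, the complexes $F_H^{co}[[D,p]]$ and $F_H^{co}[[D',p']]$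 are homotopy equivalent if and only if $[[D,p]]$ and $[[D',p']]$ are. 2. Let $\mathcal A$ be an additive category and $F:\mathrm{Cob}^{\bullet}_{/l}\to\mathcal A$ an additive functor. There is an additive functor $G:\mathrm{Free}(\mathbb{Z}[H])\to\mathcal A$, unique up to isomorphism, with $F\cong G\circ F_H^{co}$, and $F[[D,p]]\cong G(F_H^{co}[[D,p]])$ for every marked link diagram $(D,p)$. If $F_H^{co}[[D,p]]$ and $F_H^{co}[[D',p']]$ are homotopy equivalent, then so are $F[[D,p]]$ and $F[[D',p']]$. 3. Let $\mathcal A$ be an additive category and $F:\mathrm{Cob}_{/l}\to\mathcal A$ an additive functor. There is an additive functor $G:\mathrm{Free}(\mathbb{Z}[H])\to\mathcal A$ such that the composite of $\mathrm{Cob}^{\bullet}_{/l}\to\mathrm{Cob}_{/l}$ with $F$ is isomorphic to $G\circ F_H^{co}$, and $F[[D]]\cong G(F_H^{co}[[D,p]])$ for every marked link diagram $(D,p)$. If $F_H^{co}[[D,p]]$ and $F_H^{co}[[D',p']]$ are homotopy equivalent, then so are $F[[D]]$ and $F[[D']]$. -/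

import Mathlib

open CategoryTheory

noncomputable section

namespace LinkHom

/-- A compact oriented surface with `S`-labelled incoming and `T`-labelled outgoing boundary circles,
up to homeomorphism rel boundary: by the classification of surfaces it is given by its finite set of
connected components, the component on which each boundary circle lies, and the genus of each
component.  Components without boundary circles are closed surfaces. -/
structure Surface (S T : Type) where
  comp : Type
  [fin : Fintype comp]
  inn : S → comp
  out : T → comp
  genus : comp → ℕ

attribute [instance] Surface.fin

namespace Surface

open scoped Classical in
/-- Euler characteristic `2 - 2g - b` of a component. -/
def euler {S T : Type} [Fintype S] [Fintype T] (A : Surface S T) (c : A.comp) : ℤ :=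
  2 - 2 * (A.genus c : ℤ) - (Finset.univ.filter fun s => A.inn s = c).card
    - (Finset.univ.filter fun t => A.out t = c).card

/-- Homeomorphism rel boundary. -/
def Homeo {S T : Type} (A B : Surface S T) : Prop :=
  ∃ φ : A.comp ≃ B.comp, (∀ s, φ (A.inn s) = B.inn s) ∧ (∀ t, φ (A.out t) = B.out t) ∧
    ∀ c, B.genus (φ c) = A.genus c

/-- The cylinder `S × [0,1]`, its outgoing end relabelled along a bijection. -/
abbrev cylinder {S T : Type} [Fintype T] (σ : S ≃ T) : Surface S T where
  comp := T
  inn := σ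
  out := id
  genus _ := 0

/-- The components of two surfaces which touch along a circle of the common boundary. -/
def Touch {S T U : Type} (A : Surface S T) (B : Surface T U) :
    A.comp ⊕ B.comp → A.comp ⊕ B.comp → Prop :=
  fun x y => ∃ t, x = Sum.inl (A.out t) ∧ y = Sum.inr (B.inn t)

/-- Components of the glued surface. -/
abbrev GlueComp {S T U : Type} (A : Surface S T) (B : Surface T U) : Type := Quot (Touch A B)

instance {S T U : Type} (A : Surface S T) (B : Surface T U) : Fintype (GlueComp A B) :=
  Fintype.ofFinite _

open scoped Classical in
/-- Gluing along the circles `T`.  The genus of a component of the result is the sum of the genera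
of its pieces plus the first Betti number `E + 1 - V` of its gluing graph, whose vertices are the
pieces and whose edges are the circles along which they are glued. -/
abbrev glue {S T U : Type} [Fintype T] (A : Surface S T) (B : Surface T U) : Surface S U where
  comp := GlueComp A B
  inn s := Quot.mk _ (Sum.inl (A.inn s))
  out u := Quot.mk _ (Sum.inr (B.out u))
  genus k := (∑ x ∈ Finset.univ.filter fun x => (Quot.mk _ x : GlueComp A B) = k,
      Sum.elim A.genus B.genus x)
    + (Finset.univ.filter fun t => (Quot.mk _ (Sum.inl (A.out t)) : GlueComp A B) = k).card + 1
    - (Finset.univ.filter fun x => (Quot.mk _ x : GlueComp A B) = k).card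

/-! ### Gluing is well defined, associative and unital -/

open scoped Classical in
theorem card_fibre_le {V E : Type} [Fintype V] [Fintype E] (f g : E → V)
    (k : Quot fun x y => ∃ e, x = f e ∧ y = g e) :
    (Finset.univ.filter fun v => (Quot.mk (fun x y => ∃ e, x = f e ∧ y = g e) v) = k).card ≤
      (Finset.univ.filter fun e => Quot.mk (fun x y => ∃ e, x = f e ∧ y = g e) (f e) = k).card + 1 := by
  obtain ⟨r, hr⟩ : ∃ r : V → V → Prop, r = fun x y => ∃ e, x = f e ∧ y = g e := ⟨_, rfl⟩
  revert k
  rw [← hr]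
  intro k
  let W := {v : V // Quot.mk r v = k}
  let G : SimpleGraph W := SimpleGraph.fromRel fun x y => r x.1 y.1
  have hconn : G.Connected := by
    rw [SimpleGraph.connected_iff]
    constructor
    · rintro ⟨x, hx⟩ ⟨y, hy⟩
      have h : Relation.EqvGen r x y := Quot.eqvGen_exact (hx.trans hy.symm)
      induction h with
      | rel x y h =>
        by_cases hxy : x = y
        · subst hxy; exact SimpleGraph.Reachable.refl _
        · apply SimpleGraph.Adj.reachable
          rw [SimpleGraph.fromRel_adj]
          exact ⟨fun h' => hxy (congrArg Subtype.val h'), Or.inl h⟩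
      | refl x => exact SimpleGraph.Reachable.refl _
      | symm x y h ih => exact (ih hy hx).symm
      | trans x y z h1 h2 ih1 ih2 =>
        have hy' : Quot.mk r y = k := (Quot.eqvGen_sound h1).symm.trans hx
        exact (ih1 hx hy').trans (ih2 hy' hy)
    · obtain ⟨v, hv⟩ := Quot.exists_rep k
      exact ⟨⟨v, hv⟩⟩
  have h := hconn.card_vert_le_card_edgeSet_add_one
  have h1 : Nat.card W = (Finset.univ.filter fun v => (Quot.mk r v) = k).card := by
    rw [Nat.card_eq_fintype_card, Fintype.card_subtype]
  have h2 : Nat.card G.edgeSet ≤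
      Nat.card {e : E // Quot.mk r (f e) = k} := by
    have hk : ∀ e, Quot.mk r (f e) = k → Quot.mk r (g e) = k := fun e he =>
      (Quot.sound (hr ▸ ⟨e, rfl, rfl⟩ : r (f e) (g e))).symm.trans he
    have key : ∀ z : G.edgeSet, ∃ e : {e : E // Quot.mk r (f e) = k},
        z.1 = s((⟨f e.1, e.2⟩ : W), (⟨g e.1, hk _ e.2⟩ : W)) := by
      rintro ⟨z, hz⟩
      induction z using Sym2.ind with
      | _ x y =>
        rw [SimpleGraph.mem_edgeSet, SimpleGraph.fromRel_adj] at hz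
        simp only [hr] at hz
        rcases hz with ⟨_, ⟨e, h1, h2⟩ | ⟨e, h1, h2⟩⟩
        · refine ⟨⟨e, h1 ▸ x.2⟩, ?_⟩
          rw [Sym2.eq_iff]
          exact Or.inl ⟨Subtype.ext h1, Subtype.ext h2⟩
        · refine ⟨⟨e, h1 ▸ y.2⟩, ?_⟩
          rw [Sym2.eq_iff]
          exact Or.inr ⟨Subtype.ext h2, Subtype.ext h1⟩
    choose F hF using key
    refine Nat.card_le_card_of_injective F ?_
    intro a b hab
    apply Subtype.ext
    rw [hF a, hF b, hab]
  rw [Nat.card_eq_fintype_card (α := {e : E // Quot.mk r (f e) = k}), Fintype.card_subtype] at h2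
  omega

open scoped Classical in
theorem sum_card_fibre {α β γ : Type} [Fintype α] [Fintype β] (f : α → β) (π : β → γ) (k : γ) :
    (∑ b, if π b = k then ((Finset.univ.filter fun a => f a = b).card : ℤ) else 0) =
      (Finset.univ.filter fun a => π (f a) = k).card := by
  simp only [Finset.card_filter, Nat.cast_sum, Nat.cast_ite, Nat.cast_one, Nat.cast_zero]
  have : ∀ b, (if π b = k then ∑ a, (if f a = b then (1 : ℤ) else 0) else 0) =
      ∑ a, if f a = b then (if π b = k then 1 else 0) else 0 := by
    intro b
    split_ifs <;> simp
  simp only [this]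
  rw [Finset.sum_comm]
  simp

open scoped Classical in
/-- The Euler characteristic is additive under gluing. -/
theorem euler_glue {S T U : Type} [Fintype S] [Fintype T] [Fintype U]
    (A : Surface S T) (B : Surface T U) (k : GlueComp A B) :
    (glue A B).euler k =
      (∑ c, if (Quot.mk _ (Sum.inl c) : GlueComp A B) = k then A.euler c else 0) +
      ∑ c, if (Quot.mk _ (Sum.inr c) : GlueComp A B) = k then B.euler c else 0 := by
  have hle : (Finset.univ.filter fun x => (Quot.mk _ x : GlueComp A B) = k).card ≤
      (Finset.univ.filter fun t => (Quot.mk _ (Sum.inl (A.out t)) : GlueComp A B) = k).card + 1 :=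
    card_fibre_le (fun t => Sum.inl (A.out t)) (fun t => Sum.inr (B.inn t)) k
  have hg : ((glue A B).genus k : ℤ) =
      (∑ x, if (Quot.mk _ x : GlueComp A B) = k then ((Sum.elim A.genus B.genus x : ℕ) : ℤ) else 0)
      + (Finset.univ.filter fun t => (Quot.mk _ (Sum.inl (A.out t)) : GlueComp A B) = k).card + 1
      - ∑ x, if (Quot.mk _ x : GlueComp A B) = k then (1 : ℤ) else 0 := by
    show ((_ - _ : ℕ) : ℤ) = _
    rw [Nat.cast_sub (by omega)]
    push_cast
    rw [Finset.sum_filter, Finset.card_filter, Finset.card_filter]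
    push_cast
    rfl
  have hm : ∀ t, (Quot.mk _ (Sum.inr (B.inn t)) : GlueComp A B) = Quot.mk _ (Sum.inl (A.out t)) :=
    fun t => (Quot.sound ⟨t, rfl, rfl⟩).symm
  have e1 := sum_card_fibre A.inn (fun c => (Quot.mk _ (Sum.inl c) : GlueComp A B)) k
  have e2 := sum_card_fibre A.out (fun c => (Quot.mk _ (Sum.inl c) : GlueComp A B)) k
  have e3 := sum_card_fibre B.inn (fun c => (Quot.mk _ (Sum.inr c) : GlueComp A B)) k
  have e4 := sum_card_fibre B.out (fun c => (Quot.mk _ (Sum.inr c) : GlueComp A B)) k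
  simp only [hm] at e3
  have split : ∀ {γ : Type} [Fintype γ] (p : γ → Prop) (g : γ → ℕ) (a b : γ → ℤ),
      (∑ c, if p c then 2 - 2 * (g c : ℤ) - a c - b c else 0) =
      2 * (∑ c, if p c then (1 : ℤ) else 0) - 2 * (∑ c, if p c then (g c : ℤ) else 0)
        - (∑ c, if p c then a c else 0) - (∑ c, if p c then b c else 0) := by
    intro γ _ p g a b
    rw [Finset.mul_sum, Finset.mul_sum, ← Finset.sum_sub_distrib, ← Finset.sum_sub_distrib,
      ← Finset.sum_sub_distrib]
    refine Finset.sum_congr rfl fun c _ => ?_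
    split_ifs <;> ring
  rw [Fintype.sum_sum_type, Fintype.sum_sum_type] at hg
  simp only [Sum.elim_inl, Sum.elim_inr] at hg
  simp only [euler]
  rw [split, split, e1, e2, e3, e4, hg]
  ring

theorem Homeo.refl {S T : Type} (A : Surface S T) : A.Homeo A :=
  ⟨Equiv.refl _, fun _ => rfl, fun _ => rfl, fun _ => rfl⟩

theorem Homeo.symm {S T : Type} {A B : Surface S T} : A.Homeo B → B.Homeo A := by
  rintro ⟨φ, h1, h2, h3⟩
  refine ⟨φ.symm, fun s => ?_, fun t => ?_, fun c => ?_⟩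
  · rw [← h1, φ.symm_apply_apply]
  · rw [← h2, φ.symm_apply_apply]
  · rw [← h3, φ.apply_symm_apply]

theorem Homeo.trans {S T : Type} {A B C : Surface S T} : A.Homeo B → B.Homeo C → A.Homeo C := by
  rintro ⟨φ, h1, h2, h3⟩ ⟨ψ, k1, k2, k3⟩
  exact ⟨φ.trans ψ, fun s => by simp [h1, k1], fun s => by simp [h2, k2], fun s => by simp [h3, k3]⟩

theorem euler_congr {S T : Type} [Fintype S] [Fintype T] {A B : Surface S T}
    (φ : A.comp ≃ B.comp) (h1 : ∀ s, φ (A.inn s) = B.inn s) (h2 : ∀ t, φ (A.out t) = B.out t)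
    (c : A.comp) : B.euler (φ c) + 2 * B.genus (φ c) = A.euler c + 2 * A.genus c := by
  classical
  have e1 : (Finset.univ.filter fun s => B.inn s = φ c) = Finset.univ.filter fun s => A.inn s = c := by
    ext s; simp [← h1]
  have e2 : (Finset.univ.filter fun s => B.out s = φ c) = Finset.univ.filter fun s => A.out s = c := by
    ext s; simp [← h2]
  simp only [euler]
  rw [e1, e2]
  ring

/-- Components, boundary and Euler characteristics determine a surface. -/
theorem homeo_of_euler {S T : Type} [Fintype S] [Fintype T] {A B : Surface S T}
    (φ : A.comp ≃ B.comp) (h1 : ∀ s, φ (A.inn s) = B.inn s) (h2 : ∀ t, φ (A.out t) = B.out t)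
    (h3 : ∀ c, B.euler (φ c) = A.euler c) : A.Homeo B := by
  refine ⟨φ, h1, h2, fun c => ?_⟩
  have h := h3 c
  have h' := euler_congr φ h1 h2 c
  omega

theorem Homeo.euler {S T : Type} [Fintype S] [Fintype T] {A B : Surface S T}
    (φ : A.comp ≃ B.comp) (h1 : ∀ s, φ (A.inn s) = B.inn s) (h2 : ∀ t, φ (A.out t) = B.out t)
    (h3 : ∀ c, B.genus (φ c) = A.genus c) (c : A.comp) : B.euler (φ c) = A.euler c := by
  have h' := euler_congr φ h1 h2 c
  rw [h3] at h'
  omega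

theorem Homeo.glue {S T U : Type} [Fintype S] [Fintype T] [Fintype U] {A A' : Surface S T}
    {B B' : Surface T U} : A.Homeo A' → B.Homeo B' → (A.glue B).Homeo (A'.glue B') := by
  classical
  rintro ⟨φ, h1, h2, h3⟩ ⟨ψ, k1, k2, k3⟩
  let e : GlueComp A B ≃ GlueComp A' B' :=
    Quot.congr (Equiv.sumCongr φ ψ) (by
      rintro (x | x) (y | y) <;> simp [Touch, ← h2, ← k1])
  refine homeo_of_euler e (fun s => ?_) (fun u => ?_) (fun k => ?_)
  · show Quot.mk _ (Sum.inl (φ (A.inn s))) = Quot.mk _ (Sum.inl (A'.inn s)); rw [h1]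
  · show Quot.mk _ (Sum.inr (ψ (B.out u))) = Quot.mk _ (Sum.inr (B'.out u)); rw [k2]
  · have a1 : ∀ c, (Quot.mk _ (Sum.inl (φ c)) : GlueComp A' B') = e (Quot.mk _ (Sum.inl c)) :=
      fun c => rfl
    have a2 : ∀ c, (Quot.mk _ (Sum.inr (ψ c)) : GlueComp A' B') = e (Quot.mk _ (Sum.inr c)) :=
      fun c => rfl
    rw [euler_glue, euler_glue]
    rw [← φ.sum_comp, ← ψ.sum_comp]
    simp only [a1, a2, EmbeddingLike.apply_eq_iff_eq, Homeo.euler φ h1 h2 h3, Homeo.euler ψ k1 k2 k3]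

theorem euler_cylinder {S T : Type} [Fintype S] [Fintype T] (σ : S ≃ T) (c : T) :
    (cylinder σ).euler c = 0 := by
  classical
  unfold euler
  have h1 : (Finset.univ.filter fun s => (cylinder σ).inn s = c) = {σ.symm c} := by
    ext s; simp only [Finset.mem_filter, Finset.mem_univ, true_and, Finset.mem_singleton, Equiv.eq_symm_apply]
  have h2 : (Finset.univ.filter fun s => (cylinder σ).out s = c) = {c} := by
    ext s; simp only [Finset.mem_filter, Finset.mem_univ, true_and, Finset.mem_singleton, id]
  rw [h1, h2]
  simp

theorem cylinder_glue {S T : Type} [Fintype S] [Fintype T] (A : Surface S T) :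
    ((cylinder (Equiv.refl S)).glue A).Homeo A := by
  classical
  let e : GlueComp (cylinder (Equiv.refl S)) A ≃ A.comp :=
    { toFun := Quot.lift (Sum.elim A.inn id) (by rintro _ _ ⟨t, rfl, rfl⟩; rfl)
      invFun := fun c => Quot.mk _ (Sum.inr c)
      left_inv := by
        rintro ⟨s | c⟩
        · exact (Quot.sound ⟨s, rfl, rfl⟩).symm
        · rfl
      right_inv := fun c => rfl }
  refine homeo_of_euler e (fun s => rfl) (fun u => rfl) (fun k => ?_)
  rw [euler_glue]
  have a2 : ∀ c, ((Quot.mk _ (Sum.inr c) : GlueComp (cylinder (Equiv.refl S)) A) = k) ↔ c = e k := by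
    intro c
    exact e.symm_apply_eq
  simp only [a2]
  rw [Finset.sum_eq_zero (fun c _ => by rw [euler_cylinder]; simp)]
  simp

theorem glue_cylinder {S T : Type} [Fintype S] [Fintype T] (A : Surface S T) :
    (A.glue (cylinder (Equiv.refl T))).Homeo A := by
  classical
  let e : GlueComp A (cylinder (Equiv.refl T)) ≃ A.comp :=
    { toFun := Quot.lift (Sum.elim id A.out) (by rintro _ _ ⟨t, rfl, rfl⟩; rfl)
      invFun := fun c => Quot.mk _ (Sum.inl c)
      left_inv := by
        rintro ⟨c | s⟩
        · rfl
        · exact (Quot.sound ⟨s, rfl, rfl⟩)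
      right_inv := fun c => rfl }
  refine homeo_of_euler e (fun s => rfl) (fun u => rfl) (fun k => ?_)
  rw [euler_glue]
  have a2 : ∀ c, ((Quot.mk _ (Sum.inl c) : GlueComp A (cylinder (Equiv.refl T))) = k) ↔ c = e k := by
    intro c
    exact e.symm_apply_eq
  simp only [a2]
  rw [add_comm, Finset.sum_eq_zero (fun c _ => by rw [euler_cylinder]; simp)]
  simp

open scoped Classical in
theorem sum_fibre_glue {S T U : Type} [Fintype S] [Fintype T] [Fintype U] {γ : Type}
    (A : Surface S T) (B : Surface T U) (π : GlueComp A B → γ) (k : γ) :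
    (∑ c, if π c = k then (A.glue B).euler c else 0) =
      (∑ c, if π (Quot.mk _ (Sum.inl c)) = k then A.euler c else 0) +
      ∑ c, if π (Quot.mk _ (Sum.inr c)) = k then B.euler c else 0 := by
  have h : ∀ c, (if π c = k then (A.glue B).euler c else 0) =
      (∑ a, if (Quot.mk _ (Sum.inl a) : GlueComp A B) = c then (if π c = k then A.euler a else 0) else 0)
      + ∑ a, if (Quot.mk _ (Sum.inr a) : GlueComp A B) = c then (if π c = k then B.euler a else 0) else 0 := by
    intro c
    rw [euler_glue]
    split_ifs <;> simp
  erw [Finset.sum_congr rfl (fun c _ => h c)]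
  rw [Finset.sum_add_distrib, Finset.sum_comm]
  congr 1
  · simp
  · rw [Finset.sum_comm]
    simp

theorem glue_assoc {S T U V : Type} [Fintype S] [Fintype T] [Fintype U] [Fintype V]
    (A : Surface S T) (B : Surface T U) (C : Surface U V) :
    ((A.glue B).glue C).Homeo (A.glue (B.glue C)) := by
  classical
  let f : GlueComp (A.glue B) C → GlueComp A (B.glue C) :=
    Quot.lift (Sum.elim
      (Quot.lift (Sum.elim (fun a => Quot.mk _ (Sum.inl a))
          (fun b => Quot.mk _ (Sum.inr (Quot.mk _ (Sum.inl b)))))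
        (by rintro _ _ ⟨t, rfl, rfl⟩; exact Quot.sound ⟨t, rfl, rfl⟩))
      (fun c => Quot.mk _ (Sum.inr (Quot.mk _ (Sum.inr c)))))
      (by
        rintro _ _ ⟨t, rfl, rfl⟩
        exact congrArg (fun z => Quot.mk _ (Sum.inr z)) (Quot.sound ⟨t, rfl, rfl⟩))
  let g : GlueComp A (B.glue C) → GlueComp (A.glue B) C :=
    Quot.lift (Sum.elim (fun a => Quot.mk _ (Sum.inl (Quot.mk _ (Sum.inl a))))
      (Quot.lift (Sum.elim (fun b => Quot.mk _ (Sum.inl (Quot.mk _ (Sum.inr b))))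
          (fun c => Quot.mk _ (Sum.inr c)))
        (by rintro _ _ ⟨t, rfl, rfl⟩; exact Quot.sound ⟨t, rfl, rfl⟩)))
      (by
        rintro _ _ ⟨t, rfl, rfl⟩
        exact congrArg (fun z => Quot.mk _ (Sum.inl z)) (Quot.sound ⟨t, rfl, rfl⟩))
  let e : GlueComp (A.glue B) C ≃ GlueComp A (B.glue C) :=
    { toFun := f
      invFun := g
      left_inv := by
        rintro ⟨⟨⟨a | b⟩⟩ | c⟩ <;> rfl
      right_inv := by
        rintro ⟨a | ⟨⟨b | c⟩⟩⟩ <;> rfl }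
  refine homeo_of_euler e (fun s => rfl) (fun u => rfl) (fun k => ?_)
  have a1 : ∀ a, ((Quot.mk _ (Sum.inl a) : GlueComp A (B.glue C)) = e k) ↔
      (Quot.mk _ (Sum.inl (Quot.mk _ (Sum.inl a))) : GlueComp (A.glue B) C) = k :=
    fun a => e.apply_eq_iff_eq (x := Quot.mk _ (Sum.inl (Quot.mk _ (Sum.inl a))))
  have a2 : ∀ a, ((Quot.mk _ (Sum.inr (Quot.mk _ (Sum.inl a))) : GlueComp A (B.glue C)) = e k) ↔
      (Quot.mk _ (Sum.inl (Quot.mk _ (Sum.inr a))) : GlueComp (A.glue B) C) = k :=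
    fun a => e.apply_eq_iff_eq (x := Quot.mk _ (Sum.inl (Quot.mk _ (Sum.inr a))))
  have a3 : ∀ a, ((Quot.mk _ (Sum.inr (Quot.mk _ (Sum.inr a))) : GlueComp A (B.glue C)) = e k) ↔
      (Quot.mk _ (Sum.inr a) : GlueComp (A.glue B) C) = k :=
    fun a => e.apply_eq_iff_eq (x := Quot.mk _ (Sum.inr a))
  have hl := euler_glue (A.glue B) C k
  have hr := euler_glue A (B.glue C) (e k)
  have sl := sum_fibre_glue A B (fun q => (Quot.mk _ (Sum.inl q) : GlueComp (A.glue B) C)) k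
  have sr := sum_fibre_glue B C (fun q => (Quot.mk _ (Sum.inr q) : GlueComp A (B.glue C))) (e k)
  simp only [a1, a2, a3] at hr sr
  refine hr.trans (Eq.trans ?_ hl.symm)
  refine (congrArg₂ (· + ·) rfl sr).trans (Eq.trans ?_ (congrArg₂ (· + ·) sl rfl).symm)
  ring

end Surface

/-- An object of the cobordism category: a finite collection of circles. -/
structure Circles where
  carrier : Type
  [fin : Fintype carrier]

instance : CoeSort Circles Type := ⟨Circles.carrier⟩

instance (S : Circles) : Fintype S := S.fin

/-- Two surfaces are identified when they are homeomorphic rel boundary. -/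
instance surfaceSetoid (S T : Type) : Setoid (Surface S T) where
  r := Surface.Homeo
  iseqv := ⟨Surface.Homeo.refl, Surface.Homeo.symm, Surface.Homeo.trans⟩

/-- The category of two-dimensional oriented cobordisms between finite collections of circles. -/
instance : Category Circles where
  Hom S T := Quotient (surfaceSetoid S T)
  id S := ⟦Surface.cylinder (Equiv.refl S)⟧
  comp f g := Quotient.map₂ Surface.glue (fun _ _ h _ _ k => Surface.Homeo.glue h k) f g
  id_comp := by rintro S T ⟨A⟩; exact Quotient.sound (Surface.cylinder_glue A)
  comp_id := by rintro S T ⟨A⟩; exact Quotient.sound (Surface.glue_cylinder A)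
  assoc := by rintro S T U V ⟨A⟩ ⟨B⟩ ⟨C⟩; exact Quotient.sound (Surface.glue_assoc A B C)

/-- The cobordism given by a surface. -/
def cob {S T : Circles} (A : Surface S T) : S ⟶ T := (⟦A⟧ : Quotient (surfaceSetoid S T))

/-- Formal integer combinations of cobordisms. -/
abbrev ZCob : Type 1 := Free ℤ Circles

/-- A collection of circles as an object of `ZCob`. -/
abbrev Circles.z (S : Circles) : ZCob := (Free.embedding ℤ Circles).obj S

/-- A cobordism as a formal combination. -/
abbrev zcob {S T : Circles} (A : Surface S T) : S.z ⟶ T.z :=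
  (Free.embedding ℤ Circles).map (cob A)

/-- Disjoint union of collections of circles, the second one being `k` labelled circles. -/
abbrev Circles.add (S : Circles) (k : ℕ) : Circles := ⟨S ⊕ Fin k⟩

/-- The identity cobordism of `S` together with spheres with holes which bound `k` new outgoing
circles: the `i`-th new circle lies on the component `p i`. -/
def newDiscs (S : Circles) {k m : ℕ} (p : Fin k → Fin m) : Surface S (S.add k) where
  comp := S ⊕ Fin m
  inn := Sum.inl
  out := Sum.map id p
  genus _ := 0

/-- The identity cobordism of `S` together with a closed surface of genus `g`. -/
def withClosed (S : Circles) (g : ℕ) : Surface S S where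
  comp := S ⊕ Unit
  inn := Sum.inl
  out := Sum.inl
  genus := Sum.elim (fun _ => 0) (fun _ => g)

/-- The local relations.  They are imposed inside arbitrary surfaces: any surface with a closed
component, and any surface with four marked disc sites, is a composite of the form displayed. -/
inductive LocalRelation : ∀ {X Y : ZCob}, (X ⟶ Y) → Prop
  /-- `C₁₂ + C₃₄ = C₁₃ + C₂₄`, where `C_ij` has a tube between the sites `i` and `j` and discs at
  the other two sites. -/
  | fourTU {X Y : ZCob} (S : Circles) (pre : X ⟶ S.z) (post : (S.add 4).z ⟶ Y) :
      LocalRelation (pre ≫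
        (zcob (newDiscs S (![0, 0, 1, 2] : Fin 4 → Fin 3))
          + zcob (newDiscs S (![1, 2, 0, 0] : Fin 4 → Fin 3))
          - zcob (newDiscs S (![0, 1, 0, 2] : Fin 4 → Fin 3))
          - zcob (newDiscs S (![1, 0, 2, 0] : Fin 4 → Fin 3))) ≫ post)
  /-- A surface with a sphere component vanishes. -/
  | sphere {X Y : ZCob} (S : Circles) (pre : X ⟶ S.z) (post : S.z ⟶ Y) :
      LocalRelation (pre ≫ zcob (withClosed S 0) ≫ post)
  /-- A torus component can be removed at the price of a factor 2. -/
  | torus {X Y : ZCob} (S : Circles) (pre : X ⟶ S.z) (post : S.z ⟶ Y) :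
      LocalRelation (pre ≫ (zcob (withClosed S 1) - (2 : ℤ) • 𝟙 S.z) ≫ post)

/-- The subgroup spanned by the local relations. -/
def relations (X Y : ZCob) : AddSubgroup (X ⟶ Y) :=
  AddSubgroup.closure {f | LocalRelation f}

theorem comp_mem_relations {X Y Z : ZCob} (h : X ⟶ Y) {f : Y ⟶ Z} (hf : f ∈ relations Y Z) :
    h ≫ f ∈ relations X Z := by
  induction hf using AddSubgroup.closure_induction with
  | mem f hf =>
    refine AddSubgroup.subset_closure ?_
    cases hf with
    | fourTU S pre post => rw [← Category.assoc]; exact .fourTU S _ _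
    | sphere S pre post => rw [← Category.assoc]; exact .sphere S _ _
    | torus S pre post => rw [← Category.assoc]; exact .torus S _ _
  | zero => rw [Limits.comp_zero]; exact zero_mem _
  | add f g _ _ hf hg => rw [Preadditive.comp_add]; exact add_mem hf hg
  | neg f _ hf => rw [Preadditive.comp_neg]; exact neg_mem hf

theorem mem_relations_comp {X Y Z : ZCob} {f : X ⟶ Y} (hf : f ∈ relations X Y) (h : Y ⟶ Z) :
    f ≫ h ∈ relations X Z := by
  induction hf using AddSubgroup.closure_induction with
  | mem f hf =>
    refine AddSubgroup.subset_closure ?_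
    cases hf with
    | fourTU S pre post => rw [Category.assoc, Category.assoc]; exact .fourTU S _ _
    | sphere S pre post => rw [Category.assoc, Category.assoc]; exact .sphere S _ _
    | torus S pre post => rw [Category.assoc, Category.assoc]; exact .torus S _ _
  | zero => rw [Limits.zero_comp]; exact zero_mem _
  | add f g _ _ hf hg => rw [Preadditive.add_comp]; exact add_mem hf hg
  | neg f _ hf => rw [Preadditive.neg_comp]; exact neg_mem hf

/-- Equality modulo the local relations. -/
def relHom : HomRel ZCob := fun X Y f g => f - g ∈ relations X Y

instance : Congruence relHom where
  equivalence :=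
    { refl := fun f => by simp [relHom]
      symm := fun {f g} h => by
        have := neg_mem h
        rwa [neg_sub] at this
      trans := fun {f g k} h1 h2 => by
        have := add_mem h1 h2
        rwa [sub_add_sub_cancel] at this }
  comp_left f _ _ h := by
    have := comp_mem_relations f h
    rwa [Preadditive.comp_sub] at this
  comp_right g h := by
    have := mem_relations_comp h g
    rwa [Preadditive.sub_comp] at this

/-- The category `Cob_{/l}`: formal integer combinations of cobordisms modulo the local 4TU, S and T
relations. -/
abbrev Cobl : Type 1 := CategoryTheory.Quotient relHom

theorem relHom_add ⦃X Y : ZCob⦄ (f₁ f₂ g₁ g₂ : X ⟶ Y) (h₁ : relHom f₁ f₂) (h₂ : relHom g₁ g₂) :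
    relHom (f₁ + g₁) (f₂ + g₂) := by
  have := add_mem h₁ h₂
  rwa [sub_add_sub_comm] at this

instance : Preadditive Cobl := Quotient.preadditive relHom relHom_add

instance : (Quotient.functor relHom).Additive := Quotient.functor_additive relHom relHom_add

/-- A collection of circles as an object of `Cob_{/l}`. -/
abbrev Circles.obj (S : Circles) : Cobl := (Quotient.functor relHom).obj S.z

/-- The class of a surface in `Cob_{/l}`. -/
abbrev mor {S T : Circles} (A : Surface S T) : S.obj ⟶ T.obj :=
  (Quotient.functor relHom).map (zcob A)

theorem mor_id (S : Circles) : mor (Surface.cylinder (Equiv.refl S)) = 𝟙 S.obj := by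
  have h : cob (Surface.cylinder (Equiv.refl S)) = 𝟙 S := rfl
  unfold mor zcob
  rw [h, CategoryTheory.Functor.map_id]
  exact (Quotient.functor relHom).map_id _

theorem mor_comp {S T U : Circles} (A : Surface S T) (B : Surface T U) :
    mor A ≫ mor B = mor (A.glue B) := by
  have h : cob (A.glue B) = cob A ≫ cob B := rfl
  unfold mor zcob
  rw [h, Functor.map_comp, Functor.map_comp]

theorem mor_eq_of_homeo {S T : Circles} {A B : Surface S T} (h : A.Homeo B) : mor A = mor B := by
  have h : cob A = cob B := Quotient.sound h
  unfold mor zcob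
  rw [h]

/-! ### Circles with a special circle -/

/-- A finite collection of circles, one of which is marked as the special circle. -/
structure PointedCircles where
  circles : Circles
  special : circles

/-- A surface preserves the special component: both special circles lie on the same component. -/
def Surface.Special {P Q : PointedCircles} (A : Surface P.circles Q.circles) : Prop :=
  A.inn P.special = A.out Q.special

/-- The morphisms of `Cob_{/l}` which are combinations of surfaces preserving the special
component. -/
def specialHom (P Q : PointedCircles) : AddSubgroup (P.circles.obj ⟶ Q.circles.obj) :=
  AddSubgroup.closure {f | ∃ A : Surface P.circles Q.circles, A.Special ∧ f = mor A}

theorem id_mem_specialHom (P : PointedCircles) : 𝟙 P.circles.obj ∈ specialHom P P :=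
  AddSubgroup.subset_closure ⟨Surface.cylinder (Equiv.refl _), rfl, (mor_id _).symm⟩

theorem comp_mem_specialHom {P Q R : PointedCircles} {f : P.circles.obj ⟶ Q.circles.obj}
    {g : Q.circles.obj ⟶ R.circles.obj} (hf : f ∈ specialHom P Q) (hg : g ∈ specialHom Q R) :
    f ≫ g ∈ specialHom P R := by
  induction hf using AddSubgroup.closure_induction with
  | mem f hf =>
    obtain ⟨A, hA, rfl⟩ := hf
    induction hg using AddSubgroup.closure_induction with
    | mem g hg =>
      obtain ⟨B, hB, rfl⟩ := hg
      refine AddSubgroup.subset_closure ⟨A.glue B, ?_, mor_comp A B⟩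
      show (Quot.mk _ (Sum.inl (A.inn P.special)) : Surface.GlueComp A B) =
        Quot.mk _ (Sum.inr (B.out R.special))
      rw [hA, ← hB]
      exact Quot.sound ⟨_, rfl, rfl⟩
    | zero => rw [Limits.comp_zero]; exact zero_mem _
    | add f g _ _ hf hg => rw [Preadditive.comp_add]; exact add_mem hf hg
    | neg f _ hf => rw [Preadditive.comp_neg]; exact neg_mem hf
  | zero => rw [Limits.zero_comp]; exact zero_mem _
  | add f g _ _ hf hg => rw [Preadditive.add_comp]; exact add_mem hf hg
  | neg f _ hf => rw [Preadditive.neg_comp]; exact neg_mem hf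

/-- The subcategory of `Cob_{/l}` of collections of circles with a special circle and combinations of
surfaces preserving the special component. -/
instance : Category PointedCircles where
  Hom P Q := specialHom P Q
  id P := ⟨𝟙 _, id_mem_specialHom P⟩
  comp f g := ⟨f.1 ≫ g.1, comp_mem_specialHom f.2 g.2⟩
  id_comp f := Subtype.ext (Category.id_comp f.1)
  comp_id f := Subtype.ext (Category.comp_id f.1)
  assoc f g h := Subtype.ext (Category.assoc f.1 g.1 h.1)

instance : Preadditive PointedCircles where
  homGroup P Q := inferInstanceAs (AddCommGroup (specialHom P Q))
  add_comp _ _ _ f f' g := Subtype.ext (Preadditive.add_comp _ _ _ f.1 f'.1 g.1)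
  comp_add _ _ _ f g g' := Subtype.ext (Preadditive.comp_add _ _ _ f.1 g.1 g'.1)

/-- Forgetting which circle is special. -/
def forgetSpecial : PointedCircles ⥤ Cobl where
  obj P := P.circles.obj
  map f := f.1

instance : forgetSpecial.Additive where

/-! ### Link diagrams -/

/-- The four ends at each crossing, numbered counterclockwise starting from the incoming end of the
lower strand. -/
abbrev HalfEdge (n : ℕ) : Type := Fin n × Fin 4

/-- The next end (also: the next corner) in clockwise direction at the same crossing. -/
def HalfEdge.prev {n : ℕ} (x : HalfEdge n) : HalfEdge n := (x.1, x.2 - 1)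

/-- The lower strand runs from end `0` to end `2`; the upper strand runs from end `3` to end `1` at a
positive crossing and from `1` to `3` at a negative one. -/
def HalfEdge.Incoming {n : ℕ} (positive : Fin n → Bool) (x : HalfEdge n) : Prop :=
  x.2 = 0 ∨ (positive x.1 = true ∧ x.2 = 3) ∨ (positive x.1 = false ∧ x.2 = 1)

/-- An oriented planar link diagram: `crossings` crossings, whose ends are joined in pairs by the
edges of the diagram, and `loops` further circles without crossings. -/
structure LinkDiagram where
  crossings : ℕ
  loops : ℕ
  positive : Fin crossings → Bool
  join : HalfEdge crossings → HalfEdge crossings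
  join_join : ∀ x, join (join x) = x
  oriented : ∀ x, HalfEdge.Incoming positive (join x) ↔ ¬ HalfEdge.Incoming positive x
  /-- Planarity, ie, the surface obtained by gluing discs along the boundaries of the faces is a
  union of spheres: every mod 2 cycle `w` of edges is the boundary of a mod 2 sum `k` of faces.
  The corner between the ends `(c, i)` and `(c, i + 1)` is denoted by `(c, i)`; it lies in the same
  face as the corner clockwise of the other end of the edge at `(c, i)`, and the two sides of the
  edge at `(c, i)` are the corners `(c, i)` and `(c, i - 1)`. -/
  planar : ∀ w : HalfEdge crossings → ZMod 2, (∀ x, w (join x) = w x) →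
    (∀ c, ∑ i, w (c, i) = 0) →
    ∃ k : HalfEdge crossings → ZMod 2, (∀ x, k (join x).prev = k x) ∧ ∀ x, w x = k x + k x.prev

/-- The two smoothings of a crossing: the `0`-smoothing joins the ends `0, 1` and `2, 3`, the
`1`-smoothing joins `1, 2` and `3, 0`. -/
def smooth (b : Bool) (i : Fin 4) : Fin 4 :=
  if b then (![3, 2, 1, 0] : Fin 4 → Fin 4) i else (![1, 0, 3, 2] : Fin 4 → Fin 4) i

theorem smooth_smooth (b : Bool) (i : Fin 4) : smooth b (smooth b i) = i := by
  revert b i; decide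

namespace LinkDiagram

variable (D : LinkDiagram)

/-- Vertices of the cube of resolutions. -/
abbrev Vertex : Type := Fin D.crossings → Bool

/-- Points of the link away from the crossings, up to moving along edges. -/
abbrev Point : Type := HalfEdge D.crossings ⊕ Fin D.loops

/-- Moving along an edge or through a smoothed crossing. -/
def Step (v : D.Vertex) (x y : D.Point) : Prop :=
  (∃ h, x = Sum.inl h ∧ y = Sum.inl (D.join h)) ∨
    ∃ c i, x = Sum.inl (c, i) ∧ y = Sum.inl (c, smooth (v c) i)

instance (r : D.Point → D.Point → Prop) : Fintype (Quot r) := Fintype.ofFinite _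

/-- The circles of the smoothing `v`. -/
abbrev circles (v : D.Vertex) : Circles := ⟨Quot (D.Step v)⟩

/-- Moves along the smoothing `v` or the smoothing `w`. -/
def Step₂ (v w : D.Vertex) (x y : D.Point) : Prop := D.Step v x y ∨ D.Step w x y

/-- The cobordism from the smoothing `v` to the smoothing `w` which is a saddle near each crossing
where they differ and a cylinder elsewhere.  It is used for smoothings which differ at one crossing:
then all components have genus zero. -/
abbrev saddle (v w : D.Vertex) : Surface (D.circles v) (D.circles w) where
  comp := Quot (D.Step₂ v w)
  inn := Quot.map id fun _ _ h => Or.inl h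
  out := Quot.map id fun _ _ h => Or.inr h
  genus _ := 0

end LinkDiagram

/-! ### The square of the differential -/

theorem not_sameCycle_of_pow {α : Type} (σ : Equiv.Perm α) {a b : α} {m : ℕ} (hm : 0 < m)
    (ha : (σ ^ m) a = a) (h : ∀ j < m, (σ ^ j) a ≠ b) [Finite α] : ¬ σ.SameCycle a b := by
  intro hs
  obtain ⟨n, hn⟩ := hs.exists_nat_pow_eq
  have h0 : ∀ q, (σ ^ (m * q)) a = a := by
    intro q
    induction q with
    | zero => simp
    | succ q ih => rw [Nat.mul_succ, pow_add, Equiv.Perm.mul_apply, ha, ih]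
  refine h (n % m) (Nat.mod_lt _ hm) ?_
  rw [← hn]
  conv_rhs => rw [← Nat.mod_add_div n m, pow_add, Equiv.Perm.mul_apply, h0]

theorem sameCycle_swap_mul {α : Type} [Finite α] [DecidableEq α] (π : Equiv.Perm α) {a b : α}
    (hab : a ≠ b) : (Equiv.swap a b * π).SameCycle a b ↔ ¬ π.SameCycle a b := by
  classical
  have hex : ∃ m, 0 < m ∧ ((π ^ m) a = a ∨ (π ^ m) a = b) :=
    ⟨orderOf π, orderOf_pos π, Or.inl (by rw [pow_orderOf_eq_one]; rfl)⟩
  obtain ⟨hm, hor⟩ := Nat.find_spec hex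
  have hmin := fun j (hj : j < Nat.find hex) => Nat.find_min hex hj
  generalize Nat.find hex = m at hm hor hmin
  set σ := Equiv.swap a b * π with hσ
  have hpow : ∀ j < m, (σ ^ j) a = (π ^ j) a := by
    intro j hj
    induction j with
    | zero => simp
    | succ j ih =>
      have h1 := hmin (j + 1) hj
      push Not at h1
      obtain ⟨h1, h2⟩ := h1 (Nat.succ_pos j)
      rw [pow_succ', Equiv.Perm.mul_apply, ih (by omega), hσ, Equiv.Perm.mul_apply,
        ← Equiv.Perm.mul_apply π, ← pow_succ', Equiv.swap_apply_of_ne_of_ne h1 h2]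
  have hlast : (σ ^ m) a = Equiv.swap a b ((π ^ m) a) := by
    obtain ⟨j, rfl⟩ : ∃ j, m = j + 1 := ⟨m - 1, by omega⟩
    rw [pow_succ', Equiv.Perm.mul_apply, hpow j (by omega), hσ, Equiv.Perm.mul_apply,
      ← Equiv.Perm.mul_apply π, ← pow_succ']
  have hne : ∀ j < m, (π ^ j) a ≠ b := by
    intro j hj h
    rcases Nat.eq_zero_or_pos j with rfl | hj0
    · exact hab (by simpa using h)
    · exact hmin j hj ⟨hj0, Or.inr h⟩
  rcases hor with h | h
  · rw [h, Equiv.swap_apply_left] at hlast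
    exact iff_of_true ⟨m, by exact_mod_cast hlast⟩ (not_sameCycle_of_pow π hm h hne)
  · rw [h, Equiv.swap_apply_right] at hlast
    refine iff_of_false ?_ (fun hn => hn ⟨m, by exact_mod_cast h⟩)
    exact not_sameCycle_of_pow σ hm hlast fun j hj => by rw [hpow j hj]; exact hne j hj

namespace LinkDiagram

variable (D : LinkDiagram)

/-- A checkerboard colouring of the corners. -/
theorem exists_shading : ∃ k : HalfEdge D.crossings → ZMod 2,
    (∀ x, k (D.join x) = k x + 1) ∧ ∀ c i, k (c, i - 1) = k (c, i) + 1 := by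
  obtain ⟨k, h1, h2⟩ := D.planar (fun _ => 1) (fun _ => rfl) (fun _ => by
    simp only [Finset.sum_const, Finset.card_univ, Fintype.card_fin]; decide)
  have key : ∀ a b : ZMod 2, 1 = a + b → b = a + 1 := by decide
  have h3 : ∀ x : HalfEdge D.crossings, k x.prev = k x + 1 := fun x => key _ _ (h2 x)
  refine ⟨k, fun x => ?_, fun c i => h3 (c, i)⟩
  have h4 := h3 (D.join x)
  rw [h1] at h4
  have : ∀ a b : ZMod 2, a = b + 1 → b = a + 1 := by decide
  exact this _ _ h4

variable {D}

theorem shading_smooth {k : HalfEdge D.crossings → ZMod 2}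
    (hk : ∀ c i, k (c, i - 1) = k (c, i) + 1) (b : Bool) (c : Fin D.crossings) (i : Fin 4) :
    k (c, smooth b i) = k (c, i) + 1 := by
  have h0 := hk c 0
  have h1 := hk c 1
  have h2 := hk c 2
  have h3 := hk c 3
  simp only [show (0 : Fin 4) - 1 = 3 from rfl, show (1 : Fin 4) - 1 = 0 from rfl,
    show (2 : Fin 4) - 1 = 1 from rfl, show (3 : Fin 4) - 1 = 2 from rfl] at h0 h1 h2 h3
  have h5 : ∀ a b : ZMod 2, a = b + 1 → b = a + 1 := by decide
  cases b <;> fin_cases i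
  · exact h5 _ _ h1
  · exact h1
  · exact h5 _ _ h3
  · exact h3
  · exact h0
  · exact h5 _ _ h2
  · exact h2
  · exact h5 _ _ h0

/-- The permutation of the coherently oriented ends which follows the circles of a smoothing. -/
def follow {k : HalfEdge D.crossings → ZMod 2} (hj : ∀ x, k (D.join x) = k x + 1)
    (hk : ∀ c i, k (c, i - 1) = k (c, i) + 1) (κ : ZMod 2) (v : D.Vertex) :
    Equiv.Perm {x : HalfEdge D.crossings // k x = κ} where
  toFun x := ⟨((D.join x.1).1, smooth (v (D.join x.1).1) (D.join x.1).2), by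
    rw [shading_smooth hk, Prod.mk.eta, hj, x.2, add_assoc, show (1 + 1 : ZMod 2) = 0 from rfl,
      add_zero]⟩
  invFun x := ⟨D.join (x.1.1, smooth (v x.1.1) x.1.2), by
    rw [hj, shading_smooth hk, Prod.mk.eta, x.2, add_assoc, show (1 + 1 : ZMod 2) = 0 from rfl,
      add_zero]⟩
  left_inv x := Subtype.ext (by
    show D.join _ = _
    simp only [smooth_smooth, Prod.mk.eta, D.join_join])
  right_inv x := Subtype.ext (by
    show ((D.join (D.join _)).1, _) = x.1
    simp only [D.join_join, smooth_smooth, Prod.mk.eta])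

theorem circle_eq_iff {k : HalfEdge D.crossings → ZMod 2} (hj : ∀ x, k (D.join x) = k x + 1)
    (hk : ∀ c i, k (c, i - 1) = k (c, i) + 1) (κ : ZMod 2) (v : D.Vertex)
    (x y : {x : HalfEdge D.crossings // k x = κ}) :
    Quot.mk (D.Step v) (Sum.inl x.1) = Quot.mk (D.Step v) (Sum.inl y.1) ↔
      (follow hj hk κ v).SameCycle x y := by
  have hstep : ∀ z, Quot.mk (D.Step v) (Sum.inl z) =
      Quot.mk (D.Step v) (Sum.inl ((D.join z).1, smooth (v (D.join z).1) (D.join z).2)) := fun z =>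
    (Quot.sound (r := D.Step v) (Or.inl ⟨z, rfl, rfl⟩)).trans
      (Quot.sound (r := D.Step v) (Or.inr ⟨_, _, rfl, rfl⟩))
  have h5 : ∀ a b : ZMod 2, a ≠ b → a + 1 = b := by decide
  have h6 : ∀ a b : ZMod 2, a + 1 = b → a ≠ b := by decide
  constructor
  · intro h
    let ρ : HalfEdge D.crossings → {x : HalfEdge D.crossings // k x = κ} := fun z =>
      if hz : k z = κ then ⟨z, hz⟩ else ⟨D.join z, by rw [hj]; exact h5 _ _ hz⟩
    have hρ1 : ∀ z (hz : k z = κ), ρ z = ⟨z, hz⟩ := fun z hz => dif_pos hz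
    have hρ2 : ∀ z (hz : ¬ k z = κ), ρ z = ⟨D.join z, by rw [hj]; exact h5 _ _ hz⟩ :=
      fun z hz => dif_neg hz
    have key : ∀ p q : D.Point, Relation.EqvGen (D.Step v) p q →
        (p = q ∨ ∃ a b, p = Sum.inl a ∧ q = Sum.inl b ∧ (follow hj hk κ v).SameCycle (ρ a) (ρ b)) := by
      intro p q hpq
      induction hpq with
      | rel p q h =>
        right
        rcases h with ⟨z, rfl, rfl⟩ | ⟨c, i, rfl, rfl⟩
        · refine ⟨_, _, rfl, rfl, ?_⟩
          have : ρ z = ρ (D.join z) := by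
            by_cases hz : k z = κ
            · have hz' : ¬ k (D.join z) = κ := by
                rw [hj, hz]; exact fun h => h6 _ _ h rfl
              rw [hρ1 _ hz, hρ2 _ hz']
              exact Subtype.ext (D.join_join z).symm
            · rw [hρ2 _ hz, hρ1 _ (by rw [hj]; exact h5 _ _ hz)]
          rw [this]
        · refine ⟨_, _, rfl, rfl, ?_⟩
          by_cases hz : k (c, i) = κ
          · have hz' : ¬ k (c, smooth (v c) i) = κ := by
              rw [shading_smooth hk, hz]; exact fun h => h6 _ _ h rfl
            rw [hρ1 _ hz, hρ2 _ hz']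
            refine Equiv.Perm.SameCycle.symm ⟨1, ?_⟩
            apply Subtype.ext
            show ((D.join (D.join _)).1, _) = _
            simp only [D.join_join, smooth_smooth]
          · have hz' : k (c, smooth (v c) i) = κ := by
              rw [shading_smooth hk]; exact h5 _ _ hz
            rw [hρ1 _ hz', hρ2 _ hz]
            refine ⟨1, ?_⟩
            apply Subtype.ext
            show ((D.join (D.join _)).1, _) = _
            simp only [D.join_join]
      | refl p => exact Or.inl rfl
      | symm p q _ ih =>
        rcases ih with rfl | ⟨a, b, h1, h2, h3⟩
        · exact Or.inl rfl
        · exact Or.inr ⟨b, a, h2, h1, h3.symm⟩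
      | trans p q r _ _ ih1 ih2 =>
        rcases ih1 with rfl | ⟨a, b, h1, h2, h3⟩
        · exact ih2
        · rcases ih2 with rfl | ⟨a', b', h1', h2', h3'⟩
          · exact Or.inr ⟨a, b, h1, h2, h3⟩
          · have hb : b = a' := Sum.inl_injective (h2.symm.trans h1')
            subst hb
            exact Or.inr ⟨a, b', h1, h2', h3.trans h3'⟩
    rcases key _ _ (Quot.eqvGen_exact h) with h | ⟨a, b, h1, h2, h3⟩
    · rw [Subtype.ext (Sum.inl_injective h)]
    · obtain rfl : x.1 = a := Sum.inl_injective h1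
      obtain rfl : y.1 = b := Sum.inl_injective h2
      rw [hρ1 _ x.2, hρ1 _ y.2] at h3
      exact h3
  · intro h
    obtain ⟨n, rfl⟩ := h.exists_nat_pow_eq
    clear h
    induction n with
    | zero => rfl
    | succ n ih =>
      rw [pow_succ', Equiv.Perm.mul_apply]
      exact ih.trans (hstep _)

/-- A saddle between planar smoothings never turns one circle into one circle. -/
theorem circle_xor (v : D.Vertex) (c : Fin D.crossings) (hv : v c = false) :
    (Quot.mk (D.Step (Function.update v c true)) (Sum.inl (c, 0)) = Quot.mk _ (Sum.inl (c, 2))) ↔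
      ¬ Quot.mk (D.Step v) (Sum.inl (c, 0)) = Quot.mk _ (Sum.inl (c, 2)) := by
  obtain ⟨k, hj, hk⟩ := D.exists_shading
  set w := Function.update v c true with hw
  have hk2 : k (c, 2) = k (c, 0) := by
    have h2 := hk c 2
    have h1 := hk c 1
    simp only [show (1 : Fin 4) - 1 = 0 from rfl, show (2 : Fin 4) - 1 = 1 from rfl] at h1 h2
    rw [h1, h2, add_assoc, show (1 + 1 : ZMod 2) = 0 from rfl, add_zero]
  let a : {x : HalfEdge D.crossings // k x = k (c, 0)} := ⟨(c, 0), rfl⟩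
  let b : {x : HalfEdge D.crossings // k x = k (c, 0)} := ⟨(c, 2), hk2⟩
  have hab : a ≠ b := fun h => by
    have h' : (0 : Fin 4) = 2 := congrArg (fun z => z.1.2) h
    exact absurd h' (by decide)
  have hperm : follow hj hk (k (c, 0)) w = Equiv.swap a b * follow hj hk (k (c, 0)) v := by
    ext1 x
    rw [Equiv.Perm.mul_apply]
    by_cases hx : (D.join x.1).1 = c
    · have hkx : k (D.join x.1) = k (c, 0) + 1 := by rw [hj, x.2]
      obtain ⟨i, hi⟩ : ∃ i, D.join x.1 = (c, i) := ⟨(D.join x.1).2, Prod.ext hx rfl⟩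
      rw [hi] at hkx
      have hv' : follow hj hk (k (c, 0)) v x = ⟨(c, smooth false i), by
          rw [shading_smooth hk, hkx, add_assoc, show (1 + 1 : ZMod 2) = 0 from rfl, add_zero]⟩ := by
        apply Subtype.ext
        show ((D.join x.1).1, smooth (v (D.join x.1).1) (D.join x.1).2) = _
        rw [hi, hv]
      have hw' : follow hj hk (k (c, 0)) w x = ⟨(c, smooth true i), by
          rw [shading_smooth hk, hkx, add_assoc, show (1 + 1 : ZMod 2) = 0 from rfl, add_zero]⟩ := by
        apply Subtype.ext
        show ((D.join x.1).1, smooth (w (D.join x.1).1) (D.join x.1).2) = _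
        rw [hi, hw, Function.update_self]
      rw [hv', hw']
      have h6 : ∀ a : ZMod 2, a ≠ a + 1 := by decide
      fin_cases i
      · exact absurd hkx (h6 _)
      · exact (Equiv.swap_apply_left a b).symm
      · exact absurd (hk2.symm.trans hkx) (h6 _)
      · exact (Equiv.swap_apply_right a b).symm
    · have hvw : follow hj hk (k (c, 0)) w x = follow hj hk (k (c, 0)) v x := by
        apply Subtype.ext
        show ((D.join x.1).1, smooth (w (D.join x.1).1) (D.join x.1).2) = (_, _)
        rw [hw, Function.update_of_ne hx]
      have hc : (follow hj hk (k (c, 0)) v x).1.1 ≠ c := hx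
      rw [hvw, Equiv.swap_apply_of_ne_of_ne]
      · intro h; rw [h] at hc; exact hc rfl
      · intro h; rw [h] at hc; exact hc rfl
  have h1 := circle_eq_iff hj hk (k (c, 0)) w a b
  have h2 := circle_eq_iff hj hk (k (c, 0)) v a b
  rw [hperm, sameCycle_swap_mul _ hab] at h1
  exact h1.trans (not_congr h2.symm)

theorem step_of_ne {v w : D.Vertex} {c : Fin D.crossings} (h : ∀ d, d ≠ c → v d = w d)
    {x y : D.Point} (hs : D.Step w x y) :
    D.Step v x y ∨ ∃ i j, x = Sum.inl (c, i) ∧ y = Sum.inl (c, j) := by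
  rcases hs with ⟨z, rfl, rfl⟩ | ⟨d, i, rfl, rfl⟩
  · exact Or.inl (Or.inl ⟨z, rfl, rfl⟩)
  · by_cases hd : d = c
    · subst hd; exact Or.inr ⟨_, _, rfl, rfl⟩
    · refine Or.inl (Or.inr ⟨d, i, rfl, ?_⟩)
      rw [h d hd]

/-- Away from the crossing `c` nothing happens to the circles of `v`. -/
theorem eqvGen_step₂ {r : D.Point → D.Point → Prop} {v : D.Vertex} {c : Fin D.crossings}
    (hr : ∀ x y, r x y → D.Step v x y ∨ ∃ i j, x = Sum.inl (c, i) ∧ y = Sum.inl (c, j))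
    {x y : D.Point} (h : Relation.EqvGen r x y) :
    Quot.mk (D.Step v) x = Quot.mk _ y ∨
      ((∃ i, Quot.mk (D.Step v) x = Quot.mk _ (Sum.inl (c, i))) ∧
        ∃ i, Quot.mk (D.Step v) y = Quot.mk _ (Sum.inl (c, i))) := by
  induction h with
  | rel x y h =>
    rcases hr x y h with h | ⟨i, j, rfl, rfl⟩
    · exact Or.inl (Quot.sound h)
    · exact Or.inr ⟨⟨i, rfl⟩, ⟨j, rfl⟩⟩
  | refl x => exact Or.inl rfl
  | symm x y _ ih =>
    rcases ih with h | ⟨h1, h2⟩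
    · exact Or.inl h.symm
    · exact Or.inr ⟨h2, h1⟩
  | trans x y z _ _ ih1 ih2 =>
    rcases ih1 with h | ⟨h1, h2⟩
    · rw [h]; exact ih2
    · rcases ih2 with h' | ⟨h1', h2'⟩
      · rw [← h']; exact Or.inr ⟨h1, h2⟩
      · exact Or.inr ⟨h1, h2'⟩

theorem circle_end (v : D.Vertex) (c : Fin D.crossings) (i : Fin 4) :
    Quot.mk (D.Step v) (Sum.inl (c, i)) = Quot.mk _ (Sum.inl (c, 0)) ∨
      Quot.mk (D.Step v) (Sum.inl (c, i)) = Quot.mk _ (Sum.inl (c, 2)) := by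
  have h : Quot.mk (D.Step v) (Sum.inl (c, i)) = Quot.mk _ (Sum.inl (c, smooth (v c) i)) :=
    Quot.sound (Or.inr ⟨c, i, rfl, rfl⟩)
  have h' : ∀ (b : Bool) (i : Fin 4), i = 0 ∨ i = 2 ∨ smooth b i = 0 ∨ smooth b i = 2 := by decide
  rcases h' (v c) i with h1 | h1 | h1 | h1
  · rw [h1]; exact Or.inl rfl
  · rw [h1]; exact Or.inr rfl
  · rw [h1] at h; exact Or.inl h
  · rw [h1] at h; exact Or.inr h

open scoped Classical in
/-- The number of circles of `v` on a component of a saddle at `c`. -/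
theorem card_circles {r : D.Point → D.Point → Prop} {v : D.Vertex} {c : Fin D.crossings}
    (hr : ∀ x y, r x y → D.Step v x y ∨ ∃ i j, x = Sum.inl (c, i) ∧ y = Sum.inl (c, j))
    (hr' : ∀ x y, D.Step v x y → r x y)
    (hc : ∀ i, Quot.mk r (Sum.inl (c, i)) = Quot.mk r (Sum.inl (c, 0))) (q : Quot r) :
    (Finset.univ.filter fun s : Quot (D.Step v) => Quot.map id hr' s = q).card =
      if Quot.mk r (Sum.inl (c, 0)) = q then
        (if Quot.mk (D.Step v) (Sum.inl (c, 0)) = Quot.mk _ (Sum.inl (c, 2)) then 1 else 2)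
      else 1 := by
  by_cases hq : Quot.mk r (Sum.inl (c, 0)) = q
  · rw [if_pos hq]
    have hset : (Finset.univ.filter fun s : Quot (D.Step v) => Quot.map id hr' s = q) =
        {Quot.mk _ (Sum.inl (c, 0)), Quot.mk _ (Sum.inl (c, 2))} := by
      ext s
      obtain ⟨x, rfl⟩ := Quot.exists_rep s
      simp only [Finset.mem_filter, Finset.mem_univ, true_and, Finset.mem_insert,
        Finset.mem_singleton]
      constructor
      · intro h
        rcases eqvGen_step₂ hr (Quot.eqvGen_exact (h.trans hq.symm)) with h' | ⟨⟨i, hi⟩, _⟩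
        · exact Or.inl h'
        · have hi' : Quot.mk (D.Step v) x = Quot.mk _ (Sum.inl (c, i)) := hi
          rw [hi']; exact circle_end v c i
      · rintro (h | h)
        · exact (congrArg (Quot.map id hr') h).trans hq
        · exact (congrArg (Quot.map id hr') h).trans ((hc 2).trans hq)
    rw [hset]
    split_ifs with hs
    · rw [hs, Finset.pair_eq_singleton, Finset.card_singleton]
    · rw [Finset.card_pair hs]
  · rw [if_neg hq]
    obtain ⟨y, rfl⟩ := Quot.exists_rep q
    rw [Finset.card_eq_one]
    refine ⟨Quot.mk _ y, ?_⟩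
    ext s
    obtain ⟨x, rfl⟩ := Quot.exists_rep s
    simp only [Finset.mem_filter, Finset.mem_univ, true_and, Finset.mem_singleton]
    constructor
    · intro h
      rcases eqvGen_step₂ hr (Quot.eqvGen_exact h) with h' | ⟨_, ⟨i, hi⟩⟩
      · exact h'
      · refine absurd ?_ hq
        rw [← hc i]
        exact (congrArg (Quot.map id hr') hi).symm
    · intro h
      exact congrArg (Quot.map id hr') h

theorem step₂_end {v w : D.Vertex} {c : Fin D.crossings} (h : v c = false) (h' : w c = true)
    (i : Fin 4) : Quot.mk (D.Step₂ v w) (Sum.inl (c, i)) = Quot.mk _ (Sum.inl (c, 0)) := by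
  have e1 : ∀ i, Quot.mk (D.Step₂ v w) (Sum.inl (c, i)) = Quot.mk _ (Sum.inl (c, smooth false i)) :=
    fun i => Quot.sound (Or.inl (Or.inr ⟨c, i, rfl, by rw [h]⟩))
  have e2 : ∀ i, Quot.mk (D.Step₂ v w) (Sum.inl (c, i)) = Quot.mk _ (Sum.inl (c, smooth true i)) :=
    fun i => Quot.sound (Or.inr (Or.inr ⟨c, i, rfl, by rw [h']⟩))
  fin_cases i
  · rfl
  · exact e1 1
  · exact (e2 2).trans (e1 1)
  · exact e2 3

open scoped Classical in
/-- A saddle consists of a pair of pants and cylinders. -/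
theorem euler_saddle (v w : D.Vertex) (c : Fin D.crossings) (hv : v c = false)
    (hw : w = Function.update v c true) (q : Quot (D.Step₂ v w)) :
    (D.saddle v w).euler q = if Quot.mk _ (Sum.inl (c, 0)) = q then -1 else 0 := by
  have hwc : w c = true := by rw [hw, Function.update_self]
  have hne : ∀ d, d ≠ c → v d = w d := fun d hd => by rw [hw, Function.update_of_ne hd]
  have h1 := card_circles (r := D.Step₂ v w) (v := v) (c := c)
    (fun x y h => h.elim Or.inl (step_of_ne hne)) (fun _ _ => Or.inl) (step₂_end hv hwc) q
  have h2 := card_circles (r := D.Step₂ v w) (v := w) (c := c)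
    (fun x y h => h.elim (step_of_ne fun d hd => (hne d hd).symm) Or.inl) (fun _ _ => Or.inr)
    (step₂_end hv hwc) q
  have h3 := circle_xor v c hv
  rw [← hw] at h3
  have h1' : (Finset.univ.filter fun s => (D.saddle v w).inn s = q).card = _ := h1
  have h2' : (Finset.univ.filter fun s => (D.saddle v w).out s = q).card = _ := h2
  have hg : (D.saddle v w).genus q = 0 := rfl
  unfold Surface.euler
  rw [h1', h2', hg]
  by_cases hq : Quot.mk (D.Step₂ v w) (Sum.inl (c, 0)) = q
  · simp only [if_pos hq]
    by_cases h4 : Quot.mk (D.Step v) (Sum.inl (c, 0)) = Quot.mk _ (Sum.inl (c, 2))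
    · rw [if_pos h4, if_neg (fun h => h3.1 h h4)]; norm_num
    · rw [if_neg h4, if_pos (h3.2 h4)]; norm_num
  · simp only [if_neg hq]; norm_num

/-- Components of a composite of two saddles. -/
def twoSaddles {v w u : D.Vertex} (h : ∀ c, w c = v c ∨ w c = u c) :
    Surface.GlueComp (D.saddle v w) (D.saddle w u) ≃ Quot (D.Step₂ v u) where
  toFun := Quot.lift (Sum.elim
      (Quot.lift (Quot.mk _) (by
        rintro x y (h' | ⟨z, rfl, rfl⟩ | ⟨c, i, rfl, rfl⟩)
        · exact Quot.sound (Or.inl h')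
        · exact Quot.sound (Or.inl (Or.inl ⟨z, rfl, rfl⟩))
        · rcases h c with h | h
          · rw [h]; exact Quot.sound (Or.inl (Or.inr ⟨c, i, rfl, rfl⟩))
          · rw [h]; exact Quot.sound (Or.inr (Or.inr ⟨c, i, rfl, rfl⟩))))
      (Quot.lift (Quot.mk _) (by
        rintro x y ((⟨z, rfl, rfl⟩ | ⟨c, i, rfl, rfl⟩) | h')
        · exact Quot.sound (Or.inl (Or.inl ⟨z, rfl, rfl⟩))
        · rcases h c with h | h
          · rw [h]; exact Quot.sound (Or.inl (Or.inr ⟨c, i, rfl, rfl⟩))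
          · rw [h]; exact Quot.sound (Or.inr (Or.inr ⟨c, i, rfl, rfl⟩))
        · exact Quot.sound (Or.inr h'))))
    (by
      rintro _ _ ⟨⟨t⟩, rfl, rfl⟩
      rfl)
  invFun := Quot.lift (fun x => Quot.mk _ (Sum.inl (Quot.mk _ x))) (by
    rintro x y (h' | h')
    · exact congrArg (fun z => Quot.mk _ (Sum.inl z)) (Quot.sound (Or.inl h'))
    · have e : ∀ x, (Quot.mk _ (Sum.inl (Quot.mk _ x)) :
          Surface.GlueComp (D.saddle v w) (D.saddle w u)) = Quot.mk _ (Sum.inr (Quot.mk _ x)) :=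
        fun x => Quot.sound ⟨Quot.mk _ x, rfl, rfl⟩
      rw [e, e]
      exact congrArg (fun z => Quot.mk _ (Sum.inr z)) (Quot.sound (Or.inr h')))
  left_inv := by
    rintro ⟨⟨⟨x⟩⟩ | ⟨⟨x⟩⟩⟩
    · rfl
    · exact Quot.sound ⟨Quot.mk _ x, rfl, rfl⟩
  right_inv := by rintro ⟨x⟩; rfl

open scoped Classical in
theorem euler_twoSaddles (v : D.Vertex) (c d : Fin D.crossings) (hcd : c ≠ d) (hc : v c = false)
    (hd : v d = false) (w u : D.Vertex) (hw : w = Function.update v c true)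
    (hu : u = Function.update w d true) (h : ∀ c, w c = v c ∨ w c = u c)
    (q : Surface.GlueComp (D.saddle v w) (D.saddle w u)) :
    ((D.saddle v w).glue (D.saddle w u)).euler q =
      (if Quot.mk _ (Sum.inl (c, 0)) = twoSaddles h q then -1 else 0) +
        if Quot.mk _ (Sum.inl (d, 0)) = twoSaddles h q then -1 else 0 := by
  have hwd : w d = false := by rw [hw, Function.update_of_ne hcd.symm, hd]
  rw [Surface.euler_glue]
  have a1 : ∀ x : D.Point, (Quot.mk _ x = twoSaddles h q) ↔ ((Quot.mk _ (Sum.inl (Quot.mk _ x)) :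
      Surface.GlueComp (D.saddle v w) (D.saddle w u)) = q) := fun x =>
    (twoSaddles h).apply_eq_iff_eq (x := Quot.mk _ (Sum.inl (Quot.mk _ x))) (y := q)
  have a2 : ∀ x : D.Point, (Quot.mk _ x = twoSaddles h q) ↔ ((Quot.mk _ (Sum.inr (Quot.mk _ x)) :
      Surface.GlueComp (D.saddle v w) (D.saddle w u)) = q) := fun x =>
    (twoSaddles h).apply_eq_iff_eq (x := Quot.mk _ (Sum.inr (Quot.mk _ x))) (y := q)
  congr 1
  · have e : ∀ p : Quot (D.Step₂ v w), (D.saddle v w).euler p =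
        if Quot.mk _ (Sum.inl (c, 0)) = p then -1 else 0 := euler_saddle v w c hc hw
    simp only [e, a1]
    rw [Finset.sum_eq_single (Quot.mk (D.Step₂ v w) (Sum.inl (c, 0)))]
    · simp
    · intro p _ hp
      rw [if_neg (Ne.symm hp), ite_self]
    · simp
  · have e : ∀ p : Quot (D.Step₂ w u), (D.saddle w u).euler p =
        if Quot.mk _ (Sum.inl (d, 0)) = p then -1 else 0 := euler_saddle w u d hwd hu
    simp only [e, a2]
    rw [Finset.sum_eq_single (Quot.mk (D.Step₂ w u) (Sum.inl (d, 0)))]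
    · simp
    · intro p _ hp
      rw [if_neg (Ne.symm hp), ite_self]
    · simp

theorem saddle_square (v : D.Vertex) (c d : Fin D.crossings) (hcd : c ≠ d) (hc : v c = false)
    (hd : v d = false) (a b u : D.Vertex) (ha : a = Function.update v c true)
    (hb : b = Function.update v d true) (hu : u = Function.update a d true)
    (hu' : u = Function.update b c true) :
    ((D.saddle v a).glue (D.saddle a u)).Homeo ((D.saddle v b).glue (D.saddle b u)) := by
  have h1 : ∀ e, a e = v e ∨ a e = u e := fun e => by
    by_cases he : e = c
    · right; rw [hu, he, Function.update_of_ne hcd]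
    · left; rw [ha, Function.update_of_ne he]
  have h2 : ∀ e, b e = v e ∨ b e = u e := fun e => by
    by_cases he : e = d
    · right; rw [hu', he, Function.update_of_ne hcd.symm]
    · left; rw [hb, Function.update_of_ne he]
  let φ := (twoSaddles h1).trans (twoSaddles h2).symm
  refine Surface.homeo_of_euler φ ?_ ?_ ?_
  · rintro ⟨x⟩; rfl
  · rintro ⟨x⟩
    exact (Quot.sound ⟨Quot.mk _ x, rfl, rfl⟩ : (Quot.mk _ (Sum.inl (Quot.mk _ x)) :
      Surface.GlueComp (D.saddle v b) (D.saddle b u)) = Quot.mk _ (Sum.inr (Quot.mk _ x)))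
  · intro q
    have e1 := euler_twoSaddles v c d hcd hc hd a u ha hu h1 q
    have e2 := euler_twoSaddles v d c hcd.symm hd hc b u hb hu' h2 (φ q)
    have e3 : twoSaddles h2 (φ q) = twoSaddles h1 q := (twoSaddles h2).apply_symm_apply _
    rw [e3] at e2
    rw [e1, add_comm]
    exact e2

end LinkDiagram

/-! ### The geometric complex -/

namespace LinkDiagram

variable (D : LinkDiagram)

/-- The homological degree of a vertex of the cube: the number of `1`-smoothings minus the number of
negative crossings. -/
def height (v : D.Vertex) : ℤ :=
  (Finset.univ.filter fun c => v c = true).card -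
    (Finset.univ.filter fun c => D.positive c = false).card

/-- The sign of the edge of the cube which starts at `v` and changes the smoothing of `c`. -/
def edgeSign (v : D.Vertex) (c : Fin D.crossings) : ℤ :=
  (-1) ^ (Finset.univ.filter fun d => d < c ∧ v d = true).card

theorem height_update {v : D.Vertex} {c : Fin D.crossings} (h : v c = false) :
    D.height (Function.update v c true) = D.height v + 1 := by
  have h1 : (Finset.univ.filter fun d => Function.update v c true d = true) =
      insert c (Finset.univ.filter fun d => v d = true) := by
    ext d
    by_cases hd : d = c
    · subst hd; simp
    · simp [hd]
  unfold height
  rw [h1, Finset.card_insert_of_notMem (by simp [h])]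
  push_cast
  ring

theorem edgeSign_anticomm {v : D.Vertex} {c d : Fin D.crossings} (hcd : c ≠ d) (hc : v c = false)
    (hd : v d = false) :
    D.edgeSign v c * D.edgeSign (Function.update v c true) d =
      -(D.edgeSign v d * D.edgeSign (Function.update v d true) c) := by
  have key : ∀ {c d : Fin D.crossings}, c < d → v c = false →
      D.edgeSign (Function.update v c true) d = -D.edgeSign v d ∧
      D.edgeSign (Function.update v d true) c = D.edgeSign v c := by
    intro c d hlt hc
    unfold edgeSign
    constructor
    · have h1 : (Finset.univ.filter fun e => e < d ∧ Function.update v c true e = true) =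
          insert c (Finset.univ.filter fun e => e < d ∧ v e = true) := by
        ext e
        by_cases he : e = c
        · subst he; simp [hlt]
        · simp [he]
      rw [h1, Finset.card_insert_of_notMem (by simp [hc]), pow_succ]
      ring
    · congr 2
      ext e
      by_cases he : e = d
      · subst he; simp [not_lt.2 hlt.le]
      · simp [Function.update_of_ne he]
  rcases lt_or_gt_of_ne hcd with h | h
  · obtain ⟨h1, h2⟩ := key h hc
    rw [h1, h2]; ring
  · obtain ⟨h1, h2⟩ := key h hd
    rw [h1, h2]; ring

section Cube

universe v u

variable {C : Type u} [Category.{v} C] [Preadditive C]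
variable (X : D.Vertex → C) (E : ∀ a b : D.Vertex, X a ⟶ X b)

/-- The column of the objects of the cube in degree `r`. -/
abbrev cubeObj (r : ℤ) : Mat_ C where
  ι := {a : D.Vertex // D.height a = r}
  X a := X a.1

/-- The matrix of the signed edges of the cube. -/
def cubeD (r : ℤ) : D.cubeObj X r ⟶ D.cubeObj X (r + 1) :=
  fun a b => ∑ c, if a.1 c = false ∧ b.1 = Function.update a.1 c true then
    D.edgeSign a.1 c • E a.1 b.1 else 0

/-- The squares of the cube commute. -/
def CubeCommutes : Prop :=
  ∀ (a : D.Vertex) (c d : Fin D.crossings) (b b' e : D.Vertex), c ≠ d → a c = false → a d = false →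
    b = Function.update a c true → b' = Function.update a d true → e = Function.update b d true →
    e = Function.update b' c true → E a b ≫ E b e = E a b' ≫ E b' e

variable {X E}

theorem cubeD_comp (h : D.CubeCommutes X E) (r : ℤ) :
    D.cubeD X E r ≫ D.cubeD X E (r + 1) = 0 := by
  apply Mat_.hom_ext
  rintro ⟨a, ha⟩ ⟨e, he⟩
  rw [Mat_.comp_apply]
  show ∑ b : {b : D.Vertex // D.height b = r + 1},
    (∑ c, if a c = false ∧ b.1 = Function.update a c true then D.edgeSign a c • E a b.1 else 0) ≫
    (∑ d, if b.1 d = false ∧ e = Function.update b.1 d true then D.edgeSign b.1 d • E b.1 e else 0)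
      = 0
  let T : Fin D.crossings × Fin D.crossings → (X a ⟶ X e) := fun p =>
    if a p.1 = false ∧ Function.update a p.1 true p.2 = false ∧
        e = Function.update (Function.update a p.1 true) p.2 true then
      (D.edgeSign a p.1 * D.edgeSign (Function.update a p.1 true) p.2) •
        (E a (Function.update a p.1 true) ≫ E (Function.update a p.1 true) e) else 0
  have h1 : (∑ b : {b : D.Vertex // D.height b = r + 1},
      (∑ c, if a c = false ∧ b.1 = Function.update a c true then D.edgeSign a c • E a b.1 else 0) ≫
      (∑ d, if b.1 d = false ∧ e = Function.update b.1 d true then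
        D.edgeSign b.1 d • E b.1 e else 0)) = ∑ p, T p := by
    rw [Fintype.sum_prod_type]
    have hexp : ∀ b : {b : D.Vertex // D.height b = r + 1}, (∑ c, if a c = false ∧
        b.1 = Function.update a c true then D.edgeSign a c • E a b.1 else 0) ≫
        (∑ d, if b.1 d = false ∧ e = Function.update b.1 d true then
          D.edgeSign b.1 d • E b.1 e else 0) =
        ∑ c, ∑ d, (if a c = false ∧ b.1 = Function.update a c true then
          D.edgeSign a c • E a b.1 else 0) ≫ (if b.1 d = false ∧ e = Function.update b.1 d true then
          D.edgeSign b.1 d • E b.1 e else 0) := fun b => by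
      rw [Preadditive.sum_comp]
      exact Finset.sum_congr rfl fun c _ => Preadditive.comp_sum _ _ _
    rw [Finset.sum_congr rfl fun b _ => hexp b]
    rw [Finset.sum_comm]
    refine Finset.sum_congr rfl fun c _ => ?_
    rw [Finset.sum_comm]
    refine Finset.sum_congr rfl fun d _ => ?_
    by_cases hc : a c = false
    · rw [Finset.sum_eq_single (⟨Function.update a c true, by rw [D.height_update hc, ha]⟩ :
        {b : D.Vertex // D.height b = r + 1})]
      · simp only [T, hc, true_and, if_true]
        split_ifs with h2
        · rw [Preadditive.zsmul_comp, Preadditive.comp_zsmul, smul_smul]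
        · rw [Limits.comp_zero]
      · intro b _ hb
        rw [if_neg, Limits.zero_comp]
        rintro ⟨_, h3⟩
        exact hb (Subtype.ext h3)
      · intro h3; exact absurd (Finset.mem_univ _) h3
    · rw [Finset.sum_eq_zero]
      · simp only [T]; rw [if_neg (fun h3 => hc h3.1)]
      · intro b _
        rw [if_neg (fun h3 => hc h3.1), Limits.zero_comp]
  rw [h1]
  have hcond : ∀ p : Fin D.crossings × Fin D.crossings, T p ≠ 0 → p.1 ≠ p.2 ∧ a p.1 = false ∧
      a p.2 = false ∧ e = Function.update (Function.update a p.1 true) p.2 true := by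
    rintro ⟨c, d⟩ hp
    have h2 : a c = false ∧ Function.update a c true d = false ∧
        e = Function.update (Function.update a c true) d true := by
      by_contra h2
      exact hp (if_neg h2)
    obtain ⟨h3, h4, h5⟩ := h2
    have hcd : c ≠ d := by rintro rfl; simp at h4
    rw [Function.update_of_ne hcd.symm] at h4
    exact ⟨hcd, h3, h4, h5⟩
  refine Finset.sum_involution (fun p _ => (p.2, p.1)) ?_ ?_ (fun _ _ => Finset.mem_univ _)
    (fun _ _ => rfl)
  · have hval : ∀ c d, c ≠ d → a c = false → a d = false →
        e = Function.update (Function.update a c true) d true → T (c, d) =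
        (D.edgeSign a c * D.edgeSign (Function.update a c true) d) •
        (E a (Function.update a c true) ≫ E (Function.update a c true) e) := fun c d hcd hc hd hE =>
      if_pos ⟨hc, by show Function.update a c true d = false; rw [Function.update_of_ne hcd.symm, hd], hE⟩
    have main : ∀ c d, T (c, d) ≠ 0 → T (c, d) + T (d, c) = 0 := by
      intro c d hp
      obtain ⟨hcd, hc, hd, hE⟩ := hcond _ hp
      have hE' : e = Function.update (Function.update a d true) c true := by
        rw [hE]; exact Function.update_comm hcd _ _ _
      rw [hval c d hcd hc hd hE, hval d c hcd.symm hd hc hE',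
        h a c d _ _ e hcd hc hd rfl rfl hE hE', D.edgeSign_anticomm hcd hc hd, neg_smul,
        neg_add_cancel]
    rintro ⟨c, d⟩ _
    show T (c, d) + T (d, c) = 0
    by_cases hp : T (c, d) = 0
    · by_cases hp' : T (d, c) = 0
      · rw [hp, hp', add_zero]
      · rw [add_comm]; exact main d c hp'
    · exact main c d hp
  · rintro ⟨c, d⟩ _ hp hfix
    exact (hcond _ hp).1 (congrArg Prod.snd hfix)

/-- The complex of columns and matrices obtained by flattening a commutative cube. -/
def cubeComplex (h : D.CubeCommutes X E) : CochainComplex (Mat_ C) ℤ :=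
  CochainComplex.of (D.cubeObj X) (D.cubeD X E) (D.cubeD_comp h)

end Cube

theorem mor_square : D.CubeCommutes (fun a => (D.circles a).obj) fun a b => mor (D.saddle a b) := by
  intro a c d b b' e hcd hc hd h1 h2 h3 h4
  rw [mor_comp, mor_comp]
  exact mor_eq_of_homeo (D.saddle_square a c d hcd hc hd b b' e h1 h2 h3 h4)

/-- The geometric complex of a link diagram, a complex over `Mat(Cob_{/l})`. -/
def geometricComplex : CochainComplex (Mat_ Cobl) ℤ := D.cubeComplex D.mor_square

variable {D}

/-- The circles of a smoothing, the special one being the circle through the marked point. -/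
abbrev pointedCircles (p : D.Point) (a : D.Vertex) : PointedCircles :=
  ⟨D.circles a, Quot.mk _ p⟩

/-- The saddles preserve the special component. -/
def pointedSaddle (p : D.Point) (a b : D.Vertex) : pointedCircles p a ⟶ pointedCircles p b :=
  ⟨mor (D.saddle a b), AddSubgroup.subset_closure ⟨D.saddle a b, rfl, rfl⟩⟩

theorem pointed_square (p : D.Point) : D.CubeCommutes (pointedCircles p) (pointedSaddle p) :=
  fun a c d b b' e hcd hc hd h1 h2 h3 h4 =>
    Subtype.ext (D.mor_square a c d b b' e hcd hc hd h1 h2 h3 h4)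

/-- The geometric complex of a link diagram marked at the point `p`, as a complex over the
category of circles with a special circle. -/
def pointedComplex (p : D.Point) : CochainComplex (Mat_ PointedCircles) ℤ :=
  D.cubeComplex (pointed_square p)

end LinkDiagram

/-! ### Link homology theories -/

section Functors

open Limits

universe v u v' u'

variable {C : Type u} [Category.{v} C] [Preadditive C]
variable {A : Type u'} [Category.{v'} A] [Preadditive A] [HasFiniteBiproducts A]

/-- The extension of an additive functor to columns of objects and matrices of morphisms. -/
def onColumns (F : C ⥤ A) [F.Additive] : Mat_ C ⥤ A where
  obj M := ⨁ fun i => F.obj (M.X i)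
  map f := biproduct.matrix fun i j => F.map (f i j)
  map_id M := by
    classical
    ext i j
    by_cases h : j = i
    · subst h; simp
    · simp [Mat_.id_apply, h]
  map_comp f g := by
    ext i j
    simp [biproduct.lift_desc]

instance (F : C ⥤ A) [F.Additive] : (onColumns F).Additive where
  map_add {M N f g} := by
    apply biproduct.hom_ext'
    intro i
    apply biproduct.hom_ext
    intro j
    show (biproduct.ι _ i ≫ biproduct.matrix (fun i j => F.map ((f + g) i j))) ≫ biproduct.π _ j =
      (biproduct.ι _ i ≫ (biproduct.matrix (fun i j => F.map (f i j)) +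
        biproduct.matrix (fun i j => F.map (g i j)))) ≫ biproduct.π _ j
    simp

/-- The complex over `A` obtained by applying a functor to a complex of columns and matrices. -/
def applyFunctor (F : C ⥤ A) [F.Additive] (K : CochainComplex (Mat_ C) ℤ) : CochainComplex A ℤ :=
  ((onColumns F).mapHomologicalComplex _).obj K

end Functors

/-! ### The Frobenius system `A_H` -/

section Frobenius

open scoped TensorProduct
open Limits

/-- The ground ring `ℤ[H]`. -/
abbrev RH : Type := Polynomial ℤ

/-- The variable `H`. -/
abbrev H : RH := Polynomial.X

/-- The Frobenius algebra `A_H = ℤ[H][X]/(X² - HX)`. -/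
abbrev AH : Type := AdjoinRoot (Polynomial.X ^ 2 - Polynomial.C H * Polynomial.X : Polynomial RH)

/-- The generator `X` of `A_H`, also called `v₋`; the unit `1` is also called `v₊`. -/
abbrev vX : AH := AdjoinRoot.root _

/-- The tensor power of `A_H` with one factor for each circle. -/
abbrev APow (S : Circles) : Type := ⨂[RH] _ : S, AH

/-- The pure tensor on the collection `S ⊔ {k circles}` with factors `a` on `S` and `b` on the new
circles. -/
abbrev pureTensor {S : Circles} {k : ℕ} (a : S → AH) (b : Fin k → AH) : APow (S.add k) :=
  PiTensorProduct.tprod RH (Sum.elim a b)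

/-- The identity cobordism of `S` together with one genus zero component which has `m` incoming
and `n` outgoing circles. -/
def withSphere (S : Circles) (m n : ℕ) : Surface (S.add m) (S.add n) where
  comp := S ⊕ Unit
  inn := Sum.map id fun _ => ()
  out := Sum.map id fun _ => ()
  genus _ := 0

/-- The TQFT `F_H` of the Frobenius system `A_H`, as a functor on `Cob_{/l}`: a collection of circles is
sent to the tensor power of `A_H`, homeomorphisms of circles permute the factors, and discs and
pairs of pants act by the unit, counit, multiplication and comultiplication of `A_H`. -/
structure FrobeniusTQFT where
  F : Cobl ⥤ ModuleCat.{0} RH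
  additive : F.Additive
  /-- The module of a collection of circles. -/
  e : ∀ S : Circles, F.obj S.obj ≃ₗ[RH] APow S
  relabel : ∀ {S T : Circles} (σ : S ≃ T) (a : S → AH),
    e T (F.map (mor (Surface.cylinder σ)) ((e S).symm (PiTensorProduct.tprod RH a))) =
      PiTensorProduct.tprod RH fun t => a (σ.symm t)
  /-- Birth of a circle: `1 ↦ v₊`. -/
  unit : ∀ (S : Circles) (a : S → AH),
    e _ (F.map (mor (withSphere S 0 1)) ((e _).symm (pureTensor a ![]))) = pureTensor a ![1]
  /-- Death of a circle: `v₊ ↦ 0`. -/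
  counit_one : ∀ (S : Circles) (a : S → AH),
    e _ (F.map (mor (withSphere S 1 0)) ((e _).symm (pureTensor a ![1]))) = 0
  /-- Death of a circle: `v₋ ↦ 1`. -/
  counit_X : ∀ (S : Circles) (a : S → AH),
    e _ (F.map (mor (withSphere S 1 0)) ((e _).symm (pureTensor a ![vX]))) = pureTensor a ![]
  /-- Two circles merge: multiplication of `A_H`. -/
  mul : ∀ (S : Circles) (a : S → AH) (x y : AH),
    e _ (F.map (mor (withSphere S 2 1)) ((e _).symm (pureTensor a ![x, y]))) = pureTensor a ![x * y]
  /-- A circle splits: `v₊ ↦ v₊ ⊗ v₋ + v₋ ⊗ v₊ - H v₊ ⊗ v₊`. -/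
  comul_one : ∀ (S : Circles) (a : S → AH),
    e _ (F.map (mor (withSphere S 1 2)) ((e _).symm (pureTensor a ![1]))) =
      pureTensor a ![1, vX] + pureTensor a ![vX, 1] - H • pureTensor a ![1, 1]
  /-- A circle splits: `v₋ ↦ v₋ ⊗ v₋`. -/
  comul_X : ∀ (S : Circles) (a : S → AH),
    e _ (F.map (mor (withSphere S 1 2)) ((e _).symm (pureTensor a ![vX]))) = pureTensor a ![vX, vX]

/-- The property of being a free `ℤ[H]`-module of finite rank. -/
def isFreeModule : ObjectProperty (ModuleCat.{0} RH) := fun M =>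
  Module.Free RH M ∧ Module.Finite RH M

/-- The category of free `ℤ[H]`-modules of finite rank. -/
abbrev FreeModules : Type 1 := isFreeModule.FullSubcategory

instance : isFreeModule.IsClosedUnderIsomorphisms where
  of_iso {M N} i h := by
    obtain ⟨h1, h2⟩ := h
    exact ⟨Module.Free.of_equiv i.toLinearEquiv, Module.Finite.equiv i.toLinearEquiv⟩

instance : isFreeModule.IsClosedUnderFiniteProducts where
  isClosedUnderLimitsOfShape J _ :=
    { limitsOfShape_le := by
        rintro M ⟨p⟩
        have hp : ∀ j, isFreeModule (p.diag.obj ⟨j⟩) := fun j => p.prop_diag_obj _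
        have h1 : ∀ j, Module.Free RH (p.diag.obj ⟨j⟩) := fun j => (hp j).1
        have h2 : ∀ j, Module.Finite RH (p.diag.obj ⟨j⟩) := fun j => (hp j).2
        let G : J → ModuleCat.{0} RH := fun j => p.diag.obj ⟨j⟩
        have hpi : isFreeModule (ModuleCat.of RH (∀ j, G j)) :=
          ⟨Module.Free.pi RH _, Module.Finite.pi⟩
        have i : M ≅ ModuleCat.of RH (∀ j, G j) :=
          (p.isLimit.conePointsIsoOfNatIso (limit.isLimit (Discrete.functor G))
            Discrete.natIsoFunctor) ≪≫ ModuleCat.piIsoPi G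
        exact isFreeModule.prop_of_iso i.symm hpi }

instance : HasFiniteProducts FreeModules := inferInstance

instance : HasFiniteBiproducts FreeModules := HasFiniteBiproducts.of_hasFiniteProducts

open scoped Classical in
/-- Multiplication by `X` on the tensor factor of the special circle. -/
def mulSpecial (P : PointedCircles) : APow P.circles →ₗ[RH] APow P.circles :=
  PiTensorProduct.map fun s => if s = P.special then LinearMap.mulLeft RH vX else LinearMap.id

/-- The co-reduced theory `F_H^co` of the TQFT `F_H`: the image of multiplication by `X` on the factor of
the special circle, with the maps induced by `F_H`. -/
structure CoreducedTheory (T : FrobeniusTQFT) where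
  F : PointedCircles ⥤ FreeModules
  additive : F.Additive
  incl : ∀ P : PointedCircles, (F.obj P).obj →ₗ[RH] APow P.circles
  incl_injective : ∀ P, Function.Injective (incl P)
  range_incl : ∀ P, LinearMap.range (incl P) = LinearMap.range (mulSpecial P)
  incl_map : ∀ {P Q : PointedCircles} (f : P ⟶ Q) (x : (F.obj P).obj),
    incl Q ((F.map f).hom x) = T.e _ (T.F.map f.1 ((T.e _).symm (incl P x)))

attribute [instance] FrobeniusTQFT.additive CoreducedTheory.additive

end Frobenius

end LinkHom

end

universe v u

noncomputable section

namespace LinkHom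

/-! ### Functors on columns and matrices -/

section Columns

open Limits

universe v' u' v'' u''

variable {C : Type u} [Category.{v} C]
variable {B : Type u'} [Category.{v'} B] [Preadditive B] [HasFiniteBiproducts B]
variable {A : Type u''} [Category.{v''} A] [Preadditive A] [HasFiniteBiproducts A]

/-! The heart of the matter is that the co-reduced functor `K.F` becomes an equivalence once it is
extended to columns and matrices (`isEquivalence_onColumns` applied to `K.F`). The three claims are
then formal. An additive equivalence preserves and reflects homotopy equivalences of complexes
(`homotopyEquiv_iff`). An additive functor `F` extends over `FreeModules` by inverting `onColumns
K.F` and applying `onColumns F` (`extension`), and uniqueness follows by cancelling the equivalence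
(`extension_unique`). A functor on all of `Cobl` is first restricted along `forgetSpecial`.

The equivalence rests on three facts. (a) The 4TU relation, with two sites at a neck and two on the
special component, cuts the neck without ever leaving the pointed category (`special_neck`). Hence
every identity is a sum of morphisms through one special circle (`id_mem_throughBase`), and full
faithfulness need only be checked on endomorphisms of that circle. (b) Closed components can be
traded for handles on the special component, so these endomorphisms are polynomials in the handle
operator (`baseAction_surjective`). (c) The functor sends the special circle to the free module of
rank one spanned by `X`, where the handle acts as comultiplication followed by multiplication: `X ↦
X ⊗ X ↦ X² = HX`. So a polynomial acts as the scalar which it is (`CoreducedTheory.map_baseAction`).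
No nonzero polynomial acts as zero, and every endomorphism of a rank one module is a scalar, which
gives `CoreducedTheory.map_end_bijective`. Finally, every finite free module is a sum of copies of
this rank one module. Only the axioms of the TQFT enter, so the argument covers every choice of `T`
and `K`.

Existence is proved by diagonalization. Over the fraction field of `ℤ[H]` the algebra splits through
the characters `X ↦ H` and `X ↦ 0`, and tensors embed into functions of two-colourings of the
circles (`evaluations_injective`). There a surface acts by a state sum over colourings of its
components, with weight a handle eigenvalue `±H` to the power genus plus outgoing circles minus one.
This exponent is additive under gluing, so functoriality is immediate (`Surface.stateSum_glue`), and
the local relations become identities between a few numbers. The remaining point is integrality: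
despite the negative powers of `H`, tensors go to tensors (`Surface.exists_localFactor`). The
co-reduced subspaces are preserved because a special surface gives both special circles the same
colour (`tensorMap_mulSpecial`). -/

theorem ι_matrix {ι κ : Type} [Fintype ι] [Fintype κ] {X : ι → A} {Y : κ → A}
    (f : ∀ i j, X i ⟶ Y j) (i : ι) :
    biproduct.ι X i ≫ biproduct.matrix f = ∑ j, f i j ≫ biproduct.ι Y j := by
  classical
  apply biproduct.hom_ext
  intro j
  simp [Preadditive.sum_comp, biproduct.ι_π, comp_dite]

/-- Two families of objects which are related by an additive functor have isomorphic sums. -/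
def biproductCompIso (F : C ⥤ A) (K : C ⥤ B) (G : B ⥤ A) [G.Additive]
    (α : F ≅ K ⋙ G) {ι : Type} [Fintype ι] (X : ι → C) :
    (⨁ fun i => F.obj (X i)) ≅ G.obj (⨁ fun i => K.obj (X i)) where
  hom := biproduct.desc fun i => α.hom.app (X i) ≫ G.map (biproduct.ι (fun i => K.obj (X i)) i)
  inv := biproduct.lift fun i => G.map (biproduct.π (fun i => K.obj (X i)) i) ≫ α.inv.app (X i)
  hom_inv_id := by
    classical
    apply biproduct.hom_ext'
    intro i
    apply biproduct.hom_ext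
    intro j
    simp only [biproduct.ι_desc_assoc, Category.assoc, biproduct.lift_π, Category.comp_id]
    rw [← G.map_comp_assoc, biproduct.ι_π, biproduct.ι_π]
    split_ifs with h
    · subst h; simp
    · simp
  inv_hom_id := by
    rw [biproduct.lift_desc]
    simp only [Category.assoc, Iso.inv_hom_id_app_assoc]
    simp only [← G.map_comp, ← G.map_sum, biproduct.total]
    exact G.map_id _

theorem biproductCompIso_naturality (F : C ⥤ A) (K : C ⥤ B) (G : B ⥤ A) [G.Additive]
    (α : F ≅ K ⋙ G) {ι κ : Type} [Fintype ι] [Fintype κ] {X : ι → C} {Y : κ → C}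
    (f : ∀ i j, X i ⟶ Y j) :
    biproduct.matrix (fun i j => F.map (f i j)) ≫ (biproductCompIso F K G α Y).hom =
      (biproductCompIso F K G α X).hom ≫ G.map (biproduct.matrix fun i j => K.map (f i j)) := by
  apply biproduct.hom_ext'
  intro i
  rw [reassoc_of% (ι_matrix fun i j => F.map (f i j))]
  unfold biproductCompIso
  rw [biproduct.ι_desc_assoc, Category.assoc, ← G.map_comp, ι_matrix,
    Preadditive.sum_comp, G.map_sum, Preadditive.comp_sum]
  refine Finset.sum_congr rfl fun j _ => ?_
  rw [Category.assoc, biproduct.ι_desc, G.map_comp]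
  exact α.hom.naturality_assoc (f i j) _

variable [Preadditive C]

/-- An additive functor commutes with the extension to columns and matrices. -/
def onColumnsCompIso (F : C ⥤ A) [F.Additive] (K : C ⥤ B) [K.Additive] (G : B ⥤ A) [G.Additive]
    (α : F ≅ K ⋙ G) : onColumns F ≅ onColumns K ⋙ G :=
  NatIso.ofComponents (fun M => biproductCompIso F K G α M.X)
    fun f => biproductCompIso_naturality F K G α f

/-- A sum over one object. -/
def biproductPUnit (X : A) : (⨁ fun _ : PUnit => X) ≅ X where
  hom := biproduct.desc fun _ => 𝟙 X
  inv := biproduct.lift fun _ => 𝟙 X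
  hom_inv_id := by
    apply biproduct.hom_ext'
    rintro ⟨⟩
    apply biproduct.hom_ext
    rintro ⟨⟩
    simp
  inv_hom_id := by rw [biproduct.lift_desc]; simp

theorem biproductPUnit_naturality {X Y : A} (f : X ⟶ Y) :
    biproduct.matrix (f := fun _ : PUnit => X) (g := fun _ : PUnit => Y) (fun _ _ => f) ≫
      (biproductPUnit Y).hom = (biproductPUnit X).hom ≫ f := by
  apply biproduct.hom_ext'
  rintro ⟨⟩
  rw [reassoc_of% (ι_matrix (X := fun _ : PUnit => X) (Y := fun _ : PUnit => Y) fun _ _ => f)]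
  simp [biproductPUnit]

/-- The restriction of `onColumns F` to single objects is `F`. -/
def embeddingOnColumns (F : C ⥤ A) [F.Additive] : Mat_.embedding C ⋙ onColumns F ≅ F :=
  NatIso.ofComponents (fun X => biproductPUnit (F.obj X)) fun f => biproductPUnit_naturality (F.map f)

theorem onColumns_faithful (K : C ⥤ B) [K.Additive] [K.Faithful] : (onColumns K).Faithful where
  map_injective {M N f g} h := by
    funext i j
    apply K.map_injective
    have h' := congrArg (fun φ => biproduct.ι (fun i => K.obj (M.X i)) i ≫ φ ≫
      biproduct.π (fun i => K.obj (N.X i)) j) h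
    simpa [onColumns] using h'

theorem onColumns_full (K : C ⥤ B) [K.Additive] [K.Full] : (onColumns K).Full where
  map_surjective {M N} f := by
    refine ⟨fun i j => K.preimage (biproduct.ι (fun i => K.obj (M.X i)) i ≫ f ≫
      biproduct.π (fun i => K.obj (N.X i)) j), ?_⟩
    have h : ∀ (g : (⨁ fun i => K.obj (M.X i)) ⟶ ⨁ fun i => K.obj (N.X i)),
        biproduct.matrix (fun i j => biproduct.ι (fun i => K.obj (M.X i)) i ≫ g ≫
          biproduct.π (fun i => K.obj (N.X i)) j) = g := fun g => by
      apply biproduct.hom_ext'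
      intro i
      apply biproduct.hom_ext
      intro j
      simp
    exact (congrArg biproduct.matrix (by funext i j; exact K.map_preimage _)).trans (h f)

/-- Full faithfulness passes to matrices entry by entry, and the hypothesis on `Y` is exactly
essential surjectivity from columns. -/
theorem isEquivalence_onColumns (K : C ⥤ B) [K.Additive] [K.Full] [K.Faithful]
    (h : ∀ Y : B, ∃ (n : ℕ) (X : Fin n → C), Nonempty ((⨁ fun i => K.obj (X i)) ≅ Y)) :
    (onColumns K).IsEquivalence :=
  have := onColumns_faithful K
  have := onColumns_full K
  have : (onColumns K).EssSurj :=
    ⟨fun Y => by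
      obtain ⟨n, X, i⟩ := h Y
      exact ⟨⟨Fin n, X⟩, i⟩⟩
  { }

/-! ### Extending additive functors along an equivalence on columns -/

variable (K : C ⥤ B) [K.Additive]

instance [(onColumns K).IsEquivalence] : (onColumns K).inv.Additive :=
  have : (onColumns K).asEquivalence.functor.Additive := inferInstanceAs (onColumns K).Additive
  inferInstanceAs (onColumns K).asEquivalence.inverse.Additive

/-- The extension of an additive functor along a functor whose extension to columns is an equivalence. -/
def extension [(onColumns K).IsEquivalence] (F : C ⥤ A) [F.Additive] : B ⥤ A :=
  (onColumns K).inv ⋙ onColumns F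

instance [(onColumns K).IsEquivalence] (F : C ⥤ A) [F.Additive] : (extension K F).Additive :=
  inferInstanceAs ((onColumns K).inv ⋙ onColumns F).Additive

/-- The extension restricts to the functor. -/
def extensionIso [(onColumns K).IsEquivalence] (F : C ⥤ A) [F.Additive] :
    F ≅ K ⋙ extension K F :=
  (embeddingOnColumns F).symm ≪≫
    Functor.isoWhiskerLeft (Mat_.embedding C)
      ((Functor.leftUnitor _).symm ≪≫
        Functor.isoWhiskerRight (onColumns K).asEquivalence.unitIso (onColumns F)) ≪≫
    Functor.isoWhiskerRight (embeddingOnColumns K) (extension K F)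

/-- After precomposition with `onColumns K` both functors become `onColumns F`, and an equivalence
can be cancelled. -/
theorem extension_unique [(onColumns K).IsEquivalence] (F : C ⥤ A) [F.Additive] (G G' : B ⥤ A)
    [G.Additive] [G'.Additive] (α : F ≅ K ⋙ G) (α' : F ≅ K ⋙ G') : Nonempty (G' ≅ G) := by
  let β : onColumns K ⋙ G' ≅ onColumns K ⋙ G :=
    (onColumnsCompIso F K G' α').symm ≪≫ onColumnsCompIso F K G α
  exact ⟨(Functor.leftUnitor _).symm ≪≫
    Functor.isoWhiskerRight (onColumns K).asEquivalence.counitIso.symm G' ≪≫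
    Functor.isoWhiskerLeft (onColumns K).inv β ≪≫
    Functor.isoWhiskerRight (onColumns K).asEquivalence.counitIso G ≪≫
    Functor.leftUnitor _⟩

variable {K}

/-- An isomorphism of functors extends to complexes. -/
def applyFunctorIso (F : C ⥤ A) [F.Additive] (G : B ⥤ A) [G.Additive] (α : F ≅ K ⋙ G)
    (L : CochainComplex (Mat_ C) ℤ) :
    applyFunctor F L ≅ (G.mapHomologicalComplex (ComplexShape.up ℤ)).obj (applyFunctor K L) :=
  (NatIso.mapHomologicalComplex (onColumnsCompIso F K G α) (ComplexShape.up ℤ)).app L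

/-- The equivalence and its inverse are both additive, so each acts on complexes and carries
homotopies along; the unit isomorphism leads back to the original complexes. -/
theorem homotopyEquiv_iff [(onColumns K).IsEquivalence] (L L' : CochainComplex (Mat_ C) ℤ) :
    Nonempty (HomotopyEquiv L L') ↔
      Nonempty (HomotopyEquiv (applyFunctor K L) (applyFunctor K L')) := by
  constructor
  · rintro ⟨h⟩
    exact ⟨(onColumns K).mapHomotopyEquiv h⟩
  · rintro ⟨h⟩
    let i := NatIso.mapHomologicalComplex (onColumns K).asEquivalence.unitIso (ComplexShape.up ℤ)
    have e : ∀ L, HomotopyEquiv L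
        (((onColumns K).inv.mapHomologicalComplex (ComplexShape.up ℤ)).obj (applyFunctor K L)) :=
      fun L => HomotopyEquiv.ofIso (i.app L)
    exact ⟨((e L).trans ((onColumns K).inv.mapHomotopyEquiv h)).trans (e L').symm⟩

theorem homotopyEquiv_of_factor (F : C ⥤ A) [F.Additive] (G : B ⥤ A) [G.Additive]
    (α : F ≅ K ⋙ G) (L L' : CochainComplex (Mat_ C) ℤ)
    (h : HomotopyEquiv (applyFunctor K L) (applyFunctor K L')) :
    Nonempty (HomotopyEquiv (applyFunctor F L) (applyFunctor F L')) :=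
  ⟨((HomotopyEquiv.ofIso (applyFunctorIso F G α L)).trans (G.mapHomotopyEquiv h)).trans
    (HomotopyEquiv.ofIso (applyFunctorIso F G α L')).symm⟩

/-- Forgetting which circle is special takes the complex of a marked diagram to the complex of the diagram. -/
theorem applyFunctor_forgetSpecial (F : Cobl ⥤ A) [F.Additive] (D : LinkDiagram) (p : D.Point) :
    Nonempty (applyFunctor F D.geometricComplex ≅
      applyFunctor (forgetSpecial ⋙ F) (LinkDiagram.pointedComplex p)) := by
  -- Both complexes have the same objects, by definition, so identities serve as components and only
  -- the differentials are compared.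
  refine ⟨HomologicalComplex.Hom.isoOfComponents (fun r => Iso.refl _) ?_⟩
  rintro r _ rfl
  have hd : ∀ a b, forgetSpecial.map (D.cubeD (LinkDiagram.pointedCircles p)
      (LinkDiagram.pointedSaddle p) r a b) = D.cubeD (fun a => (D.circles a).obj)
        (fun a b => mor (D.saddle a b)) r a b := fun a b => by
    unfold LinkDiagram.cubeD
    rw [forgetSpecial.map_sum]
    refine Finset.sum_congr rfl fun c _ => ?_
    split_ifs
    · rw [forgetSpecial.map_zsmul]; rfl
    · exact forgetSpecial.map_zero _ _
  have h : (applyFunctor F D.geometricComplex).d r (r + 1) =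
      (applyFunctor (forgetSpecial ⋙ F) (LinkDiagram.pointedComplex p)).d r (r + 1) := by
    show (onColumns F).map (CochainComplex.of.d (D.cubeObj fun a => (D.circles a).obj)
        (D.cubeD _ fun a b => mor (D.saddle a b)) r (r + 1)) =
      (onColumns (forgetSpecial ⋙ F)).map (CochainComplex.of.d
        (D.cubeObj (LinkDiagram.pointedCircles p))
        (D.cubeD _ (LinkDiagram.pointedSaddle p)) r (r + 1))
    rw [CochainComplex.of_d, CochainComplex.of_d]
    refine congrArg biproduct.matrix ?_
    funext a b
    exact congrArg F.map (hd a b).symm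
  exact (Category.id_comp _).trans (h.symm.trans (Category.comp_id _).symm)
end Columns

/-! ### Recognizing glued surfaces -/

open scoped Classical in
/-- The indicator of a proposition. -/
def ind (p : Prop) : ℤ := if p then 1 else 0

@[simp] theorem ind_true : ind True = 1 := if_pos trivial

@[simp] theorem ind_false : ind False = 0 := if_neg id

@[simp] theorem sum_ind_eq {α : Type} [Fintype α] (c : α) : ∑ a, ind (a = c) = 1 := by
  classical
  simp [ind]

@[simp] theorem sum_ind_eq_mul {α : Type} [Fintype α] (c : α) (f : α → ℤ) :
    ∑ a, ind (a = c) * f a = f c := by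
  classical
  simp [ind]

namespace Surface

/-- The genus plus the number of outgoing circles minus one; additive under gluing. -/
def excess {S T : Type} [Fintype T] (A : Surface S T) (c : A.comp) : ℤ :=
  A.genus c + (∑ t, ind (A.out t = c)) - 1

-- Twice the excess is minus the Euler characteristic, minus the number of incoming circles, plus
-- the number of outgoing ones. The Euler characteristic is additive, and the glued circles are
-- outgoing for `A` and incoming for `B`, so they cancel.
open scoped Classical in
theorem excess_glue {S T U : Type} [Fintype S] [Fintype T] [Fintype U]
    (A : Surface S T) (B : Surface T U) (k : GlueComp A B) :
    (glue A B).excess k =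
      (∑ c, if (Quot.mk _ (Sum.inl c) : GlueComp A B) = k then A.excess c else 0) +
      ∑ c, if (Quot.mk _ (Sum.inr c) : GlueComp A B) = k then B.excess c else 0 := by
  have he : ∀ {S T : Type} [Fintype S] [Fintype T] (A : Surface S T) (c : A.comp),
      2 * A.excess c = - A.euler c - (Finset.univ.filter fun s => A.inn s = c).card +
        (Finset.univ.filter fun t => A.out t = c).card := by
    intro S T _ _ A c
    unfold excess euler ind
    rw [Finset.card_filter, Finset.card_filter]
    push_cast
    ring
  have hm : ∀ t, (Quot.mk _ (Sum.inr (B.inn t)) : GlueComp A B) = Quot.mk _ (Sum.inl (A.out t)) :=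
    fun t => (Quot.sound ⟨t, rfl, rfl⟩).symm
  have e1 := sum_card_fibre A.inn (fun c => (Quot.mk _ (Sum.inl c) : GlueComp A B)) k
  have e2 := sum_card_fibre A.out (fun c => (Quot.mk _ (Sum.inl c) : GlueComp A B)) k
  have e3 := sum_card_fibre B.inn (fun c => (Quot.mk _ (Sum.inr c) : GlueComp A B)) k
  have e4 := sum_card_fibre B.out (fun c => (Quot.mk _ (Sum.inr c) : GlueComp A B)) k
  simp only [hm] at e3
  have split : ∀ {γ : Type} [Fintype γ] (p : γ → Prop) (f a b : γ → ℤ),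
      (∑ c, if p c then - f c - a c + b c else 0) =
      -(∑ c, if p c then f c else 0) - (∑ c, if p c then a c else 0)
        + (∑ c, if p c then b c else 0) := by
    intro γ _ p f a b
    rw [← Finset.sum_neg_distrib, ← Finset.sum_sub_distrib, ← Finset.sum_add_distrib]
    refine Finset.sum_congr rfl fun c _ => ?_
    split_ifs <;> ring
  have h := euler_glue A B k
  have key : 2 * (glue A B).excess k =
      2 * ((∑ c, if (Quot.mk _ (Sum.inl c) : GlueComp A B) = k then A.excess c else 0) +
      ∑ c, if (Quot.mk _ (Sum.inr c) : GlueComp A B) = k then B.excess c else 0) := by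
    rw [mul_add, Finset.mul_sum, Finset.mul_sum]
    simp only [mul_ite, mul_zero, he]
    rw [split, split, e1, e2, e3, e4, h]
    ring
  omega

/-- Components, boundary and excess determine a surface. -/
theorem homeo_of_excess {S T : Type} [Fintype T] {A B : Surface S T}
    (φ : A.comp ≃ B.comp) (h1 : ∀ s, φ (A.inn s) = B.inn s) (h2 : ∀ t, φ (A.out t) = B.out t)
    (h3 : ∀ c, B.excess (φ c) = A.excess c) : A.Homeo B := by
  refine ⟨φ, h1, h2, fun c => ?_⟩
  have h := h3 c
  unfold excess at h
  simp only [← h2, EmbeddingLike.apply_eq_iff_eq] at h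
  omega

/-- A glued surface is recognized by a map of its pieces to the components. -/
theorem glue_homeo {S T U X Y Z : Type} [Fintype S] [Fintype T] [Fintype U] [Fintype X] [Fintype Y]
    [Fintype Z] {iA : S → X} {oA : T → X} {gA : X → ℕ} {iB : T → Y} {oB : U → Y} {gB : Y → ℕ}
    {iC : S → Z} {oC : U → Z} {gC : Z → ℕ} (π : X ⊕ Y → Z) (σ : Z → X ⊕ Y)
    {eA : X → ℤ} {eB : Y → ℤ} {eC : Z → ℤ} (hA : ∀ a, (Surface.mk X iA oA gA).excess a = eA a)
    (hB : ∀ b, (Surface.mk Y iB oB gB).excess b = eB b)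
    (hC : ∀ c, (Surface.mk Z iC oC gC).excess c = eC c)
    (hin : ∀ s, π (Sum.inl (iA s)) = iC s) (hout : ∀ u, π (Sum.inr (oB u)) = oC u)
    (hmid : ∀ t, π (Sum.inl (oA t)) = π (Sum.inr (iB t))) (hσ : ∀ c, π (σ c) = c)
    (hσ' : ∀ x, (Quot.mk _ x : GlueComp (Surface.mk X iA oA gA) (Surface.mk Y iB oB gB)) =
      Quot.mk _ (σ (π x)))
    (hE : ∀ c, ∑ a, ind (π (Sum.inl a) = c) * eA a + ∑ b, ind (π (Sum.inr b) = c) * eB b = eC c) :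
    ((Surface.mk X iA oA gA).glue (Surface.mk Y iB oB gB)).Homeo (Surface.mk Z iC oC gC) := by
  let A := Surface.mk X iA oA gA
  let B := Surface.mk Y iB oB gB
  let C := Surface.mk Z iC oC gC
  -- `π` sends a piece to its component and `σ` chooses a representative piece of each component;
  -- `hσ'` says that each piece is connected to the representative.
  let e : GlueComp A B ≃ C.comp :=
    { toFun := Quot.lift π (by rintro _ _ ⟨t, rfl, rfl⟩; exact hmid t)
      invFun := fun c => Quot.mk _ (σ c)
      left_inv := by rintro ⟨x⟩; exact (hσ' x).symm
      right_inv := hσ }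
  refine homeo_of_excess e hin hout fun k => ?_
  have h : ∀ x, π x = e k ↔ (Quot.mk _ x : GlueComp A B) = k := fun x =>
    (e.apply_eq_iff_eq (x := Quot.mk _ x) (y := k))
  -- By additivity of the excess, the genus of the glued surface never has to be computed from its
  -- gluing graph.
  refine (hC _).trans ((hE (e k)).symm.trans (Eq.trans ?_ (excess_glue A B k).symm))
  congr 1
  · exact Finset.sum_congr rfl fun a _ => by
      rw [← hA, h]; unfold ind; rw [ite_mul, one_mul, zero_mul]
  · exact Finset.sum_congr rfl fun a _ => by
      rw [← hB, h]; unfold ind; rw [ite_mul, one_mul, zero_mul]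

end Surface

/-! ### Elementary cobordisms -/

open scoped Classical in
/-- The function with the value `g` at `s` which is zero elsewhere. -/
def spot {α : Type} (s : α) (g : ℕ) (c : α) : ℕ := if s = c then g else 0

@[simp] theorem cast_spot {α : Type} (s : α) (g : ℕ) (c : α) :
    (spot s g c : ℤ) = ind (s = c) * g := by
  by_cases h : s = c <;> simp [h, spot]

/-- A cylinder with `g` handles on the component of the circle `s`. -/
def handles (S : Circles) (s : S) (g : ℕ) : Surface S S where
  comp := S
  inn := id
  out := id
  genus := spot s g

/-- Birth of a circle. -/
def cup (S : Circles) : Surface S (S.add 1) where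
  comp := S ⊕ Fin 1
  inn := Sum.inl
  out := id
  genus _ := 0

/-- Death of a circle. -/
def cap (S : Circles) : Surface (S.add 1) S where
  comp := S ⊕ Fin 1
  inn := id
  out := Sum.inl
  genus _ := 0

/-- A circle splits off from the circle `s`. -/
def splitOff (S : Circles) (s : S) : Surface S (S.add 1) where
  comp := S
  inn := id
  out := Sum.elim id fun _ => s
  genus _ := 0

/-- A circle merges with the circle `s`. -/
def mergeInto (S : Circles) (s : S) : Surface (S.add 1) S where
  comp := S
  inn := Sum.elim id fun _ => s
  out := id
  genus _ := 0

theorem mk_eq {S T U : Type} (A : Surface S T) (B : Surface T U) (t : T) :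
    (Quot.mk _ (Sum.inl (A.out t)) : Surface.GlueComp A B) = Quot.mk _ (Sum.inr (B.inn t)) :=
  Quot.sound ⟨t, rfl, rfl⟩

theorem excess_mk {S T X : Type} [Fintype T] [Fintype X] (i : S → X) (o : T → X) (g : X → ℕ)
    (c : X) : (Surface.mk X i o g).excess c = g c + (∑ t, ind (o t = c)) - 1 := rfl

theorem excess_cylinder {S T : Type} [Fintype T] (σ : S ≃ T) (c : T) :
    (Surface.cylinder σ).excess c = 0 := by
  refine (excess_mk _ _ _ _).trans ?_; simp

theorem excess_handles (S : Circles) (s : S) (g : ℕ) (c : S) :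
    (handles S s g).excess c = ind (s = c) * g := by
  refine (excess_mk _ _ _ _).trans ?_; simp

theorem excess_cup (S : Circles) (c : S ⊕ Fin 1) : (cup S).excess c = 0 := by
  refine (excess_mk _ _ _ _).trans ?_
  rcases c with c | c
  · simp
  · fin_cases c; simp

theorem excess_cap (S : Circles) (c : S ⊕ Fin 1) :
    (cap S).excess c = Sum.elim (fun _ => 0) (fun _ => -1) c := by
  refine (excess_mk _ _ _ _).trans ?_
  rcases c with c | c <;> simp

theorem excess_splitOff (S : Circles) (s c : S) :
    (splitOff S s).excess c = ind (s = c) := by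
  refine (excess_mk _ _ _ _).trans ?_; simp

theorem excess_mergeInto (S : Circles) (s c : S) :
    (mergeInto S s).excess c = 0 := by
  refine (excess_mk _ _ _ _).trans ?_; simp

theorem excess_withClosed (S : Circles) (g : ℕ) (c : S ⊕ Unit) :
    (withClosed S g).excess c = Sum.elim (fun _ => 0) (fun _ => (g : ℤ) - 1) c := by
  refine (excess_mk _ _ _ _).trans ?_
  rcases c with c | c <;> simp

theorem cylinder_glue_cylinder {S T U : Type} [Fintype S] [Fintype T] [Fintype U] (σ : S ≃ T)
    (τ : T ≃ U) :
    ((Surface.cylinder σ).glue (Surface.cylinder τ)).Homeo (Surface.cylinder (σ.trans τ)) := by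
  refine Surface.glue_homeo (Sum.elim τ id) Sum.inr (excess_cylinder σ) (excess_cylinder τ)
    (excess_cylinder _) (fun _ => rfl) (fun _ => rfl) (fun _ => rfl) (fun _ => rfl) ?_ ?_
  · rintro (c | c)
    · exact mk_eq (Surface.cylinder σ) (Surface.cylinder τ) c
    · rfl
  · intro c; simp

theorem handles_glue_handles (S : Circles) (s : S) (g k : ℕ) :
    ((handles S s g).glue (handles S s k)).Homeo (handles S s (g + k)) := by
  refine Surface.glue_homeo (Sum.elim id id) Sum.inr (excess_handles S s g) (excess_handles S s k)
    (excess_handles S s _) (fun _ => rfl) (fun _ => rfl) (fun _ => rfl) (fun _ => rfl) ?_ ?_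
  · rintro (c | c)
    · exact mk_eq (handles S s g) (handles S s k) c
    · rfl
  · intro c; simp [mul_add]

/-- A circle merges with `s` and another one is born. -/
def mergeCup (S : Circles) (s : S) : Surface (S.add 1) (S.add 1) where
  comp := S ⊕ Fin 1
  inn := Sum.elim Sum.inl fun _ => Sum.inl s
  out := id
  genus _ := 0

/-- A circle dies and another one splits off from `s`. -/
def capSplit (S : Circles) (s : S) : Surface (S.add 1) (S.add 1) where
  comp := S ⊕ Fin 1
  inn := id
  out := Sum.elim Sum.inl fun _ => Sum.inl s
  genus _ := 0

/-- A circle dies, and the component of `s` has a handle. -/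
def capHandle (S : Circles) (s : S) : Surface (S.add 1) S where
  comp := S ⊕ Fin 1
  inn := id
  out := Sum.inl
  genus := Sum.elim (spot s 1) fun _ => 0

/-- A circle dies and another one is born, and the component of `s` has a handle. -/
def capHandleCup (S : Circles) (s : S) : Surface (S.add 1) (S.add 1) where
  comp := S ⊕ Fin 2
  inn := Sum.map id fun _ => 0
  out := Sum.map id fun _ => 1
  genus := Sum.elim (spot s 1) fun _ => 0

/-- A closed component, and a handle on the component of `s`. -/
def closedHandle (S : Circles) (s : S) (g : ℕ) : Surface S S where
  comp := S ⊕ Unit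
  inn := Sum.inl
  out := Sum.inl
  genus := Sum.elim (spot s 1) fun _ => g

/-- The identity of `S ⊔ {circle}`, the last component cut along a neck, with four sites: two at the neck
and two at the component of `s`. -/
def neckSites (S : Circles) (s : S) : Surface ((S.add 1).add 4) (S.add 1) where
  comp := S ⊕ Fin 2
  inn := Sum.elim (Sum.map id fun _ => 0) ![Sum.inr 0, Sum.inr 1, Sum.inl s, Sum.inl s]
  out := Sum.map id fun _ => 1
  genus _ := 0

/-- The identity of `S` and a closed component, with two sites at the closed component and two at the
component of `s`. -/
def closedSites (S : Circles) (s : S) (g : ℕ) : Surface (S.add 4) S where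
  comp := S ⊕ Unit
  inn := Sum.elim Sum.inl ![Sum.inr (), Sum.inr (), Sum.inl s, Sum.inl s]
  out := Sum.inl
  genus := Sum.elim (fun _ => 0) fun _ => g

theorem excess_mergeCup (S : Circles) (s : S) (c : S ⊕ Fin 1) :
    (mergeCup S s).excess c = 0 := by
  refine (excess_mk _ _ _ _).trans ?_
  rcases c with c | c
  · simp
  · fin_cases c; simp

theorem excess_capSplit (S : Circles) (s : S) (c : S ⊕ Fin 1) :
    (capSplit S s).excess c = Sum.elim (fun c => ind (s = c)) (fun _ => -1) c := by
  refine (excess_mk _ _ _ _).trans ?_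
  rcases c with c | c <;> simp

theorem excess_capHandle (S : Circles) (s : S) (c : S ⊕ Fin 1) :
    (capHandle S s).excess c = Sum.elim (fun c => ind (s = c)) (fun _ => -1) c := by
  refine (excess_mk _ _ _ _).trans ?_
  rcases c with c | c <;> simp

theorem excess_capHandleCup (S : Circles) (s : S) (c : S ⊕ Fin 2) :
    (capHandleCup S s).excess c = Sum.elim (fun c => ind (s = c)) ![-1, 0] c := by
  refine (excess_mk _ _ _ _).trans ?_
  rcases c with c | c
  · simp
  · fin_cases c <;> simp

theorem excess_closedHandle (S : Circles) (s : S) (g : ℕ) (c : S ⊕ Unit) :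
    (closedHandle S s g).excess c = Sum.elim (fun c => ind (s = c)) (fun _ => (g : ℤ) - 1) c := by
  refine (excess_mk _ _ _ _).trans ?_
  rcases c with c | c <;> simp

theorem excess_neckSites (S : Circles) (s : S) (c : S ⊕ Fin 2) :
    (neckSites S s).excess c = Sum.elim (fun _ => 0) ![-1, 0] c := by
  refine (excess_mk _ _ _ _).trans ?_
  rcases c with c | c
  · simp
  · fin_cases c <;> simp

theorem excess_closedSites (S : Circles) (s : S) (g : ℕ) (c : S ⊕ Unit) :
    (closedSites S s g).excess c = Sum.elim (fun _ => 0) (fun _ => (g : ℤ) - 1) c := by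
  refine (excess_mk _ _ _ _).trans ?_
  rcases c with c | c <;> simp

theorem excess_newDiscs (S : Circles) {k m : ℕ} (p : Fin k → Fin m) (c : S ⊕ Fin m) :
    (newDiscs S p).excess c = Sum.elim (fun _ => 0) (fun j => (∑ i, ind (p i = j)) - 1) c := by
  refine (excess_mk _ _ _ _).trans ?_
  rcases c with c | c <;> simp

theorem mergeInto_cup (S : Circles) (s : S) :
    ((mergeInto S s).glue (cup S)).Homeo (mergeCup S s) := by
  refine Surface.glue_homeo (Sum.elim Sum.inl id) Sum.inr (excess_mergeInto S s) (excess_cup S)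
    (excess_mergeCup S s) ?_ (fun _ => rfl) (fun _ => rfl) (fun _ => rfl) ?_ ?_
  · rintro (c | c) <;> rfl
  · rintro (c | c)
    · exact mk_eq (mergeInto S s) (cup S) c
    · rfl
  · rintro (c | c) <;> simp

theorem cap_splitOff (S : Circles) (s : S) :
    ((cap S).glue (splitOff S s)).Homeo (capSplit S s) := by
  refine Surface.glue_homeo (Sum.elim id Sum.inl) Sum.inl (excess_cap S) (excess_splitOff S s)
    (excess_capSplit S s) (fun _ => rfl) ?_ (fun _ => rfl) (fun _ => rfl) ?_ ?_
  · rintro (c | c) <;> rfl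
  · rintro (c | c)
    · rfl
    · exact (mk_eq (cap S) (splitOff S s) c).symm
  · rintro (c | c) <;> simp

theorem cap_handles (S : Circles) (s : S) :
    ((cap S).glue (handles S s 1)).Homeo (capHandle S s) := by
  refine Surface.glue_homeo (Sum.elim id Sum.inl) Sum.inl (excess_cap S) (excess_handles S s 1)
    (excess_capHandle S s) (fun _ => rfl) (fun _ => rfl) (fun _ => rfl) (fun _ => rfl) ?_ ?_
  · rintro (c | c)
    · rfl
    · exact (mk_eq (cap S) (handles S s 1) c).symm
  · rintro (c | c) <;> simp

theorem capHandle_cup (S : Circles) (s : S) :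
    ((capHandle S s).glue (cup S)).Homeo (capHandleCup S s) := by
  refine Surface.glue_homeo (Sum.elim (Sum.map id fun _ => 0) (Sum.map id fun _ => 1))
    (Sum.elim (fun c => Sum.inl (Sum.inl c)) ![Sum.inl (Sum.inr 0), Sum.inr (Sum.inr 0)])
    (excess_capHandle S s) (excess_cup S)
    (excess_capHandleCup S s) (fun _ => rfl) (fun _ => rfl) (fun _ => rfl) ?_ ?_ ?_
  · rintro (c | c)
    · rfl
    · fin_cases c <;> rfl
  · rintro ((c | c) | (c | c))
    · rfl
    · fin_cases c; rfl
    · exact (mk_eq (capHandle S s) (cup S) c).symm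
    · fin_cases c; rfl
  · rintro (c | c)
    · simp
    · fin_cases c <;> simp

theorem withClosed_handles (S : Circles) (s : S) (g : ℕ) :
    ((withClosed S g).glue (handles S s 1)).Homeo (closedHandle S s g) := by
  refine Surface.glue_homeo (Sum.elim id Sum.inl) Sum.inl (excess_withClosed S g)
    (excess_handles S s 1)
    (excess_closedHandle S s g) (fun _ => rfl) (fun _ => rfl) (fun _ => rfl) (fun _ => rfl) ?_ ?_
  · rintro (c | c)
    · rfl
    · exact (mk_eq (withClosed S g) (handles S s 1) c).symm
  · rintro (c | c) <;> simp

/-- Two pieces which are glued to the same piece lie on the same component. -/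
theorem mk_eq_mk {S T U : Type} (A : Surface S T) (B : Surface T U) (t t' : T)
    (h : B.inn t = B.inn t') :
    (Quot.mk _ (Sum.inl (A.out t)) : Surface.GlueComp A B) = Quot.mk _ (Sum.inl (A.out t')) :=
  (mk_eq A B t).trans (h ▸ (mk_eq A B t').symm)

/-! ### The four tubes of the 4TU relation, at a neck and at a closed component -/

/-- The sites 0 and 1 are the incoming and the outgoing side of the cut neck, the sites 2 and 3 lie
on the component of `s`. The tube between 0 and 1 restores the neck; the other three tubes, treated
below, leave it cut and put a handle on `s`, merge the incoming circle into `s`, or split the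
outgoing one off from `s`. -/
theorem neck_tube (S : Circles) (s : S) :
    ((newDiscs (S.add 1) (![0, 0, 1, 2] : Fin 4 → Fin 3)).glue (neckSites S s)).Homeo
      (Surface.cylinder (Equiv.refl (S.add 1))) := by
  refine Surface.glue_homeo (Sum.elim (Sum.elim id ![Sum.inr 0, Sum.inl s, Sum.inl s])
    (Sum.map id fun _ => 0)) (fun c => Sum.inl (Sum.inl c)) (excess_newDiscs (S.add 1) _)
    (excess_neckSites S s) (excess_cylinder _) (fun _ => rfl) ?_ ?_ (fun _ => rfl) ?_ ?_
  · rintro (c | c)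
    · rfl
    · fin_cases c; rfl
  · rintro ((c | c) | c)
    · rfl
    · fin_cases c; rfl
    · fin_cases c <;> rfl
  · have h := mk_eq_mk (newDiscs (S.add 1) (![0, 0, 1, 2] : Fin 4 → Fin 3)) (neckSites S s)
    have h' := mk_eq (newDiscs (S.add 1) (![0, 0, 1, 2] : Fin 4 → Fin 3)) (neckSites S s)
    rintro ((c | c) | (c | c))
    · rfl
    · fin_cases c
      · exact h (Sum.inr 0) (Sum.inl (Sum.inr 0)) rfl
      · exact h (Sum.inr 2) (Sum.inl (Sum.inl s)) rfl
      · exact h (Sum.inr 3) (Sum.inl (Sum.inl s)) rfl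
    · exact (h' (Sum.inl (Sum.inl c))).symm
    · fin_cases c
      · exact (h' (Sum.inl (Sum.inr 0))).symm
      · exact (h' (Sum.inr 1)).symm.trans (h (Sum.inr 0) (Sum.inl (Sum.inr 0)) rfl)
  · rintro (c | c)
    · simp [Fin.sum_univ_succ]
    · fin_cases c; simp [Fin.sum_univ_succ]

theorem neck_handle (S : Circles) (s : S) :
    ((newDiscs (S.add 1) (![1, 2, 0, 0] : Fin 4 → Fin 3)).glue (neckSites S s)).Homeo
      (capHandleCup S s) := by
  have h := mk_eq_mk (newDiscs (S.add 1) (![1, 2, 0, 0] : Fin 4 → Fin 3)) (neckSites S s)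
  have h' := mk_eq (newDiscs (S.add 1) (![1, 2, 0, 0] : Fin 4 → Fin 3)) (neckSites S s)
  refine Surface.glue_homeo (Sum.elim (Sum.elim (Sum.map id fun _ => 0)
    ![Sum.inl s, Sum.inr 0, Sum.inr 1]) id) Sum.inr (excess_newDiscs (S.add 1) _)
    (excess_neckSites S s) (excess_capHandleCup S s) (fun _ => rfl) (fun _ => rfl) ?_
    (fun _ => rfl) ?_ ?_
  · rintro ((c | c) | c)
    · rfl
    · rfl
    · fin_cases c <;> rfl
  · rintro ((c | c) | c)
    · exact h' (Sum.inl c)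
    · fin_cases c
      · exact h' (Sum.inr 2)
      · exact h' (Sum.inr 0)
      · exact h' (Sum.inr 1)
    · rfl
  · rintro (c | c)
    · simp [Fin.sum_univ_succ]
    · fin_cases c <;> simp [Fin.sum_univ_succ]

theorem neck_merge (S : Circles) (s : S) :
    ((newDiscs (S.add 1) (![0, 1, 0, 2] : Fin 4 → Fin 3)).glue (neckSites S s)).Homeo
      (mergeCup S s) := by
  have h := mk_eq_mk (newDiscs (S.add 1) (![0, 1, 0, 2] : Fin 4 → Fin 3)) (neckSites S s)
  have h' := mk_eq (newDiscs (S.add 1) (![0, 1, 0, 2] : Fin 4 → Fin 3)) (neckSites S s)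
  refine Surface.glue_homeo (Sum.elim (Sum.elim (Sum.elim Sum.inl fun _ => Sum.inl s)
    ![Sum.inl s, Sum.inr 0, Sum.inl s]) (Sum.elim Sum.inl ![Sum.inl s, Sum.inr 0]))
    (fun c => Sum.inr (c.map id fun _ => 1)) (excess_newDiscs (S.add 1) _)
    (excess_neckSites S s) (excess_mergeCup S s) (fun _ => rfl) ?_ ?_
    ?_ ?_ ?_
  · rintro (c | c)
    · rfl
    · fin_cases c; rfl
  · rintro ((c | c) | c)
    · rfl
    · rfl
    · fin_cases c <;> rfl
  · rintro (c | c)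
    · rfl
    · fin_cases c; rfl
  · have h0 := (h (Sum.inr 0) (Sum.inl (Sum.inr 0)) rfl).symm.trans (h' (Sum.inr 2))
    rintro (((c | c) | c) | (c | c))
    · exact h' (Sum.inl (Sum.inl c))
    · fin_cases c
      exact h0
    · fin_cases c
      · exact h' (Sum.inr 2)
      · exact h' (Sum.inr 1)
      · exact h' (Sum.inr 3)
    · rfl
    · fin_cases c
      · exact (h' (Sum.inl (Sum.inr 0))).symm.trans h0
      · rfl
  · rintro (c | c)
    · simp [Fin.sum_univ_succ]
    · fin_cases c; simp [Fin.sum_univ_succ]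

theorem neck_split (S : Circles) (s : S) :
    ((newDiscs (S.add 1) (![1, 0, 2, 0] : Fin 4 → Fin 3)).glue (neckSites S s)).Homeo
      (capSplit S s) := by
  have h := mk_eq_mk (newDiscs (S.add 1) (![1, 0, 2, 0] : Fin 4 → Fin 3)) (neckSites S s)
  have h' := mk_eq (newDiscs (S.add 1) (![1, 0, 2, 0] : Fin 4 → Fin 3)) (neckSites S s)
  refine Surface.glue_homeo (Sum.elim (Sum.elim id
    ![Sum.inl s, Sum.inr 0, Sum.inl s]) (Sum.elim Sum.inl ![Sum.inr 0, Sum.inl s]))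
    (fun c => Sum.inl (Sum.inl c)) (excess_newDiscs (S.add 1) _)
    (excess_neckSites S s) (excess_capSplit S s) (fun _ => rfl) ?_ ?_
    (fun _ => rfl) ?_ ?_
  · rintro (c | c) <;> rfl
  · rintro ((c | c) | c)
    · rfl
    · fin_cases c; rfl
    · fin_cases c <;> rfl
  · rintro ((c | c) | (c | c))
    · rfl
    · fin_cases c
      · exact h (Sum.inr 3) (Sum.inl (Sum.inl s)) rfl
      · exact h (Sum.inr 0) (Sum.inl (Sum.inr 0)) rfl
      · exact h (Sum.inr 2) (Sum.inl (Sum.inl s)) rfl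
    · exact (h' (Sum.inl (Sum.inl c))).symm
    · fin_cases c
      · exact (h' (Sum.inl (Sum.inr 0))).symm
      · exact (h' (Sum.inr 1)).symm.trans (h (Sum.inr 3) (Sum.inl (Sum.inl s)) rfl)
  · rintro (c | c)
    · simp [Fin.sum_univ_succ]
    · fin_cases c; simp [Fin.sum_univ_succ]

/-- Here the sites 0 and 1 lie on the closed component and 2 and 3 on that of `s`. Joining the first
pair raises the closed genus and joining the second puts a handle on `s`. The two mixed tubes,
`closed_merge` and `closed_split`, both absorb the closed component into that of `s`, which thereby
gains genus `g`. -/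
theorem closed_tube (S : Circles) (s : S) (g : ℕ) :
    ((newDiscs S (![0, 0, 1, 2] : Fin 4 → Fin 3)).glue (closedSites S s g)).Homeo
      (withClosed S (g + 1)) := by
  have h' := mk_eq (newDiscs S (![0, 0, 1, 2] : Fin 4 → Fin 3)) (closedSites S s g)
  refine Surface.glue_homeo (Sum.elim (Sum.elim Sum.inl ![Sum.inr (), Sum.inl s, Sum.inl s]) id)
    Sum.inr (excess_newDiscs S _) (excess_closedSites S s g) (excess_withClosed S _)
    (fun _ => rfl) (fun _ => rfl) ?_ (fun _ => rfl) ?_ ?_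
  · rintro (c | c)
    · rfl
    · fin_cases c <;> rfl
  · rintro ((c | c) | c)
    · exact h' (Sum.inl c)
    · fin_cases c
      · exact h' (Sum.inr 0)
      · exact h' (Sum.inr 2)
      · exact h' (Sum.inr 3)
    · rfl
  · rintro (c | c) <;> simp [Fin.sum_univ_succ]

theorem closed_handle (S : Circles) (s : S) (g : ℕ) :
    ((newDiscs S (![1, 2, 0, 0] : Fin 4 → Fin 3)).glue (closedSites S s g)).Homeo
      (closedHandle S s g) := by
  have h' := mk_eq (newDiscs S (![1, 2, 0, 0] : Fin 4 → Fin 3)) (closedSites S s g)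
  refine Surface.glue_homeo (Sum.elim (Sum.elim Sum.inl ![Sum.inl s, Sum.inr (), Sum.inr ()]) id)
    Sum.inr (excess_newDiscs S _) (excess_closedSites S s g) (excess_closedHandle S s _)
    (fun _ => rfl) (fun _ => rfl) ?_ (fun _ => rfl) ?_ ?_
  · rintro (c | c)
    · rfl
    · fin_cases c <;> rfl
  · rintro ((c | c) | c)
    · exact h' (Sum.inl c)
    · fin_cases c
      · exact h' (Sum.inr 2)
      · exact h' (Sum.inr 0)
      · exact h' (Sum.inr 1)
    · rfl
  · rintro (c | c) <;> simp [Fin.sum_univ_succ]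

theorem closed_merge (S : Circles) (s : S) (g : ℕ) :
    ((newDiscs S (![0, 1, 0, 2] : Fin 4 → Fin 3)).glue (closedSites S s g)).Homeo
      (handles S s g) := by
  have h := mk_eq_mk (newDiscs S (![0, 1, 0, 2] : Fin 4 → Fin 3)) (closedSites S s g)
  have h' := mk_eq (newDiscs S (![0, 1, 0, 2] : Fin 4 → Fin 3)) (closedSites S s g)
  refine Surface.glue_homeo (Sum.elim (Sum.elim id fun _ => s) (Sum.elim id fun _ => s))
    (fun c => Sum.inl (Sum.inl c)) (excess_newDiscs S _) (excess_closedSites S s g)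
    (excess_handles S s g) (fun _ => rfl) (fun _ => rfl) ?_ (fun _ => rfl) ?_ ?_
  · rintro (c | c)
    · rfl
    · fin_cases c <;> rfl
  · have h0 := h (Sum.inr 2) (Sum.inl s) rfl
    rintro ((c | c) | (c | c))
    · rfl
    · fin_cases c
      · exact h0
      · exact (h (Sum.inr 1) (Sum.inr 0) rfl).trans h0
      · exact h (Sum.inr 3) (Sum.inl s) rfl
    · exact (h' (Sum.inl c)).symm
    · exact (h' (Sum.inr 0)).symm.trans h0
  · intro c
    simp [Fin.sum_univ_succ]
    ring

theorem closed_split (S : Circles) (s : S) (g : ℕ) :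
    ((newDiscs S (![1, 0, 2, 0] : Fin 4 → Fin 3)).glue (closedSites S s g)).Homeo
      (handles S s g) := by
  have h := mk_eq_mk (newDiscs S (![1, 0, 2, 0] : Fin 4 → Fin 3)) (closedSites S s g)
  have h' := mk_eq (newDiscs S (![1, 0, 2, 0] : Fin 4 → Fin 3)) (closedSites S s g)
  refine Surface.glue_homeo (Sum.elim (Sum.elim id fun _ => s) (Sum.elim id fun _ => s))
    (fun c => Sum.inl (Sum.inl c)) (excess_newDiscs S _) (excess_closedSites S s g)
    (excess_handles S s g) (fun _ => rfl) (fun _ => rfl) ?_ (fun _ => rfl) ?_ ?_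
  · rintro (c | c)
    · rfl
    · fin_cases c <;> rfl
  · have h0 := h (Sum.inr 3) (Sum.inl s) rfl
    rintro ((c | c) | (c | c))
    · rfl
    · fin_cases c
      · exact h0
      · exact (h (Sum.inr 0) (Sum.inr 1) rfl).trans h0
      · exact h (Sum.inr 2) (Sum.inl s) rfl
    · exact (h' (Sum.inl c)).symm
    · exact (h' (Sum.inr 1)).symm.trans h0
  · intro c
    simp [Fin.sum_univ_succ]
    ring

/-! ### Local relations in `Cob_{/l}` -/

theorem map_eq_zero_of_localRelation {X Y : ZCob} {f : X ⟶ Y} (h : LocalRelation f) :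
    (Quotient.functor relHom).map f = 0 := by
  have h1 : relHom f 0 := by
    show f - 0 ∈ relations X Y
    rw [sub_zero]
    exact AddSubgroup.subset_closure h
  exact (CategoryTheory.Quotient.sound relHom h1).trans (Functor.map_zero _ _ _)

/-- The form of 4TU in which it is used: `B` is the surface with the four sites removed. -/
theorem mor_fourTU {S T : Circles} (B : Surface (S.add 4) T) :
    mor ((newDiscs S (![0, 0, 1, 2] : Fin 4 → Fin 3)).glue B)
      + mor ((newDiscs S (![1, 2, 0, 0] : Fin 4 → Fin 3)).glue B)
      - mor ((newDiscs S (![0, 1, 0, 2] : Fin 4 → Fin 3)).glue B)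
      - mor ((newDiscs S (![1, 0, 2, 0] : Fin 4 → Fin 3)).glue B) = 0 := by
  have h := map_eq_zero_of_localRelation (LocalRelation.fourTU S (𝟙 S.z) (zcob B))
  rw [Category.id_comp, Functor.map_comp] at h
  simp only [Functor.map_sub, Functor.map_add, Preadditive.sub_comp, Preadditive.add_comp] at h
  rw [← mor_comp, ← mor_comp, ← mor_comp, ← mor_comp]
  exact h

theorem mor_sphere (S : Circles) : mor (withClosed S 0) = 0 := by
  have h := map_eq_zero_of_localRelation (LocalRelation.sphere S (𝟙 S.z) (𝟙 S.z))
  rwa [Category.id_comp, Category.comp_id] at h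

/-- Neck cutting in the presence of the component of `s`. -/
theorem mor_neck (S : Circles) (s : S) : 𝟙 (S.add 1).obj =
    mor (mergeInto S s) ≫ mor (cup S) + mor (cap S) ≫ mor (splitOff S s) -
      mor (cap S) ≫ mor (handles S s 1) ≫ mor (cup S) := by
  have h := mor_fourTU (neckSites S s)
  rw [mor_eq_of_homeo (neck_tube S s), mor_eq_of_homeo (neck_handle S s),
    mor_eq_of_homeo (neck_merge S s), mor_eq_of_homeo (neck_split S s), mor_id,
    ← mor_eq_of_homeo (capHandle_cup S s), ← mor_comp, ← mor_eq_of_homeo (cap_handles S s),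
    ← mor_comp, ← mor_eq_of_homeo (mergeInto_cup S s), ← mor_comp,
    ← mor_eq_of_homeo (cap_splitOff S s), ← mor_comp, Category.assoc] at h
  rw [sub_sub, sub_eq_zero] at h
  rw [← h]
  abel

/-- This is 4TU solved for the tube on the closed component. It needs some circle `s` to supply the
other two sites; the recursion it gives removes closed components of every genus. -/
theorem mor_withClosed_succ (S : Circles) (s : S) (g : ℕ) : mor (withClosed S (g + 1)) =
    mor (handles S s g) + mor (handles S s g) - mor (withClosed S g) ≫ mor (handles S s 1) := by
  have h := mor_fourTU (closedSites S s g)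
  rw [mor_eq_of_homeo (closed_tube S s g), mor_eq_of_homeo (closed_handle S s g),
    mor_eq_of_homeo (closed_merge S s g), mor_eq_of_homeo (closed_split S s g),
    ← mor_eq_of_homeo (withClosed_handles S s g), ← mor_comp, sub_sub, sub_eq_zero] at h
  rw [← h]
  abel

/-! ### Circles with a special circle -/

/-- The morphism of a surface which preserves the special component. -/
def specialMor {P Q : PointedCircles} (A : Surface P.circles Q.circles) (h : A.Special) : P ⟶ Q :=
  ⟨mor A, AddSubgroup.subset_closure ⟨A, h, rfl⟩⟩

/-- Adding a circle which is not special. -/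
def PointedCircles.addCircle (P : PointedCircles) : PointedCircles :=
  ⟨P.circles.add 1, Sum.inl P.special⟩

/-- One circle, which is special. -/
def basePoint : PointedCircles := ⟨Circles.add ⟨Empty⟩ 1, Sum.inr 0⟩

/-! ### Reduction to one special circle -/

/-- Since the partner sites of 4TU are put on the special component, every surface in the neck
cutting formula preserves that component. Each term on the right factors through the object with one
circle less. -/
theorem special_neck (P : PointedCircles) : 𝟙 P.addCircle =
    specialMor (P := P.addCircle) (Q := P) (mergeInto P.circles P.special) rfl ≫
        specialMor (P := P) (Q := P.addCircle) (cup P.circles) rfl +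
      specialMor (P := P.addCircle) (Q := P) (cap P.circles) rfl ≫
        specialMor (P := P) (Q := P.addCircle) (splitOff P.circles P.special) rfl -
      specialMor (P := P.addCircle) (Q := P) (cap P.circles) rfl ≫
        specialMor (P := P) (Q := P) (handles P.circles P.special 1) rfl ≫
        specialMor (P := P) (Q := P.addCircle) (cup P.circles) rfl :=
  Subtype.ext (mor_neck P.circles P.special)

/-- Sums of morphisms which factor through one special circle. -/
def throughBase (P Q : PointedCircles) : AddSubgroup (P ⟶ Q) :=
  AddSubgroup.closure {f | ∃ (r : P ⟶ basePoint) (i : basePoint ⟶ Q), f = r ≫ i}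

theorem comp_mem_throughBase {P Q P' Q' : PointedCircles} (a : P' ⟶ P) {f : P ⟶ Q}
    (hf : f ∈ throughBase P Q) (b : Q ⟶ Q') : a ≫ f ≫ b ∈ throughBase P' Q' := by
  induction hf using AddSubgroup.closure_induction with
  | mem f hf =>
    obtain ⟨r, i, rfl⟩ := hf
    exact AddSubgroup.subset_closure ⟨a ≫ r, i ≫ b, by simp only [Category.assoc]⟩
  | zero => rw [Limits.zero_comp, Limits.comp_zero]; exact zero_mem _
  | add f g _ _ hf hg => rw [Preadditive.add_comp, Preadditive.comp_add]; exact add_mem hf hg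
  | neg f _ hf => rw [Preadditive.neg_comp, Preadditive.comp_neg]; exact neg_mem hf

/-- Each of the three terms of `special_neck` factors through `P`, where the identity already passes
through the special circle. -/
theorem id_addCircle_mem_throughBase {P : PointedCircles} (h : 𝟙 P ∈ throughBase P P) :
    𝟙 P.addCircle ∈ throughBase P.addCircle P.addCircle := by
  rw [special_neck]
  refine sub_mem (add_mem ?_ ?_) ?_
  · have := comp_mem_throughBase (specialMor (P := P.addCircle) (Q := P) (mergeInto P.circles P.special) rfl) h (specialMor (P := P) (Q := P.addCircle) (cup P.circles) rfl)
    rwa [Category.id_comp] at this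
  · have := comp_mem_throughBase (specialMor (P := P.addCircle) (Q := P) (cap P.circles) rfl) h
      (specialMor (P := P) (Q := P.addCircle) (splitOff P.circles P.special) rfl)
    rwa [Category.id_comp] at this
  · have := comp_mem_throughBase (specialMor (P := P.addCircle) (Q := P) (cap P.circles) rfl) h
      (specialMor (P := P) (Q := P) (handles P.circles P.special 1) rfl ≫
        specialMor (P := P) (Q := P.addCircle) (cup P.circles) rfl)
    rwa [Category.id_comp] at this

/-- Pointed collections with equally many circles are isomorphic, through relabelled cylinders. -/
theorem id_mem_throughBase_of_card {P Q : PointedCircles}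
    (h : Fintype.card P.circles = Fintype.card Q.circles) (hQ : 𝟙 Q ∈ throughBase Q Q) :
    𝟙 P ∈ throughBase P P := by
  classical
  obtain ⟨σ, hσ⟩ : ∃ σ : P.circles ≃ Q.circles, σ P.special = Q.special :=
    -- An arbitrary bijection is corrected by a transposition, so that it matches the special
    -- circles.
    ⟨(Fintype.equivOfCardEq h).trans (Equiv.swap (Fintype.equivOfCardEq h P.special) Q.special),
      Equiv.swap_apply_left _ _⟩
  have h1 : 𝟙 P = specialMor (P := P) (Q := Q) (Surface.cylinder σ) hσ ≫
      specialMor (P := Q) (Q := P) (Surface.cylinder σ.symm)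
        (show σ.symm Q.special = P.special by rw [← hσ, σ.symm_apply_apply]) := by
    refine Subtype.ext ?_
    show 𝟙 P.circles.obj = mor _ ≫ mor _
    rw [mor_comp, mor_eq_of_homeo (cylinder_glue_cylinder σ σ.symm), Equiv.self_trans_symm, mor_id]
  have h2 := comp_mem_throughBase (specialMor (P := P) (Q := Q) (Surface.cylinder σ) hσ) hQ
    (specialMor (P := Q) (Q := P) (Surface.cylinder σ.symm)
        (show σ.symm Q.special = P.special by rw [← hσ, σ.symm_apply_apply]))
  rw [Category.id_comp] at h2
  rw [h1]
  exact h2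

/-- Induction on the number of non-special circles, removing one at a time by neck cutting. Up to
relabelling, only the standard collections have to be considered. -/
theorem id_mem_throughBase (P : PointedCircles) : 𝟙 P ∈ throughBase P P := by
  obtain ⟨n, hn⟩ : ∃ n, Fintype.card P.circles = n + 1 :=
    ⟨_, (Nat.succ_pred_eq_of_pos (Fintype.card_pos_iff.2 ⟨P.special⟩)).symm⟩
  induction n generalizing P with
  | zero =>
    have hb : 𝟙 basePoint ∈ throughBase basePoint basePoint :=
      AddSubgroup.subset_closure ⟨𝟙 _, 𝟙 _, (Category.id_comp _).symm⟩
    refine id_mem_throughBase_of_card (Q := basePoint) (hn.trans ?_) hb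
    show 0 + 1 = Fintype.card (Empty ⊕ Fin 1)
    rw [Fintype.card_sum]; rfl
  | succ n ih =>
    let Q : PointedCircles := ⟨⟨Fin (n + 1)⟩, 0⟩
    refine id_mem_throughBase_of_card (Q := Q.addCircle) (hn.trans ?_)
      (id_addCircle_mem_throughBase (ih Q (by simp [Q])))
    show n + 1 + 1 = Fintype.card (Fin (n + 1) ⊕ Fin 1)
    rw [Fintype.card_sum, Fintype.card_fin, Fintype.card_fin]

/-! ### Endomorphisms of the special circle -/

/-- Splitting off a closed component. -/
theorem remove_closed {S : Circles} (A : Surface S S) (c : A.comp) (hin : ∀ s, A.inn s ≠ c)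
    (hout : ∀ s, A.out s ≠ c) [Fintype {x // x ≠ c}] :
    ((Surface.mk {x // x ≠ c} (fun s => ⟨A.inn s, hin s⟩) (fun s => ⟨A.out s, hout s⟩)
      fun x => A.genus x.1).glue (withClosed S (A.genus c))).Homeo A := by
  classical
  obtain ⟨X, iA, oA, gA⟩ := A
  -- The representatives for `Surface.glue_homeo`: the component `c` comes from the closed piece of
  -- `withClosed`, all others from the surface without `c`.
  obtain ⟨σ, hσ1, hσ2⟩ : ∃ σ : X → {x // x ≠ c} ⊕ (S ⊕ Unit), σ c = Sum.inr (Sum.inr ()) ∧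
      ∀ x (h : x ≠ c), σ x = Sum.inl ⟨x, h⟩ :=
    ⟨fun x => if h : x = c then Sum.inr (Sum.inr ()) else Sum.inl ⟨x, h⟩, dif_pos rfl,
      fun x h => dif_neg h⟩
  refine Surface.glue_homeo (Sum.elim Subtype.val (Sum.elim oA fun _ => c)) σ
    (eA := fun x => (Surface.mk X iA oA gA).excess x.1) (fun x => ?_)
    (excess_withClosed S _) (fun _ => rfl) (fun _ => rfl) (fun _ => rfl) (fun _ => rfl) ?_ ?_ ?_
  · rw [excess_mk, excess_mk]
    simp only [Subtype.ext_iff]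
  · intro x
    by_cases h : x = c
    · rw [h, hσ1]; rfl
    · rw [hσ2 x h]; rfl
  · rintro (x | (s | ⟨⟩))
    · exact congrArg (Quot.mk _) (hσ2 x.1 x.2).symm
    · refine (mk_eq (Surface.mk {x // x ≠ c} (fun s => ⟨iA s, hin s⟩) (fun s => ⟨oA s, hout s⟩)
        fun x => gA x.1) (withClosed S (gA c)) s).symm.trans ?_
      exact congrArg (Quot.mk _) (hσ2 (oA s) (hout s)).symm
    · exact congrArg (Quot.mk _) hσ1.symm
  · intro x
    by_cases h : x = c
    · subst h
      have h1 : ∀ a : {y // y ≠ x}, ind (a.1 = x) = 0 := fun a => by simp [a.2]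
      have h2 : ∀ t, ind (oA t = x) = 0 := fun t => by
        have := hout t
        simp [this]
      rw [excess_mk]
      simp [h1, h2]
    · have h1 : ∀ a : {y // y ≠ c}, ind (a.1 = x) = ind (a = ⟨x, h⟩) := fun a => by
        rw [Subtype.ext_iff]
      have h2 : ind (c = x) = 0 := by simp [Ne.symm h]
      simp [h1, h2]

/-- A special circle with a handle attached to the cylinder over it. -/
def baseHandle : End basePoint :=
  specialMor (P := basePoint) (Q := basePoint) (handles basePoint.circles basePoint.special 1) rfl

/-- The action of polynomials on the special circle. -/
def baseAction : Polynomial ℤ →ₐ[ℤ] End basePoint := Polynomial.aeval baseHandle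

theorem baseAction_X_pow (g : ℕ) : (baseAction (Polynomial.X ^ g)).1 =
    mor (handles basePoint.circles basePoint.special g) := by
  induction g with
  | zero =>
    rw [pow_zero, map_one]
    refine (mor_id _).symm.trans (mor_eq_of_homeo ?_)
    exact Surface.homeo_of_excess (Equiv.refl _) (fun _ => rfl) (fun _ => rfl) fun c => by
      refine (excess_handles _ _ _ c).trans (Eq.trans ?_ (excess_cylinder _ c).symm)
      simp
  | succ g ih =>
    rw [pow_succ', map_mul]
    have hX : (baseAction Polynomial.X).1 =
        mor (handles basePoint.circles basePoint.special 1) :=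
      congrArg Subtype.val (Polynomial.aeval_X baseHandle)
    show (baseAction (Polynomial.X ^ g)).1 ≫ (baseAction Polynomial.X).1 = _
    rw [hX, ih, mor_comp]
    exact mor_eq_of_homeo (handles_glue_handles _ _ _ _)

/-- Multiplication in `End` is composition in the opposite order. -/
theorem baseAction_mul (p q : Polynomial ℤ) :
    (baseAction (p * q)).1 = (baseAction q).1 ≫ (baseAction p).1 := by
  rw [map_mul]; rfl

theorem exists_baseAction_withClosed (g : ℕ) :
    ∃ p, mor (withClosed basePoint.circles g) = (baseAction p).1 := by
  induction g with
  | zero => exact ⟨0, by rw [map_zero]; exact mor_sphere _⟩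
  | succ g ih =>
    obtain ⟨p, hp⟩ := ih
    -- From the recursion of `mor_withClosed_succ`: the value of genus `g + 1` is `2 H ^ g` minus
    -- `H` times the value of genus `g`, starting with zero for the sphere.
    refine ⟨Polynomial.X ^ g + Polynomial.X ^ g - Polynomial.X ^ 1 * p, ?_⟩
    rw [mor_withClosed_succ _ basePoint.special, hp, map_sub, map_add]
    show _ = (baseAction (Polynomial.X ^ g)).1 + (baseAction (Polynomial.X ^ g)).1 -
      (baseAction (Polynomial.X ^ 1 * p)).1
    rw [baseAction_mul, baseAction_X_pow, baseAction_X_pow]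

/-- Induction on the number of components: closed components are split off and replaced by
polynomials, until a connected surface remains, which is a power of the handle. -/
theorem exists_baseAction_mor (n : ℕ) :
    ∀ A : Surface basePoint.circles basePoint.circles,
      A.Special (P := basePoint) (Q := basePoint) → Fintype.card A.comp = n →
      ∃ p, mor A = (baseAction p).1 := by
  classical
  have hS : ∀ s : basePoint.circles, s = basePoint.special := by
    rintro (s | s)
    · exact s.elim
    · fin_cases s; rfl
  induction n using Nat.strong_induction_on with
  | _ n ih =>
    intro A hA hn
    -- There is only one incoming and one outgoing circle, and both lie on the special component, so
    -- any other component is closed.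
    by_cases h : ∃ c, c ≠ A.inn basePoint.special
    · obtain ⟨c, hc⟩ := h
      have hin : ∀ s, A.inn s ≠ c := fun s => by rw [hS s]; exact hc.symm
      have hout : ∀ s, A.out s ≠ c := fun s => by rw [hS s, ← hA]; exact hc.symm
      obtain ⟨p, hp⟩ := ih (Fintype.card {x // x ≠ c})
        (by rw [← hn]; exact Fintype.card_subtype_lt (x := c) (by simp))
        (Surface.mk {x // x ≠ c} (fun s => ⟨A.inn s, hin s⟩) (fun s => ⟨A.out s, hout s⟩)
          fun x => A.genus x.1) (Subtype.ext hA) rfl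
      obtain ⟨q, hq⟩ := exists_baseAction_withClosed (A.genus c)
      refine ⟨q * p, ?_⟩
      rw [← mor_eq_of_homeo (remove_closed A c hin hout), ← mor_comp, hp, hq, baseAction_mul]
    · push Not at h
      refine ⟨Polynomial.X ^ A.genus (A.inn basePoint.special), ?_⟩
      rw [baseAction_X_pow]
      refine mor_eq_of_homeo ⟨⟨fun _ => basePoint.special, fun _ => A.inn basePoint.special,
        fun c => (h c).symm, fun c => (hS c).symm⟩, fun s => (hS s).symm, fun s => (hS s).symm,
        fun c => ?_⟩
      rw [h c]
      exact if_pos rfl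

theorem baseAction_surjective : Function.Surjective baseAction := by
  rintro ⟨f, hf⟩
  suffices h : ∃ p, f = (baseAction p).1 by
    obtain ⟨p, hp⟩ := h
    exact ⟨p, Subtype.ext hp.symm⟩
  induction hf using AddSubgroup.closure_induction with
  | mem f hf =>
    obtain ⟨A, hA, rfl⟩ := hf
    exact exists_baseAction_mor _ A hA rfl
  | zero => exact ⟨0, by rw [map_zero]; rfl⟩
  | add f g _ _ hf hg =>
    obtain ⟨p, rfl⟩ := hf
    obtain ⟨q, rfl⟩ := hg
    exact ⟨p + q, by rw [map_add]; rfl⟩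
  | neg f _ hf =>
    obtain ⟨p, rfl⟩ := hf
    exact ⟨-p, by rw [map_neg]; rfl⟩

/-! ### The Frobenius algebra -/

section Algebra

open scoped TensorProduct

theorem vX_mul_vX : vX * vX = H • vX := by
  have h := AdjoinRoot.eval₂_root (Polynomial.X ^ 2 - Polynomial.C H * Polynomial.X : Polynomial RH)
  rw [Polynomial.eval₂_sub, Polynomial.eval₂_mul, Polynomial.eval₂_pow, Polynomial.eval₂_X,
    Polynomial.eval₂_C, sub_eq_zero] at h
  rw [Algebra.smul_def, ← pow_two]
  exact h

/-- Multiples of `X` in `A_H` are scalar multiples. -/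
theorem exists_vX_mul (y : AH) : ∃ c : RH, vX * y = c • vX := by
  obtain ⟨f, rfl⟩ := AdjoinRoot.mk_surjective y
  induction f using Polynomial.induction_on' with
  | add p q hp hq =>
    obtain ⟨c, hc⟩ := hp
    obtain ⟨d, hd⟩ := hq
    exact ⟨c + d, by rw [map_add, mul_add, hc, hd, add_smul]⟩
  | monomial n a =>
    induction n with
    | zero =>
      refine ⟨a, ?_⟩
      rw [Polynomial.monomial_zero_left, AdjoinRoot.mk_C, mul_comm, Algebra.smul_def]
      rfl
    | succ n ih =>
      obtain ⟨c, hc⟩ := ih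
      refine ⟨c * H, ?_⟩
      rw [← Polynomial.monomial_mul_X, map_mul, ← mul_assoc, hc, AdjoinRoot.mk_X,
        Algebra.smul_mul_assoc, vX_mul_vX, smul_smul]

/-- The two characters of `A_H`: `X` is sent to `H` or to `0`. -/
def character (b : Bool) : AH →ₐ[RH] RH :=
  AdjoinRoot.liftAlgHom _ (Algebra.ofId RH RH) (if b then H else 0) (by
    cases b <;> simp [pow_two])

@[simp] theorem character_vX (b : Bool) : character b vX = if b then H else 0 :=
  AdjoinRoot.liftAlgHom_root ..

/-- Evaluation of a tensor at a point of the spectrum. -/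
def evalAt {S : Type} [Fintype S] (f : S → Bool) : (⨂[RH] _ : S, AH) →ₗ[RH] RH :=
  PiTensorProduct.lift ((MultilinearMap.mkPiAlgebra RH S RH).compLinearMap
    fun s => (character (f s)).toLinearMap)

@[simp] theorem evalAt_tprod {S : Type} [Fintype S] (f : S → Bool) (a : S → AH) :
    evalAt f (PiTensorProduct.tprod RH a) = ∏ s, character (f s) (a s) := by
  simp [evalAt]

end Algebra

/-! ### Coreduced theories are fully faithful -/

theorem excess_withSphere (S : Circles) (m n : ℕ) (c : S ⊕ Unit) :
    (withSphere S m n).excess c = Sum.elim (fun _ => 0) (fun _ => (n : ℤ) - 1) c := by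
  refine (excess_mk _ _ _ _).trans ?_
  rcases c with c | c <;> simp

/-- A split followed by a merge makes one handle. This expresses the handle operator through the
axioms of the TQFT; the circles of `basePoint` have the form `Empty ⊕ Fin 1` so that these axioms
apply with no further circles. -/
theorem withSphere_glue_withSphere :
    ((withSphere ⟨Empty⟩ 1 2).glue (withSphere ⟨Empty⟩ 2 1)).Homeo
      (handles basePoint.circles basePoint.special 1) := by
  have h := mk_eq (withSphere ⟨Empty⟩ 1 2) (withSphere ⟨Empty⟩ 2 1)
  refine Surface.glue_homeo (Z := Empty ⊕ Fin 1)
    (Sum.elim (Sum.map id fun _ => 0) (Sum.map id fun _ => 0))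
    (fun c => Sum.inl (c.map id fun _ => ())) (excess_withSphere _ _ _) (excess_withSphere _ _ _)
    (excess_handles basePoint.circles basePoint.special 1) ?_ ?_ ?_ ?_ ?_ ?_
  · rintro (⟨⟨⟩⟩ | s)
    fin_cases s; rfl
  · rintro (⟨⟨⟩⟩ | s)
    fin_cases s; rfl
  · rintro (⟨⟨⟩⟩ | s)
    rfl
  · rintro (⟨⟨⟩⟩ | s)
    fin_cases s; rfl
  · rintro ((⟨⟨⟩⟩ | ⟨⟩) | (⟨⟨⟩⟩ | ⟨⟩))
    · rfl
    · exact (h (Sum.inr 0)).symm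
  · rintro (⟨⟨⟩⟩ | s)
    fin_cases s
    have h1 : ind (basePoint.special = Sum.inr 0) = 1 := by
      unfold basePoint; simp
    simp [h1]

/-- The tensor `X` on the special circle. -/
def baseTensor : APow basePoint.circles := pureTensor (S := ⟨Empty⟩) Empty.elim ![vX]

theorem pureTensor_smul (a : (⟨Empty⟩ : Circles) → AH) (c : RH) (y : AH) :
    pureTensor a ![c • y] = c • pureTensor a ![y] := by
  have h := (PiTensorProduct.tprod RH (s := fun _ : Circles.add ⟨Empty⟩ 1 => AH)).map_update_smul
    (Sum.elim a ![y]) (Sum.inr 0) c y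
  have h1 : ∀ z, Function.update (Sum.elim a ![y]) (Sum.inr 0) z = Sum.elim a ![z] := by
    intro z
    funext t
    rcases t with t | t
    · exact t.elim
    · fin_cases t; rfl
  rw [h1, h1] at h
  exact h

theorem eq_pureTensor (x : Circles.add ⟨Empty⟩ 1 → AH) :
    PiTensorProduct.tprod RH x = pureTensor (S := ⟨Empty⟩) Empty.elim ![x (Sum.inr 0)] := by
  congr 1
  funext t
  rcases t with t | t
  · exact t.elim
  · fin_cases t; rfl

theorem smul_baseTensor_eq_zero {p : RH} (h : p • baseTensor = 0) : p = 0 := by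
  -- The character `X ↦ H` sends the generator to `H`, which is not a zero divisor.
  have h1 := congrArg (evalAt fun _ => true) h
  rw [map_smul, map_zero] at h1
  have h2 : evalAt (fun _ => true) baseTensor = H := by
    refine (evalAt_tprod _ _).trans ?_
    refine (Fintype.prod_sum_type _).trans ?_
    simp
  rw [h2, smul_eq_mul] at h1
  exact (mul_eq_zero.1 h1).resolve_right Polynomial.X_ne_zero

/-- In `A_H` the ideal generated by `X` is the line spanned by `X`, because `X² = HX`. -/
theorem range_mulSpecial_basePoint :
    LinearMap.range (mulSpecial basePoint) = Submodule.span RH {baseTensor} := by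
  have h1 : ∀ x : basePoint.circles → AH, mulSpecial basePoint (PiTensorProduct.tprod RH x) =
      pureTensor (S := ⟨Empty⟩) Empty.elim ![vX * x (Sum.inr 0)] := by
    intro x
    refine (PiTensorProduct.map_tprod _ _).trans ((eq_pureTensor _).trans ?_)
    congr 4
    exact congrArg (fun f : AH →ₗ[RH] AH => f (x (Sum.inr 0))) (if_pos rfl)
  apply le_antisymm
  · rintro _ ⟨y, rfl⟩
    induction y using PiTensorProduct.induction_on with
    | smul_tprod r x =>
      obtain ⟨c, hc⟩ := exists_vX_mul (x (Sum.inr 0))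
      rw [map_smul, h1, hc, pureTensor_smul]
      exact Submodule.smul_mem _ _ (Submodule.smul_mem _ _ (Submodule.mem_span_singleton_self _))
    | add x y hx hy => rw [map_add]; exact add_mem hx hy
  · rw [Submodule.span_singleton_le_iff_mem]
    refine ⟨PiTensorProduct.tprod RH fun _ => 1, ?_⟩
    rw [h1, mul_one]
    rfl

section FullyFaithful

variable {T : FrobeniusTQFT} (K : CoreducedTheory T)

/-- The handle is comultiplication followed by multiplication: `X ↦ X ⊗ X ↦ X² = HX`. -/
theorem FrobeniusTQFT.map_baseHandle (T : FrobeniusTQFT) :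
    T.e _ (T.F.map baseHandle.1 ((T.e _).symm baseTensor)) = H • baseTensor := by
  have h1 : baseHandle.1 = mor (withSphere ⟨Empty⟩ 1 2) ≫ mor (withSphere ⟨Empty⟩ 2 1) :=
    (mor_eq_of_homeo withSphere_glue_withSphere).symm.trans (mor_comp _ _).symm
  have h2 := T.comul_X ⟨Empty⟩ Empty.elim
  rw [← LinearEquiv.eq_symm_apply] at h2
  have h3 := T.mul ⟨Empty⟩ Empty.elim vX vX
  rw [← h2, vX_mul_vX, pureTensor_smul] at h3
  exact (congrArg (fun φ => T.e _ (φ ((T.e _).symm baseTensor)))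
    ((congrArg T.F.map h1).trans (T.F.map_comp _ _))).trans h3

/-- The generator is the preimage of `X` under the inclusion into the tensor power. The value on the
special circle is thus free of rank one, with the handle acting as `H`. -/
theorem CoreducedTheory.exists_generator : ∃ u : (K.F.obj basePoint).obj,
    (∀ x, ∃ p : RH, x = p • u) ∧ (∀ p : RH, p • u = 0 → p = 0) ∧
      (K.F.map baseHandle).hom u = H • u := by
  have hr := (K.range_incl basePoint).trans range_mulSpecial_basePoint
  obtain ⟨u, hu⟩ : baseTensor ∈ LinearMap.range (K.incl basePoint) := by
    rw [hr]; exact Submodule.mem_span_singleton_self _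
  refine ⟨u, fun x => ?_, fun p hp => ?_, ?_⟩
  · have hx : K.incl basePoint x ∈ Submodule.span RH {baseTensor} := by rw [← hr]; exact ⟨x, rfl⟩
    obtain ⟨p, hp⟩ := Submodule.mem_span_singleton.1 hx
    refine ⟨p, K.incl_injective _ ?_⟩
    rw [← hp, map_smul, hu]
  · apply smul_baseTensor_eq_zero
    rw [← hu, ← map_smul, hp, map_zero]
  · apply K.incl_injective
    rw [K.incl_map, hu, T.map_baseHandle, map_smul, hu]

theorem CoreducedTheory.map_baseAction {u : (K.F.obj basePoint).obj}
    (hu : (K.F.map baseHandle).hom u = H • u) (p : RH) :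
    (K.F.map (baseAction p)).hom u = p • u := by
  induction p using Polynomial.induction_on' with
  | add p q hp hq =>
    rw [map_add, K.F.map_add, add_smul, ← hp, ← hq]
    rfl
  | monomial n a =>
    have h : ∀ n : ℕ, (K.F.map (baseAction (Polynomial.X ^ n))).hom u =
        (Polynomial.X ^ n : RH) • u := by
      intro n
      induction n with
      | zero =>
        rw [pow_zero, map_one, one_smul]
        have : K.F.map (1 : End basePoint) = 𝟙 _ := K.F.map_id _
        rw [this]
        rfl
      | succ n ih =>
        have h1 : baseAction (Polynomial.X ^ (n + 1)) =
            baseHandle ≫ baseAction (Polynomial.X ^ n) := by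
          rw [pow_succ, map_mul]
          exact congrArg (fun z => z ≫ baseAction (Polynomial.X ^ n)) (Polynomial.aeval_X baseHandle)
        rw [h1, K.F.map_comp]
        show (K.F.map (baseAction (Polynomial.X ^ n))).hom ((K.F.map baseHandle).hom u) = _
        rw [hu, map_smul, ih, smul_smul, pow_succ']
    -- The coefficient is an integer, so it is respected by any additive functor; powers of the
    -- variable have been treated in `h`.
    have h1 : (Polynomial.monomial n a : RH) = a • Polynomial.X ^ n := by
      rw [Polynomial.smul_X_eq_monomial]
    rw [h1, map_smul, smul_assoc, ← h]
    have h2 : K.F.map (a • baseAction (Polynomial.X ^ n)) =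
      a • K.F.map (baseAction (Polynomial.X ^ n)) := K.F.map_zsmul
    rw [h2]
    rfl

/-- Every endomorphism is a polynomial in the handle, and it acts as that polynomial. An action by
zero forces the polynomial to vanish, and a linear endomorphism is the scalar by which it moves the
generator. -/
theorem CoreducedTheory.map_end_bijective :
    Function.Bijective (K.F.map : (basePoint ⟶ basePoint) → _) := by
  obtain ⟨u, hu1, hu2, hu3⟩ := K.exists_generator
  constructor
  · suffices h : ∀ f : basePoint ⟶ basePoint, K.F.map f = 0 → f = 0 by
      intro f g hfg
      exact sub_eq_zero.1 (h _ (by rw [K.F.map_sub, hfg, sub_self]))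
    intro f hf
    obtain ⟨p, rfl⟩ := baseAction_surjective f
    have h := K.map_baseAction hu3 p
    rw [hf] at h
    rw [hu2 p h.symm, map_zero]
  · intro g
    obtain ⟨p, hp⟩ := hu1 (g.hom u)
    refine ⟨baseAction p, ?_⟩
    ext x
    obtain ⟨q, rfl⟩ := hu1 x
    have h := (K.map_baseAction hu3 p).trans hp.symm
    show (K.F.map (baseAction p)).hom (q • u) = g.hom (q • u)
    rw [map_smul, map_smul, h]

/-- Sandwiched between morphisms through the special circle, `f` becomes an endomorphism of that
circle, where faithfulness is known. The identities at both ends are sums of such morphisms. -/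
instance : K.F.Faithful where
  map_injective {P Q} := by
    suffices h : ∀ f : P ⟶ Q, K.F.map f = 0 → f = 0 by
      intro f g hfg
      exact sub_eq_zero.1 (h _ (by rw [K.F.map_sub, hfg, sub_self]))
    intro f hf
    have h : ∀ e ∈ throughBase P P, ∀ e' ∈ throughBase Q Q, e ≫ f ≫ e' = 0 := by
      intro e he e' he'
      induction he using AddSubgroup.closure_induction with
      | mem e he =>
        obtain ⟨r, i, rfl⟩ := he
        induction he' using AddSubgroup.closure_induction with
        | mem e' he' =>
          obtain ⟨r', i', rfl⟩ := he'
          -- The middle of `(r ≫ i) ≫ f ≫ (r' ≫ i')` is an endomorphism of `basePoint`.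
          have h : i ≫ f ≫ r' = 0 := by
            apply K.map_end_bijective.1
            rw [K.F.map_comp, K.F.map_comp, hf, Limits.zero_comp, Limits.comp_zero, K.F.map_zero]
          rw [Category.assoc, reassoc_of% h, Limits.zero_comp, Limits.comp_zero]
        | zero => simp
        | add a b _ _ ha hb => rw [Preadditive.comp_add, Preadditive.comp_add, ha, hb, add_zero]
        | neg a _ ha => rw [Preadditive.comp_neg, Preadditive.comp_neg, ha, neg_zero]
      | zero => simp
      | add a b _ _ ha hb => rw [Preadditive.add_comp, ha, hb, add_zero]
      | neg a _ ha => rw [Preadditive.neg_comp, ha, neg_zero]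
    simpa using h _ (id_mem_throughBase P) _ (id_mem_throughBase Q)

/-- Same reduction: the middle of a sandwiched `g` is lifted to an endomorphism of `basePoint`, and
the lifts are summed. -/
instance : K.F.Full where
  map_surjective {P Q} g := by
    have h : ∀ e ∈ throughBase P P, ∀ e' ∈ throughBase Q Q,
        ∃ f : P ⟶ Q, K.F.map f = K.F.map e ≫ g ≫ K.F.map e' := by
      intro e he e' he'
      induction he using AddSubgroup.closure_induction with
      | mem e he =>
        obtain ⟨r, i, rfl⟩ := he
        induction he' using AddSubgroup.closure_induction with
        | mem e' he' =>
          obtain ⟨r', i', rfl⟩ := he'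
          obtain ⟨k, hk⟩ := K.map_end_bijective.2 (K.F.map i ≫ g ≫ K.F.map r')
          refine ⟨r ≫ k ≫ i', ?_⟩
          simp only [K.F.map_comp, hk, Category.assoc]
        | zero => exact ⟨0, by simp⟩
        | add a b _ _ ha hb =>
          obtain ⟨f, hf⟩ := ha
          obtain ⟨f', hf'⟩ := hb
          exact ⟨f + f', by simp only [K.F.map_add, Preadditive.comp_add, hf, hf']⟩
        | neg a _ ha =>
          obtain ⟨f, hf⟩ := ha
          exact ⟨-f, by simp only [K.F.map_neg, Preadditive.comp_neg, hf]⟩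
      | zero => exact ⟨0, by simp⟩
      | add a b _ _ ha hb =>
        obtain ⟨f, hf⟩ := ha
        obtain ⟨f', hf'⟩ := hb
        exact ⟨f + f', by simp only [K.F.map_add, Preadditive.add_comp, hf, hf']⟩
      | neg a _ ha =>
        obtain ⟨f, hf⟩ := ha
        exact ⟨-f, by simp only [K.F.map_neg, Preadditive.neg_comp, hf]⟩
    obtain ⟨f, hf⟩ := h _ (id_mem_throughBase P) _ (id_mem_throughBase Q)
    exact ⟨f, by simpa using hf⟩

theorem nonempty_biproduct_iso {A : Type*} [Category A] [Preadditive A]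
    [Limits.HasFiniteBiproducts A] {n : ℕ} {X : Fin n → A} {Y : A} (i : ∀ k, X k ⟶ Y)
    (r : ∀ k, Y ⟶ X k) (h1 : ∀ k, i k ≫ r k = 𝟙 _) (h2 : ∀ k l, k ≠ l → i k ≫ r l = 0)
    (h3 : ∑ k, r k ≫ i k = 𝟙 Y) : Nonempty ((⨁ X) ≅ Y) := by
  refine ⟨⟨Limits.biproduct.desc i, Limits.biproduct.lift r, ?_, ?_⟩⟩
  · apply Limits.biproduct.hom_ext'
    intro k
    apply Limits.biproduct.hom_ext
    intro l
    by_cases h : k = l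
    · subst h; simp [h1]
    · simp [h2 k l h, Limits.biproduct.ι_π_ne _ h]
  · rw [Limits.biproduct.lift_desc, h3]

/-- A basis of a finite free module splits it into copies of the rank one module assigned to the
special circle. -/
instance : (onColumns K.F).IsEquivalence := by
  refine isEquivalence_onColumns K.F fun Y => ?_
  obtain ⟨hfree, hfin⟩ := Y.property
  let b := Module.finBasis RH Y.obj
  obtain ⟨u, hu1, hu2, -⟩ := K.exists_generator
  let e : RH ≃ₗ[RH] (K.F.obj basePoint).obj := LinearEquiv.ofBijective
    (LinearMap.toSpanSingleton RH _ u)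
    ⟨(injective_iff_map_eq_zero _).2 hu2, fun x => (hu1 x).imp fun p hp => hp.symm⟩
  let i : ∀ k, K.F.obj basePoint ⟶ Y := fun k =>
    ⟨ModuleCat.ofHom ((LinearMap.toSpanSingleton RH _ (b k)).comp e.symm.toLinearMap)⟩
  let r : ∀ k, Y ⟶ K.F.obj basePoint := fun k =>
    ⟨ModuleCat.ofHom (e.toLinearMap.comp (b.coord k))⟩
  refine ⟨_, fun _ => basePoint, nonempty_biproduct_iso i r (fun k => ?_) (fun k l h => ?_) ?_⟩
  · ext x
    show e (b.coord k (e.symm x • b k)) = x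
    simp
  · ext x
    show e (b.coord l (e.symm x • b k)) = 0
    simp [h]
  · ext x
    have hs : ∀ s : Finset (Fin (Module.finrank RH Y.obj)), (∑ k ∈ s, r k ≫ i k).hom x =
        ∑ k ∈ s, b.repr x k • b k := by
      intro s
      induction s using Finset.induction_on with
      | empty => rfl
      | insert k s hk ih =>
        rw [Finset.sum_insert hk, Finset.sum_insert hk, ← ih]
        show e.symm (e (b.coord k x)) • b k + _ = _
        rw [e.symm_apply_apply]
        rfl
    exact (hs _).trans (b.sum_repr x)

end FullyFaithful

/-! ### Evaluation of tensors -/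

section Evaluation

open scoped TensorProduct

/-- The basis `1, X` of `A_H`. -/
def basisAH : Module.Basis (Fin 2) RH AH :=
  have hdeg : (Polynomial.C H * Polynomial.X : Polynomial RH).degree < 2 :=
    (Polynomial.degree_C_mul_X_le _).trans_lt (by norm_num)
  have hmonic : (Polynomial.X ^ 2 - Polynomial.C H * Polynomial.X : Polynomial RH).Monic :=
    Polynomial.monic_X_pow_sub (n := 2) hdeg
  have hnat : (Polynomial.X ^ 2 - Polynomial.C H * Polynomial.X : Polynomial RH).natDegree = 2 :=
    Polynomial.natDegree_eq_of_degree_eq_some (by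
      rw [Polynomial.degree_sub_eq_left_of_degree_lt] <;> rw [Polynomial.degree_X_pow]
      exact hdeg)
  (AdjoinRoot.powerBasis' hmonic).basis.reindex (finCongr hnat)

@[simp] theorem basisAH_zero : basisAH 0 = 1 := by
  unfold basisAH
  rw [Module.Basis.reindex_apply, PowerBasis.basis_eq_pow]
  exact pow_zero _

@[simp] theorem basisAH_one : basisAH 1 = vX := by
  unfold basisAH
  rw [Module.Basis.reindex_apply, PowerBasis.basis_eq_pow]
  exact pow_one _

@[simp] theorem basisAH_repr_one : basisAH.repr 1 = Finsupp.single 0 1 := by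
  rw [← basisAH_zero, Module.Basis.repr_self]

@[simp] theorem basisAH_repr_vX : basisAH.repr vX = Finsupp.single 1 1 := by
  rw [← basisAH_one, Module.Basis.repr_self]

/-- The two characters agree modulo `H`, and the quotient of their difference by `H` is the
coefficient of `X`. Integrality of the state sum depends on this. -/
theorem character_true_eq (y : AH) :
    character true y = character false y + H * basisAH.coord 1 y := by
  have h : (character true).toLinearMap =
      (character false).toLinearMap + H • basisAH.coord 1 := by
    refine basisAH.ext fun i => ?_
    fin_cases i <;> simp
  exact LinearMap.congr_fun h y

theorem character_false_eq (y : AH) : character false y = basisAH.coord 0 y := by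
  have h : (character false).toLinearMap = basisAH.coord 0 := by
    refine basisAH.ext fun i => ?_
    fin_cases i <;> simp
  exact LinearMap.congr_fun h y

variable {S : Type} [Fintype S]

/-- A tensor is determined by its evaluations. -/
theorem eq_zero_of_evalAt {x : ⨂[RH] _ : S, AH} (h : ∀ f : S → Bool, evalAt f x = 0) : x = 0 := by
  classical
  -- For `y = c₀ + c₁ X` the characters are `c₀` and `c₀ + H c₁`. The matrix `m` recovers `H c₀` and
  -- `H c₁` from them, inverting up to the factor `H`.
  let m : Fin 2 → Bool → RH := ![fun b => if b then 0 else H, fun b => if b then 1 else -1]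
  have hm : ∀ i y, H * basisAH.coord i y = ∑ b, m i b * character b y := by
    intro i y
    fin_cases i
    · simp [m, character_false_eq]
    · simp [m, character_true_eq]
  let b := Basis.piTensorProduct fun _ : S => basisAH
  refine b.ext_elem fun p => ?_
  -- The tensor power of that inversion costs one factor `H` for each circle, harmless since `ℤ[H]`
  -- is a domain.
  have key : (H ^ Fintype.card S) • b.coord p =
      ∑ f : S → Bool, (∏ s, m (p s) (f s)) • evalAt f := by
    refine PiTensorProduct.ext (MultilinearMap.ext fun a => ?_)
    have h1 : b.coord p (PiTensorProduct.tprod RH a) = ∏ s, basisAH.coord (p s) (a s) :=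
      Basis.piTensorProduct_repr_tprod_apply _ _ _
    simp only [LinearMap.compMultilinearMap_apply, LinearMap.smul_apply, LinearMap.sum_apply, h1,
      evalAt_tprod, smul_eq_mul, ← Finset.prod_mul_distrib]
    rw [← Finset.card_univ, ← Finset.prod_const, ← Finset.prod_mul_distrib]
    simp only [hm]
    rw [Finset.prod_univ_sum, Fintype.piFinset_univ]
  have h2 := LinearMap.congr_fun key x
  simp only [LinearMap.smul_apply, LinearMap.sum_apply, h, mul_zero, Finset.sum_const_zero,
    smul_eq_mul] at h2
  rw [map_zero]
  exact (mul_eq_zero.1 h2).resolve_left (pow_ne_zero _ Polynomial.X_ne_zero)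

theorem evalAt_one (f : S → Bool) : evalAt f 1 = 1 := by
  rw [PiTensorProduct.one_def, evalAt_tprod]; simp

theorem evalAt_mul (f : S → Bool) (x y : ⨂[RH] _ : S, AH) :
    evalAt f (x * y) = evalAt f x * evalAt f y := by
  induction x using PiTensorProduct.induction_on with
  | smul_tprod r a =>
    induction y using PiTensorProduct.induction_on with
    | smul_tprod s b =>
      rw [PiTensorProduct.smul_tprod_mul_smul_tprod, map_smul, map_smul, map_smul, evalAt_tprod,
        evalAt_tprod, evalAt_tprod]
      simp only [Pi.mul_apply, map_mul, Finset.prod_mul_distrib, smul_eq_mul]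
      ring
    | add y z hy hz => rw [mul_add, map_add, map_add, hy, hz, mul_add]
  | add x z hx hz => rw [add_mul, map_add, map_add, hx, hz, add_mul]

/-- Evaluation as a ring homomorphism. -/
def evalAtHom (f : S → Bool) : (⨂[RH] _ : S, AH) →+* RH where
  toFun := evalAt f
  map_one' := evalAt_one f
  map_mul' := evalAt_mul f
  map_zero' := map_zero _
  map_add' := map_add _

open scoped Classical in
/-- The element `X` on the factor of `t`. -/
def generatorAt (t : S) : ⨂[RH] _ : S, AH := PiTensorProduct.singleAlgHom t vX

theorem evalAt_generatorAt (f : S → Bool) (t : S) :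
    evalAt f (generatorAt t) = if f t then H else 0 := by
  classical
  refine (evalAt_tprod _ _).trans ?_
  rw [Fintype.prod_eq_single t]
  · simp
  · intro s hs
    simp [Pi.mulSingle_eq_of_ne hs]

/-- The field of fractions of `ℤ[H]`. -/
abbrev KH : Type := FractionRing RH

/-- The evaluations of a tensor, with values in the field of fractions. -/
def evaluations : (⨂[RH] _ : S, AH) →ₗ[RH] ((S → Bool) → KH) :=
  LinearMap.pi fun f => (Algebra.linearMap RH KH).comp (evalAt f)

theorem evaluations_apply (x : ⨂[RH] _ : S, AH) (f : S → Bool) :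
    evaluations x f = algebraMap RH KH (evalAt f x) := rfl

theorem evaluations_injective : Function.Injective (evaluations (S := S)) := by
  rw [injective_iff_map_eq_zero]
  intro x hx
  refine eq_zero_of_evalAt fun f => ?_
  have h := congrFun hx f
  rw [evaluations_apply] at h
  exact (map_eq_zero_iff _ (IsFractionRing.injective RH KH)).1 h

/-- A character with values in the field of fractions. -/
def characterK (b : Bool) : AH →+* KH := (algebraMap RH KH).comp (character b).toRingHom

theorem characterK_apply (b : Bool) (y : AH) :
    characterK b y = algebraMap RH KH (character b y) := rfl

theorem evaluations_tprod (a : S → AH) (f : S → Bool) :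
    evaluations (PiTensorProduct.tprod RH a) f = ∏ s, characterK (f s) (a s) := by
  rw [evaluations_apply, evalAt_tprod, map_prod]
  rfl

end Evaluation

/-! ### The state sum -/

section StateSum

open scoped Classical in
/-- The indicator of a proposition in the field of fractions. -/
def indK (p : Prop) : KH := if p then 1 else 0

theorem indK_of_not {p : Prop} (h : ¬ p) : indK p = 0 := if_neg h

@[simp] theorem indK_true : indK True = 1 := if_pos trivial

@[simp] theorem indK_false : indK False = 0 := if_neg id

open scoped Classical in
/-- A factor which is present when a proposition holds. -/
def factorIf (p : Prop) (x : KH) : KH := if p then x else 1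

@[simp] theorem factorIf_true (x : KH) : factorIf True x = x := if_pos trivial

@[simp] theorem factorIf_false (x : KH) : factorIf False x = 1 := if_neg id

@[simp] theorem prod_factorIf_eq {α : Type} [Fintype α] (c : α) (f : α → KH) :
    ∏ a, factorIf (a = c) (f a) = f c := by
  classical
  simp [factorIf]

/-- The eigenvalues of the handle operator. -/
def handleValue (b : Bool) : KH := algebraMap RH KH (if b then H else -H)

theorem algebraMap_H_ne_zero : algebraMap RH KH H ≠ 0 :=
  (map_ne_zero_iff _ (IsFractionRing.injective RH KH)).2 Polynomial.X_ne_zero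

theorem handleValue_ne_zero (b : Bool) : handleValue b ≠ 0 := by
  cases b
  · simp [handleValue]
  · simp [handleValue]

namespace Surface

variable {S T U : Type} [Fintype T]

/-- The weight of a colouring of the components. -/
def weight (A : Surface S T) (κ : A.comp → Bool) : KH := ∏ c, handleValue (κ c) ^ A.excess c

open scoped Classical in
/-- The operator of a surface on functions of colourings of the boundary. -/
def stateSum (A : Surface S T) : ((S → Bool) → KH) →ₗ[RH] ((T → Bool) → KH) where
  toFun φ h := ∑ κ : A.comp → Bool, indK (κ ∘ A.out = h) * A.weight κ * φ (κ ∘ A.inn)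
  map_add' φ ψ := by
    funext h
    simp only [Pi.add_apply, mul_add, Finset.sum_add_distrib]
  map_smul' r φ := by
    funext h
    simp only [Pi.smul_apply, mul_smul_comm, Finset.smul_sum, RingHom.id_apply]

open scoped Classical in
theorem stateSum_apply (A : Surface S T) (φ : (S → Bool) → KH) (h : T → Bool) :
    A.stateSum φ h = ∑ κ : A.comp → Bool, indK (κ ∘ A.out = h) * A.weight κ * φ (κ ∘ A.inn) := rfl

theorem zpow_sum {ι : Type} (s : Finset ι) (x : KH) (hx : x ≠ 0) (f : ι → ℤ) :
    x ^ (∑ i ∈ s, f i) = ∏ i ∈ s, x ^ f i := by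
  classical
  induction s using Finset.induction_on with
  | empty => simp
  | insert i s hi ih => rw [Finset.sum_insert hi, Finset.prod_insert hi, zpow_add₀ hx, ih]

-- Turns the additivity of exponents over the pieces of a glued surface into multiplicativity of
-- weights.
open scoped Classical in
theorem prod_handleValue_fibre {X Z : Type} [Fintype X] [Fintype Z] (π : X → Z) (κ : Z → Bool)
    (e : X → ℤ) : ∏ k, handleValue (κ k) ^ (∑ x, if π x = k then e x else 0) =
      ∏ x, handleValue (κ (π x)) ^ e x := by
  have h : ∀ k, handleValue (κ k) ^ (∑ x, if π x = k then e x else 0) =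
      ∏ x, if π x = k then handleValue (κ k) ^ e x else 1 := fun k => by
    rw [zpow_sum _ _ (handleValue_ne_zero _)]
    refine Finset.prod_congr rfl fun x _ => ?_
    split_ifs <;> simp
  rw [Finset.prod_congr rfl fun k _ => h k, Finset.prod_comm]
  refine Finset.prod_congr rfl fun x _ => ?_
  rw [Finset.prod_ite_eq]
  simp

theorem stateSum_congr {A B : Surface S T} (h : A.Homeo B) : A.stateSum = B.stateSum := by
  classical
  obtain ⟨e, h1, h2, h3⟩ := h
  have he : ∀ c, B.excess (e c) = A.excess c := fun c => by
    unfold excess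
    simp only [← h2, EmbeddingLike.apply_eq_iff_eq, h3]
  refine LinearMap.ext fun φ => funext fun f => ?_
  rw [stateSum_apply, stateSum_apply]
  refine Fintype.sum_equiv (e.arrowCongr (Equiv.refl Bool)) _ _ fun κ => ?_
  have hκ : ∀ c, e.arrowCongr (Equiv.refl Bool) κ (e c) = κ c := fun c => by
    simp [Equiv.arrowCongr]
  have hw : B.weight (e.arrowCongr (Equiv.refl Bool) κ) = A.weight κ := by
    unfold weight
    rw [← e.prod_comp]
    exact Finset.prod_congr rfl fun c _ => by rw [he, hκ]
  have ho : e.arrowCongr (Equiv.refl Bool) κ ∘ B.out = κ ∘ A.out :=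
    funext fun t => by rw [Function.comp_apply, ← h2, hκ]; rfl
  have hi : e.arrowCongr (Equiv.refl Bool) κ ∘ B.inn = κ ∘ A.inn :=
    funext fun t => by rw [Function.comp_apply, ← h1, hκ]; rfl
  rw [hw, ho, hi]

variable [Fintype S] [Fintype U]

theorem weight_glue (A : Surface S T) (B : Surface T U) (κ : GlueComp A B → Bool) :
    (A.glue B).weight κ = A.weight (fun a => κ (Quot.mk _ (Sum.inl a))) *
      B.weight (fun b => κ (Quot.mk _ (Sum.inr b))) := by
  classical
  unfold weight
  rw [← prod_handleValue_fibre (fun a => (Quot.mk _ (Sum.inl a) : GlueComp A B)) κ,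
    ← prod_handleValue_fibre (fun a => (Quot.mk _ (Sum.inr a) : GlueComp A B)) κ,
    ← Finset.prod_mul_distrib]
  refine Finset.prod_congr rfl fun k _ => ?_
  rw [excess_glue, zpow_add₀ (handleValue_ne_zero _)]

/-- A colouring of the glued surface is a pair of colourings which agree on the common circles, and
weights multiply. -/
theorem stateSum_glue (A : Surface S T) (B : Surface T U) (φ : (S → Bool) → KH) :
    (A.glue B).stateSum φ = B.stateSum (A.stateSum φ) := by
  classical
  funext h
  rw [stateSum_apply, stateSum_apply]
  simp only [stateSum_apply A, Finset.mul_sum]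
  rw [← Fintype.sum_prod_type' (f := fun (κ' : B.comp → Bool) (κ : A.comp → Bool) =>
    indK (κ' ∘ B.out = h) * B.weight κ' *
      (indK (κ ∘ A.out = κ' ∘ B.inn) * A.weight κ * φ (κ ∘ A.inn)))]
  -- Pairs outside the image disagree on some common circle, and their indicator vanishes.
  refine Fintype.sum_of_injective (fun κ : GlueComp A B → Bool =>
    ((fun b => κ (Quot.mk _ (Sum.inr b))), fun a => κ (Quot.mk _ (Sum.inl a)))) ?_ _ _ ?_ ?_
  · intro κ κ' h
    obtain ⟨h1, h2⟩ := Prod.mk.inj h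
    funext k
    obtain ⟨a | b⟩ := k
    · exact congrFun h2 a
    · exact congrFun h1 b
  · rintro ⟨κB, κA⟩ hq
    by_cases hc : κA ∘ A.out = κB ∘ B.inn
    · exfalso
      refine hq ⟨Quot.lift (Sum.elim κA κB) ?_, rfl⟩
      rintro _ _ ⟨t, rfl, rfl⟩
      exact congrFun hc t
    · simp [hc]
  · intro κ
    have hc : (fun a => κ (Quot.mk _ (Sum.inl a))) ∘ A.out =
        (fun b => κ (Quot.mk _ (Sum.inr b))) ∘ B.inn := by
      funext t
      exact congrArg κ (Quot.sound ⟨t, rfl, rfl⟩)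
    have h1 : κ ∘ (A.glue B).out = (fun b => κ (Quot.mk _ (Sum.inr b))) ∘ B.out := rfl
    have h2 : κ ∘ (A.glue B).inn = (fun a => κ (Quot.mk _ (Sum.inl a))) ∘ A.inn := rfl
    rw [weight_glue, h1, h2]
    simp only [hc, indK_true]
    ring

/-- The contribution of a component to the operator of a surface. -/
def localFactor (A : Surface S T) (a : S → AH) (h : T → Bool) (c : A.comp) : KH :=
  ∑ b, indK (∀ t, A.out t = c → h t = b) * handleValue b ^ A.excess c *
    ∏ s, factorIf (A.inn s = c) (characterK b (a s))

/-- On pure tensors the operator of a surface is a product over the components. -/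
theorem stateSum_tprod (A : Surface S T) (a : S → AH) (h : T → Bool) :
    A.stateSum (evaluations (PiTensorProduct.tprod RH a)) h = ∏ c, A.localFactor a h c := by
  classical
  unfold localFactor
  rw [stateSum_apply, Finset.prod_univ_sum, Fintype.piFinset_univ]
  refine Finset.sum_congr rfl fun κ _ => ?_
  rw [Finset.prod_mul_distrib, Finset.prod_mul_distrib, evaluations_tprod]
  congr 1
  · congr 1
    by_cases hc : κ ∘ A.out = h
    · rw [Finset.prod_eq_one]
      · simp [hc]
      · intro c _
        have : ∀ t, A.out t = c → h t = κ c := by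
          rintro t rfl
          exact (congrFun hc t).symm
        exact if_pos this
    · obtain ⟨t, ht⟩ := Function.ne_iff.1 hc
      rw [Finset.prod_eq_zero (Finset.mem_univ (A.out t))]
      · simp [hc]
      · rw [indK_of_not fun h' => ht (h' t rfl).symm]
  · rw [Finset.prod_comm]
    refine Finset.prod_congr rfl fun s _ => ?_
    have : ∀ c, factorIf (A.inn s = c) (characterK (κ c) (a s)) =
        factorIf (c = A.inn s) (characterK (κ c) (a s)) := fun c => congrArg (factorIf · _) (propext eq_comm)
    simp only [this, prod_factorIf_eq]
    rfl

end Surface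

end StateSum

/-! ### Integrality of the state sum -/

section Integrality

open scoped TensorProduct

/-- The factors `x i` and `x i - η` are congruent modulo `η`, so the two products are as well. -/
theorem exists_prod_sub_prod {R ι : Type*} [CommRing R] (s : Finset ι) (x : ι → R) (η : R) :
    ∃ z, ∏ i ∈ s, x i - ∏ i ∈ s, (x i - η) = η * z := by
  classical
  induction s using Finset.induction_on with
  | empty => exact ⟨0, by simp⟩
  | insert i s hi ih =>
    obtain ⟨z, hz⟩ := ih
    refine ⟨x i * z + ∏ i ∈ s, (x i - η), ?_⟩
    rw [Finset.prod_insert hi, Finset.prod_insert hi]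
    linear_combination x i * hz

theorem evalAt_prod {S ι : Type} [Fintype S] (f : S → Bool) (s : Finset ι)
    (x : ι → ⨂[RH] _ : S, AH) : evalAt f (∏ i ∈ s, x i) = ∏ i ∈ s, evalAt f (x i) :=
  map_prod (evalAtHom f) x s

theorem evalAt_algebraMap {S : Type} [Fintype S] (f : S → Bool) (r : RH) :
    evalAt f (algebraMap RH (⨂[RH] _ : S, AH) r) = r := by
  rw [Algebra.algebraMap_eq_smul_one, map_smul, evalAt_one, smul_eq_mul, mul_one]

namespace Surface

/-- One factor of the wrong colour kills the product; otherwise all factors equal the handle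
eigenvalue of `b`. The elements `X` and `X - H` detect the two colours in this way. -/
theorem prod_eq_indK {T : Type} {F : Finset T} {p : Prop} {h : T → Bool} {b : Bool}
    (hp : p ↔ ∀ t ∈ F, h t = b) (x : T → RH)
    (hx : ∀ t, x t = if h t = b then (if b then H else -H) else 0) :
    algebraMap RH KH (∏ t ∈ F, x t) = indK p * handleValue b ^ F.card := by
  by_cases hc : p
  · have h1 : ∀ t ∈ F, x t = if b then H else -H := fun t ht => by
      rw [hx, if_pos (hp.1 hc t ht)]
    rw [Finset.prod_congr rfl h1, Finset.prod_const, map_pow]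
    simp [hc, handleValue]
  · have h1 : ∃ t ∈ F, h t ≠ b := by
      by_contra h2
      push Not at h2
      exact hc (hp.2 h2)
    obtain ⟨t, ht, htb⟩ := h1
    rw [Finset.prod_eq_zero ht (by rw [hx, if_neg htb])]
    simp [hc]

variable {S T : Type} [Fintype S] [Fintype T]

/-- Up to a single division by `H`, the contribution of a component is `χ₁(y) ∏ X - χ₀(y) ∏ (X -
H)`, with the products over its outgoing circles and `χ₁`, `χ₀` the characters `X ↦ H`, `X ↦ 0`. The
two products are congruent modulo `H`, and so are the two character values, so the division is
possible. -/
theorem exists_localFactor (A : Surface S T) (a : S → AH) (c : A.comp) :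
    ∃ z : ⨂[RH] _ : T, AH, ∀ h, evaluations z h = A.localFactor a h c := by
  classical
  let F : Finset T := Finset.univ.filter fun t => A.out t = c
  have hchi : ∀ b, character b (2 * vX - algebraMap RH AH H) = if b then H else -H := by
    intro b
    rw [map_sub, map_mul, character_vX, AlgHom.commutes, map_ofNat]
    cases b
    · simp
    · simp only [if_true, Algebra.algebraMap_self, RingHom.id_apply]; ring
  obtain ⟨y, hy⟩ : ∃ y : AH, ∀ b, characterK b y =
      (∏ s, factorIf (A.inn s = c) (characterK b (a s))) * handleValue b ^ A.genus c := by
    -- The inputs are multiplied together, and each handle contributes `2X - H`, the product of the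
    -- comultiplication of `1`, with eigenvalues `±H`.
    refine ⟨(∏ s, if A.inn s = c then a s else 1) * (2 * vX - algebraMap RH AH H) ^ A.genus c,
      fun b => ?_⟩
    rw [map_mul, map_prod, map_pow]
    congr 1
    · refine Finset.prod_congr rfl fun s _ => ?_
      unfold factorIf
      split_ifs
      · rfl
      · exact map_one _
    · rw [characterK_apply, hchi]; rfl
  obtain ⟨z, hz⟩ := exists_prod_sub_prod F (fun t => generatorAt (S := T) t) (algebraMap _ _ H)
  -- With `P = ∏ X` and `Q = ∏ (X - H)`, and `c₁` the coefficient of `X` in `y`, this is `(χ₁(y) P -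
  -- χ₀(y) Q) / H = c₁ P + χ₀(y) (P - Q) / H`, where `z` is `(P - Q) / H`.
  refine ⟨basisAH.coord 1 y • ∏ t ∈ F, generatorAt t + character false y • z, fun h => ?_⟩
  have hP : algebraMap RH KH (∏ t ∈ F, evalAt h (generatorAt t)) =
      indK (∀ t, A.out t = c → h t = true) * handleValue true ^ F.card :=
    prod_eq_indK (h := h) (by simp [F]) _ fun t => by rw [evalAt_generatorAt]; simp
  have hQ : algebraMap RH KH (∏ t ∈ F, (evalAt h (generatorAt t) - H)) =
      indK (∀ t, A.out t = c → h t = false) * handleValue false ^ F.card :=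
    prod_eq_indK (h := h) (by simp [F]) _ fun t => by
      rw [evalAt_generatorAt]; cases h t <;> simp
  have hexc : A.excess c = A.genus c + F.card - 1 := by
    unfold excess ind
    rw [Finset.card_filter]
    push_cast
    rfl
  -- The summand `-1` of the excess is the one inverse handle eigenvalue, which is the division by
  -- `±H` to be justified.
  have hterm : ∀ b, indK (∀ t, A.out t = c → h t = b) * handleValue b ^ A.excess c *
      ∏ s, factorIf (A.inn s = c) (characterK b (a s)) =
      (handleValue b)⁻¹ * (indK (∀ t, A.out t = c → h t = b) * handleValue b ^ F.card) *
        characterK b y := by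
    intro b
    rw [hy, hexc, zpow_sub₀ (handleValue_ne_zero b), zpow_add₀ (handleValue_ne_zero b),
      zpow_natCast, zpow_natCast, zpow_one, div_eq_mul_inv]
    ring
  have hz' := congrArg (fun x => algebraMap RH KH (evalAt h x)) hz
  simp only [map_sub, evalAt_prod, evalAt_mul, evalAt_algebraMap] at hz'
  rw [map_mul] at hz'
  have hy1 : characterK true y = characterK false y +
      algebraMap RH KH H * algebraMap RH KH (basisAH.coord 1 y) := by
    rw [characterK_apply, character_true_eq, map_add, map_mul, characterK_apply]
  have hH := algebraMap_H_ne_zero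
  have ht : handleValue true = algebraMap RH KH H := rfl
  have hf : handleValue false = -algebraMap RH KH H := map_neg _ _
  unfold localFactor
  rw [Fintype.sum_bool, hterm, hterm, ← hP, ← hQ, hy1, ht, hf, evaluations_apply, map_add, map_smul,
    map_smul, evalAt_prod, smul_eq_mul, smul_eq_mul, map_add, map_mul, map_mul, ← characterK_apply]
  set P := algebraMap RH KH (∏ t ∈ F, evalAt h (generatorAt t))
  field_simp
  linear_combination (-characterK false y) * hz'

/-- On a pure tensor the result is a product of local contributions. Each is integral, and
evaluation is multiplicative for the algebra structure of the tensor power. -/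
theorem stateSum_mem_range (A : Surface S T) (x : ⨂[RH] _ : S, AH) :
    A.stateSum (evaluations x) ∈ LinearMap.range (evaluations (S := T)) := by
  induction x using PiTensorProduct.induction_on with
  | smul_tprod r a =>
    rw [map_smul, map_smul]
    refine Submodule.smul_mem _ _ ?_
    choose z hz using fun c => A.exists_localFactor a c
    refine ⟨∏ c, z c, funext fun h => ?_⟩
    rw [stateSum_tprod, evaluations_apply, evalAt_prod, map_prod]
    exact Finset.prod_congr rfl fun c _ => hz c h
  | add x y hx hy => rw [map_add, map_add]; exact add_mem hx hy

/-- The map of tensor powers induced by a surface. -/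
def tensorMap (A : Surface S T) : (⨂[RH] _ : S, AH) →ₗ[RH] ⨂[RH] _ : T, AH :=
  (LinearEquiv.ofInjective evaluations evaluations_injective).symm.toLinearMap.comp
    ((A.stateSum.comp evaluations).codRestrict _ A.stateSum_mem_range)

theorem evaluations_tensorMap (A : Surface S T) (x : ⨂[RH] _ : S, AH) :
    evaluations (A.tensorMap x) = A.stateSum (evaluations x) :=
  congrArg Subtype.val ((LinearEquiv.ofInjective evaluations evaluations_injective).apply_symm_apply
    ((A.stateSum.comp evaluations).codRestrict _ A.stateSum_mem_range x))

theorem tensorMap_glue {U : Type} [Fintype U] (A : Surface S T) (B : Surface T U) :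
    (A.glue B).tensorMap = B.tensorMap.comp A.tensorMap := by
  refine LinearMap.ext fun x => evaluations_injective ?_
  rw [LinearMap.comp_apply, evaluations_tensorMap, evaluations_tensorMap, evaluations_tensorMap,
    stateSum_glue]

theorem tensorMap_congr {A B : Surface S T} (h : A.Homeo B) : A.tensorMap = B.tensorMap := by
  refine LinearMap.ext fun x => evaluations_injective ?_
  rw [evaluations_tensorMap, evaluations_tensorMap, stateSum_congr h]

theorem evaluations_tensorMap_tprod (A : Surface S T) (a : S → AH) (h : T → Bool) :
    evaluations (A.tensorMap (PiTensorProduct.tprod RH a)) h = ∏ c, A.localFactor a h c := by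
  rw [evaluations_tensorMap, stateSum_tprod]

theorem localFactor_mk {X : Type} [Fintype X] (i : S → X) (o : T → X) (g : X → ℕ) (e : X → ℤ)
    (he : ∀ c, (Surface.mk X i o g).excess c = e c) (a : S → AH) (h : T → Bool) (c : X) :
    (Surface.mk X i o g).localFactor a h c =
      ∑ b, indK (∀ t, o t = c → h t = b) * handleValue b ^ e c *
        ∏ s, factorIf (i s = c) (characterK b (a s)) := by
  rw [← he]; rfl

end Surface

theorem tensorMap_cylinder {S T : Type} [Fintype S] [Fintype T] (σ : S ≃ T) (a : S → AH) :
    (Surface.cylinder σ).tensorMap (PiTensorProduct.tprod RH a) =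
      PiTensorProduct.tprod RH fun t => a (σ.symm t) := by
  apply evaluations_injective
  funext h
  rw [Surface.evaluations_tensorMap_tprod, evaluations_tprod]
  refine Finset.prod_congr rfl fun c _ => ?_
  refine (Surface.localFactor_mk _ _ _ _ (excess_cylinder σ) a h c).trans ?_
  have h1 : ∀ s, (σ s = c) = (s = σ.symm c) := fun s => propext (σ.eq_symm_apply).symm
  simp only [h1, prod_factorIf_eq]
  cases hc : h c <;> simp [hc]

/-- One formula from which all structure maps of the Frobenius system are read off: the cylinders
act trivially, and a sphere with `n` outgoing circles has excess `n - 1`. -/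
theorem tensorMap_withSphere (S : Circles) (m n : ℕ) (a : S → AH) (x : Fin m → AH)
    (h : S.add n → Bool) :
    evaluations ((withSphere S m n).tensorMap (pureTensor a x)) h =
      (∏ s, characterK (h (Sum.inl s)) (a s)) *
        ∑ b, indK (∀ j, h (Sum.inr j) = b) * handleValue b ^ ((n : ℤ) - 1) *
          ∏ i, characterK b (x i) := by
  rw [Surface.evaluations_tensorMap_tprod]
  refine (Fintype.prod_sum_type _).trans ?_
  congr 1
  · refine Finset.prod_congr rfl fun c _ => ?_
    refine (Surface.localFactor_mk _ _ _ _ (excess_withSphere S m n) _ h (Sum.inl c)).trans ?_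
    cases hc : h (Sum.inl c) <;> simp [hc, Fintype.prod_sum_type]
  · refine (Fintype.prod_unique _).trans ?_
    refine (Surface.localFactor_mk _ _ _ _ (excess_withSphere S m n) _ h (Sum.inr ())).trans ?_
    simp

theorem evaluations_pureTensor (S : Circles) (n : ℕ) (a : S → AH) (x : Fin n → AH)
    (h : S.add n → Bool) : evaluations (pureTensor a x) h =
      (∏ s, characterK (h (Sum.inl s)) (a s)) * ∏ i, characterK (h (Sum.inr i)) (x i) :=
  (evaluations_tprod _ _).trans (Fintype.prod_sum_type _)

end Integrality

/-! ### The functor `F_H` -/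

section FreeLift

universe w₁ w₂ w₃ w₄

variable {C : Type w₁} [Category.{w₂} C] {D : Type w₃} [Category.{w₄} D] [Preadditive D]

/-- The additive extension of a functor to formal integer combinations of morphisms, on
morphisms. -/
def freeMap (F : C ⥤ D) (X Y : C) :
    ((Free.embedding ℤ C).obj X ⟶ (Free.embedding ℤ C).obj Y) →+ (F.obj X ⟶ F.obj Y) :=
  Finsupp.liftAddHom fun f => (zmultiplesHom _ (F.map f))

theorem freeMap_single (F : C ⥤ D) {X Y : C} (f : X ⟶ Y) (n : ℤ) :
    freeMap F X Y (Finsupp.single f n) = n • F.map f :=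
  Finsupp.liftAddHom_apply_single (fun f : X ⟶ Y => zmultiplesHom _ (F.map f)) f n

theorem freeMap_id (F : C ⥤ D) (X : C) :
    freeMap F X X (𝟙 ((Free.embedding ℤ C).obj X)) = 𝟙 (F.obj X) := by
  refine (freeMap_single F (𝟙 X) 1).trans ?_
  rw [one_smul, CategoryTheory.Functor.map_id]

theorem freeMap_comp_single (F : C ⥤ D) {X Y Z : C} (f : X ⟶ Y) (g : Y ⟶ Z) (m n : ℤ) :
    freeMap F X Z (Finsupp.single (f ≫ g) (m * n)) =
      freeMap F X Y (Finsupp.single f m) ≫ freeMap F Y Z (Finsupp.single g n) := by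
  refine (freeMap_single F _ _).trans
    (Eq.trans ?_ (congrArg₂ (· ≫ ·) (freeMap_single F f m) (freeMap_single F g n)).symm)
  rw [Preadditive.zsmul_comp, Preadditive.comp_zsmul, smul_smul]
  exact congrArg ((m * n) • ·) (F.map_comp f g)

/-- Both sides are biadditive, so it suffices to compare them on multiples of single morphisms. -/
theorem freeMap_comp (F : C ⥤ D) {X Y Z : C}
    (f : (Free.embedding ℤ C).obj X ⟶ (Free.embedding ℤ C).obj Y)
    (g : (Free.embedding ℤ C).obj Y ⟶ (Free.embedding ℤ C).obj Z) :
    freeMap F X Z (f ≫ g) = freeMap F X Y f ≫ freeMap F Y Z g := by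
  have hg : (freeMap F X Z).comp (Preadditive.rightComp _ g) =
      (Preadditive.rightComp _ (freeMap F Y Z g)).comp (freeMap F X Y) := by
    refine Finsupp.addHom_ext fun f m => ?_
    have hf : (freeMap F X Z).comp (Preadditive.leftComp _ (Finsupp.single f m :
        (Free.embedding ℤ C).obj X ⟶ (Free.embedding ℤ C).obj Y)) =
        (Preadditive.leftComp _ (freeMap F X Y (Finsupp.single f m))).comp (freeMap F Y Z) := by
      refine Finsupp.addHom_ext fun g n => ?_
      exact (congrArg (freeMap F X Z) (Free.single_comp_single ℤ _ f g m n)).trans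
        (freeMap_comp_single F f g m n)
    exact DFunLike.congr_fun hf g
  exact DFunLike.congr_fun hg f

/-- The additive extension of a functor to formal integer combinations of morphisms. -/
def freeLift (F : C ⥤ D) : Free ℤ C ⥤ D where
  obj X := F.obj X
  map {X Y} f := freeMap F X Y f
  map_id X := freeMap_id F X
  map_comp f g := freeMap_comp F f g

instance (F : C ⥤ D) : (freeLift F).Additive where
  map_add {X Y f g} := map_add (freeMap F X Y) f g

theorem freeLift_map_embedding (F : C ⥤ D) {X Y : C} (f : X ⟶ Y) :
    (freeLift F).map ((Free.embedding ℤ C).map f) = F.map f :=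
  (freeMap_single F f 1).trans (one_smul _ _)

end FreeLift

/-- The tensor powers of `A_H` as a functor on cobordisms. -/
def tensorFunctor : Circles ⥤ ModuleCat.{0} RH where
  obj S := ModuleCat.of RH (APow S)
  map f := Quotient.lift (fun A : Surface _ _ => ModuleCat.ofHom A.tensorMap)
    (fun A B (h : A.Homeo B) => congrArg ModuleCat.ofHom (Surface.tensorMap_congr h)) f
  map_id S := by
    refine congrArg ModuleCat.ofHom (PiTensorProduct.ext (MultilinearMap.ext fun a => ?_))
    exact tensorMap_cylinder (Equiv.refl S) a
  map_comp := by
    rintro S T U ⟨A⟩ ⟨B⟩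
    exact congrArg ModuleCat.ofHom (Surface.tensorMap_glue A B)

/-- The extension of the tensor power functor to formal combinations. -/
abbrev tensorLift : ZCob ⥤ ModuleCat.{0} RH := freeLift tensorFunctor

theorem tensorLift_zcob {S T : Circles} (A : Surface S T) :
    tensorLift.map (zcob A) = ModuleCat.ofHom A.tensorMap :=
  freeLift_map_embedding _ _

/-! ### The local relations hold for the tensor maps -/

theorem evaluations_withClosed (S : Circles) (g : ℕ) (a : S → AH) (h : S → Bool) :
    evaluations ((withClosed S g).tensorMap (PiTensorProduct.tprod RH a)) h =
      (∏ s, characterK (h s) (a s)) * ∑ b, handleValue b ^ ((g : ℤ) - 1) := by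
  rw [Surface.evaluations_tensorMap_tprod]
  refine (Fintype.prod_sum_type _).trans ?_
  congr 1
  · refine Finset.prod_congr rfl fun c _ => ?_
    refine (Surface.localFactor_mk _ _ _ _ (excess_withClosed S g) _ h (Sum.inl c)).trans ?_
    cases hc : h c <;> simp [hc]
  · refine (Fintype.prod_unique _).trans ?_
    refine (Surface.localFactor_mk _ _ _ _ (excess_withClosed S g) _ h (Sum.inr ())).trans ?_
    simp

theorem evaluations_newDiscs (S : Circles) {k m : ℕ} (p : Fin k → Fin m) (a : S → AH)
    (h : S.add k → Bool) :
    evaluations ((newDiscs S p).tensorMap (PiTensorProduct.tprod RH a)) h =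
      (∏ s, characterK (h (Sum.inl s)) (a s)) * ∏ j, ∑ b, indK (∀ i, p i = j → h (Sum.inr i) = b) *
        handleValue b ^ ((∑ i, ind (p i = j)) - 1) := by
  rw [Surface.evaluations_tensorMap_tprod]
  refine (Fintype.prod_sum_type _).trans ?_
  congr 1
  · refine Finset.prod_congr rfl fun c _ => ?_
    refine (Surface.localFactor_mk _ _ _ _ (excess_newDiscs S p) _ h (Sum.inl c)).trans ?_
    cases hc : h (Sum.inl c) <;> simp [hc]
  · refine Finset.prod_congr rfl fun j _ => ?_
    refine (Surface.localFactor_mk _ _ _ _ (excess_newDiscs S p) _ h (Sum.inr j)).trans ?_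
    simp

/-- The sphere is the sum of the inverse eigenvalues, `1/H - 1/H`. -/
theorem withClosed_zero_tensorMap (S : Circles) : (withClosed S 0).tensorMap = 0 := by
  refine PiTensorProduct.ext (MultilinearMap.ext fun a => evaluations_injective (funext fun h => ?_))
  refine (evaluations_withClosed S 0 a h).trans ?_
  simp [handleValue]

/-- The torus has excess zero and counts the two colours. -/
theorem withClosed_one_tensorMap (S : Circles) :
    (withClosed S 1).tensorMap = (2 : ℤ) • LinearMap.id := by
  refine PiTensorProduct.ext (MultilinearMap.ext fun a => evaluations_injective (funext fun h => ?_))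
  refine (evaluations_withClosed S 1 a h).trans ?_
  refine Eq.trans ?_ (congrFun (map_zsmul evaluations (2 : ℤ) (PiTensorProduct.tprod RH a)).symm h)
  rw [Pi.smul_apply, evaluations_tprod]
  simp
  ring

/-- A disc contributes 1, and a tube between the sites `i` and `j` contributes the eigenvalue of
their colour if the colours agree and 0 otherwise. As the eigenvalues are `±H`, this is half the sum
of the eigenvalues at `i` and `j`. Both sides of the relation are therefore half the sum over all
four sites; the proof checks the sixteen colourings. -/
theorem fourTU_tensorMap (S : Circles) :
    (newDiscs S (![0, 0, 1, 2] : Fin 4 → Fin 3)).tensorMap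
      + (newDiscs S (![1, 2, 0, 0] : Fin 4 → Fin 3)).tensorMap
      - (newDiscs S (![0, 1, 0, 2] : Fin 4 → Fin 3)).tensorMap
      - (newDiscs S (![1, 0, 2, 0] : Fin 4 → Fin 3)).tensorMap = 0 := by
  refine PiTensorProduct.ext (MultilinearMap.ext fun a => evaluations_injective (funext fun h => ?_))
  refine (congrFun ((map_sub evaluations _ _).trans (congrArg₂ (· - ·) ((map_sub evaluations _ _).trans
    (congrArg₂ (· - ·) (map_add evaluations _ _) rfl)) rfl)) h).trans ?_
  refine (congrArg₂ (· - ·) (congrArg₂ (· - ·) (congrArg₂ (· + ·) (evaluations_newDiscs S _ a h)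
    (evaluations_newDiscs S _ a h)) (evaluations_newDiscs S _ a h))
    (evaluations_newDiscs S _ a h)).trans ?_
  refine Eq.trans ?_ (congrFun (map_zero evaluations).symm h)
  rw [← mul_add, ← mul_sub, ← mul_sub]
  refine mul_eq_zero_of_right _ ?_
  generalize h0 : h (Sum.inr 0) = b0
  generalize h1 : h (Sum.inr 1) = b1
  generalize h2 : h (Sum.inr 2) = b2
  generalize h3 : h (Sum.inr 3) = b3
  simp only [Fin.prod_univ_three, Fin.sum_univ_four, Fin.forall_fin_succ]
  cases b0 <;> cases b1 <;> cases b2 <;> cases b3 <;> simp [h0, h1, h2, h3, handleValue]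
theorem tensorLift_eq_zero {X Y : ZCob} {f : X ⟶ Y} (hf : f ∈ relations X Y) :
    tensorLift.map f = 0 := by
  induction hf using AddSubgroup.closure_induction with
  | mem f hf =>
    cases hf with
    | fourTU S pre post =>
      rw [Functor.map_comp, Functor.map_comp, Functor.map_sub, Functor.map_sub, Functor.map_add]
      have h : tensorLift.map (zcob (newDiscs S (![0, 0, 1, 2] : Fin 4 → Fin 3)))
          + tensorLift.map (zcob (newDiscs S (![1, 2, 0, 0] : Fin 4 → Fin 3)))
          - tensorLift.map (zcob (newDiscs S (![0, 1, 0, 2] : Fin 4 → Fin 3)))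
          - tensorLift.map (zcob (newDiscs S (![1, 0, 2, 0] : Fin 4 → Fin 3))) = 0 := by
        rw [tensorLift_zcob, tensorLift_zcob, tensorLift_zcob, tensorLift_zcob]
        exact congrArg ModuleCat.ofHom (fourTU_tensorMap S)
      rw [h, Limits.zero_comp, Limits.comp_zero]
    | sphere S pre post =>
      rw [Functor.map_comp, Functor.map_comp, tensorLift_zcob, withClosed_zero_tensorMap]
      exact (congrArg (_ ≫ ·) Limits.zero_comp).trans Limits.comp_zero
    | torus S pre post =>
      rw [Functor.map_comp, Functor.map_comp, Functor.map_sub, Functor.map_zsmul]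
      have h : tensorLift.map (zcob (withClosed S 1)) - (2 : ℤ) • tensorLift.map (𝟙 S.z) = 0 := by
        rw [tensorLift_zcob, withClosed_one_tensorMap, CategoryTheory.Functor.map_id]
        exact sub_self _
      rw [h, Limits.zero_comp, Limits.comp_zero]
  | zero => exact Functor.map_zero _ _ _
  | add f g _ _ hf hg => rw [Functor.map_add, hf, hg, add_zero]
  | neg f _ hf => rw [Functor.map_neg, hf, neg_zero]

/-- The tensor powers of `A_H` as a functor on `Cob_{/l}`. -/
def coblFunctor : Cobl ⥤ ModuleCat.{0} RH :=
  CategoryTheory.Quotient.lift relHom tensorLift fun _ _ f g h => by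
    rw [← sub_eq_zero, ← Functor.map_sub]
    exact tensorLift_eq_zero h

instance : coblFunctor.Additive where
  map_add := by
    rintro X Y ⟨f⟩ ⟨g⟩
    exact tensorLift.map_add (f := f) (g := g)

theorem coblFunctor_mor {S T : Circles} (A : Surface S T) :
    coblFunctor.map (mor A) = ModuleCat.ofHom A.tensorMap :=
  tensorLift_zcob A

/-! ### The structure maps of the Frobenius system -/

theorem tensorMap_unit (S : Circles) (a : S → AH) :
    (withSphere S 0 1).tensorMap (pureTensor a ![]) = pureTensor a ![1] := by
  refine evaluations_injective (funext fun h => ?_)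
  refine (tensorMap_withSphere S 0 1 a _ h).trans (Eq.trans ?_ (evaluations_pureTensor S 1 a _ h).symm)
  cases h0 : h (Sum.inr 0) <;> simp [h0]

theorem tensorMap_counit_one (S : Circles) (a : S → AH) :
    (withSphere S 1 0).tensorMap (pureTensor a ![1]) = 0 := by
  refine evaluations_injective (funext fun h => ?_)
  refine (tensorMap_withSphere S 1 0 a _ h).trans
    (Eq.trans ?_ (congrFun (map_zero evaluations).symm h))
  simp [handleValue]

@[simp] theorem characterK_vX (b : Bool) :
    characterK b vX = if b then algebraMap RH KH H else 0 := by
  rw [characterK_apply, character_vX]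
  cases b <;> simp

theorem tensorMap_counit_vX (S : Circles) (a : S → AH) :
    (withSphere S 1 0).tensorMap (pureTensor a ![vX]) = pureTensor a ![] := by
  refine evaluations_injective (funext fun h => ?_)
  refine (tensorMap_withSphere S 1 0 a _ h).trans (Eq.trans ?_ (evaluations_pureTensor S 0 a _ h).symm)
  simp [handleValue]

theorem tensorMap_mul (S : Circles) (a : S → AH) (x y : AH) :
    (withSphere S 2 1).tensorMap (pureTensor a ![x, y]) = pureTensor a ![x * y] := by
  refine evaluations_injective (funext fun h => ?_)
  refine (tensorMap_withSphere S 2 1 a _ h).trans (Eq.trans ?_ (evaluations_pureTensor S 1 a _ h).symm)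
  cases h0 : h (Sum.inr 0) <;> simp [h0]

/-- At two circles of equal colour both sides give the handle eigenvalue, `2H - H` or `-H`; at
different colours both vanish. -/
theorem tensorMap_comul_one (S : Circles) (a : S → AH) :
    (withSphere S 1 2).tensorMap (pureTensor a ![1]) =
      pureTensor a ![1, vX] + pureTensor a ![vX, 1] - H • pureTensor a ![1, 1] := by
  refine evaluations_injective (funext fun h => ?_)
  refine (tensorMap_withSphere S 1 2 a _ h).trans (Eq.trans ?_ (congrFun ((map_sub evaluations _ _).trans
    (congrArg₂ (· - ·) (map_add evaluations _ _) (map_smul evaluations _ _))) h).symm)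
  refine Eq.trans ?_ (congrArg₂ (· - ·) (congrArg₂ (· + ·) (evaluations_pureTensor S 2 a _ h)
    (evaluations_pureTensor S 2 a _ h)) (congrArg (H • ·) (evaluations_pureTensor S 2 a _ h))).symm
  rw [Algebra.smul_def]
  cases h0 : h (Sum.inr 0) <;> cases h1 : h (Sum.inr 1) <;>
    simp [h0, h1, handleValue] <;> ring

theorem tensorMap_comul_vX (S : Circles) (a : S → AH) :
    (withSphere S 1 2).tensorMap (pureTensor a ![vX]) = pureTensor a ![vX, vX] := by
  refine evaluations_injective (funext fun h => ?_)
  refine (tensorMap_withSphere S 1 2 a _ h).trans (Eq.trans ?_ (evaluations_pureTensor S 2 a _ h).symm)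
  cases h0 : h (Sum.inr 0) <;> cases h1 : h (Sum.inr 1) <;> simp [h0, h1, handleValue]

theorem coblFunctor_mor_apply {S T : Circles} (A : Surface S T) (x : APow S) :
    (coblFunctor.map (mor A)).hom x = A.tensorMap x :=
  congrArg (fun f => (ModuleCat.Hom.hom f) x) (coblFunctor_mor A)

/-- The TQFT of the Frobenius system `A_H`. -/
def frobeniusTQFT : FrobeniusTQFT where
  F := coblFunctor
  additive := inferInstance
  e S := LinearEquiv.refl RH (APow S)
  relabel σ a := (coblFunctor_mor_apply _ _).trans (tensorMap_cylinder σ a)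
  unit S a := (coblFunctor_mor_apply _ _).trans (tensorMap_unit S a)
  counit_one S a := (coblFunctor_mor_apply _ _).trans (tensorMap_counit_one S a)
  counit_X S a := (coblFunctor_mor_apply _ _).trans (tensorMap_counit_vX S a)
  mul S a x y := (coblFunctor_mor_apply _ _).trans (tensorMap_mul S a x y)
  comul_one S a := (coblFunctor_mor_apply _ _).trans (tensorMap_comul_one S a)
  comul_X S a := (coblFunctor_mor_apply _ _).trans (tensorMap_comul_vX S a)

/-! ### The co-reduced theory of `F_H` -/

section Coreduced

open scoped TensorProduct

open scoped Classical in
theorem mulSpecial_tprod (P : PointedCircles) (a : P.circles → AH) :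
    mulSpecial P (PiTensorProduct.tprod RH a) = PiTensorProduct.tprod RH fun s =>
      if s = P.special then vX * a s else a s := by
  refine (PiTensorProduct.map_tprod _ _).trans (congrArg _ (funext fun s => ?_))
  split_ifs <;> rfl

/-- Multiplication by `X` is diagonal in the evaluations: it multiplies by `H` or by 0, according to
the colour of the special circle. -/
theorem evaluations_mulSpecial (P : PointedCircles) (x : APow P.circles) (f : P.circles → Bool) :
    evaluations (mulSpecial P x) f = characterK (f P.special) vX * evaluations x f := by
  classical
  induction x using PiTensorProduct.induction_on with
  | smul_tprod r a =>
    rw [map_smul, map_smul, map_smul, Pi.smul_apply, Pi.smul_apply, mul_smul_comm, mulSpecial_tprod,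
      evaluations_tprod, evaluations_tprod]
    congr 1
    rw [← Finset.mul_prod_erase _ _ (Finset.mem_univ P.special),
      ← Finset.mul_prod_erase _ _ (Finset.mem_univ P.special), if_pos rfl, map_mul, mul_assoc]
    congr 2
    refine Finset.prod_congr rfl fun s hs => ?_
    rw [if_neg (Finset.ne_of_mem_erase hs)]
  | add x y hx hy => rw [map_add, map_add, map_add, Pi.add_apply, Pi.add_apply, hx, hy, mul_add]

/-- In each nonzero term of the state sum the two special circles lie on the same component and
share its colour, so the diagonal factor may be taken at either end. -/
theorem tensorMap_mulSpecial {P Q : PointedCircles} (A : Surface P.circles Q.circles)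
    (hA : A.Special) (x : APow P.circles) :
    A.tensorMap (mulSpecial P x) = mulSpecial Q (A.tensorMap x) := by
  classical
  refine evaluations_injective (funext fun h => ?_)
  rw [Surface.evaluations_tensorMap, evaluations_mulSpecial, Surface.evaluations_tensorMap,
    Surface.stateSum_apply, Surface.stateSum_apply, Finset.mul_sum]
  refine Finset.sum_congr rfl fun κ _ => ?_
  rw [evaluations_mulSpecial]
  by_cases hκ : κ ∘ A.out = h
  · have h1 : (κ ∘ A.inn) P.special = h Q.special := by
      rw [← hκ]
      exact congrArg κ hA
    rw [h1]
    ring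
  · rw [indK_of_not hκ, zero_mul, zero_mul, zero_mul, mul_zero]

/-- The basis of a tensor power of `A_H`. -/
def tensorBasis (S : Circles) : Module.Basis (S → Fin 2) RH (APow S) :=
  Basis.piTensorProduct fun _ => basisAH

theorem tensorBasis_apply (S : Circles) (f : S → Fin 2) :
    tensorBasis S f = PiTensorProduct.tprod RH fun s => basisAH (f s) :=
  Basis.piTensorProduct_apply _ _

open scoped Classical in
theorem mulSpecial_tensorBasis (P : PointedCircles) (f : P.circles → Fin 2) :
    mulSpecial P (tensorBasis P.circles f) = (if f P.special = 1 then H else 1) •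
      tensorBasis P.circles (Function.update f P.special 1) := by
  rw [tensorBasis_apply, tensorBasis_apply, mulSpecial_tprod]
  have key : ∀ i : Fin 2, vX * basisAH i = (if i = 1 then H else 1) • basisAH 1 := by
    intro i
    fin_cases i
    · simp
    · simp [vX_mul_vX]
  have h : (fun s => if s = P.special then vX * basisAH (f s) else basisAH (f s)) =
      Function.update (fun s => basisAH (Function.update f P.special 1 s)) P.special
        ((if f P.special = 1 then H else 1) • basisAH 1) := by
    funext s
    by_cases hs : s = P.special
    · subst hs; simp only [if_true, Function.update_self, key]
    · simp only [if_neg hs, Function.update_of_ne hs]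
  rw [h, MultilinearMap.map_update_smul]
  congr 2
  funext s
  by_cases hs : s = P.special
  · subst hs; simp only [Function.update_self]
  · simp only [Function.update_of_ne hs]

theorem range_mulSpecial (P : PointedCircles) : LinearMap.range (mulSpecial P) =
    Submodule.span RH (Set.range fun f : {f : P.circles → Fin 2 // f P.special = 1} =>
      tensorBasis P.circles f.1) := by
  classical
  refine le_antisymm ?_ ?_
  · rw [LinearMap.range_eq_map, ← (tensorBasis P.circles).span_eq, Submodule.map_span,
      Submodule.span_le]
    rintro _ ⟨_, ⟨f, rfl⟩, rfl⟩
    rw [mulSpecial_tensorBasis]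
    exact Submodule.smul_mem _ _ (Submodule.subset_span ⟨⟨_, Function.update_self _ _ _⟩, rfl⟩)
  · rw [Submodule.span_le]
    rintro _ ⟨⟨f, hf⟩, rfl⟩
    -- Putting `1` in place of `X` on the special circle gives a preimage, since the scalar in
    -- `mulSpecial_tensorBasis` is then 1.
    refine ⟨tensorBasis P.circles (Function.update f P.special 0), ?_⟩
    have h : Function.update (Function.update f P.special 0) P.special 1 = f := by
      rw [Function.update_idem, ← hf, Function.update_eq_self]
    rw [mulSpecial_tensorBasis, Function.update_self, h]
    simp

/-- The image is spanned by part of the basis of the tensor power, namely the basis tensors with `X`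
on the special circle. -/
theorem isFreeModule_range (P : PointedCircles) :
    isFreeModule (ModuleCat.of RH (LinearMap.range (mulSpecial P))) := by
  have b := Module.Basis.span ((tensorBasis P.circles).linearIndependent.comp
    (Subtype.val : {f : P.circles → Fin 2 // f P.special = 1} → _) Subtype.val_injective)
  have h : LinearMap.range (mulSpecial P) = Submodule.span RH (Set.range
      (tensorBasis P.circles ∘ (Subtype.val : {f : P.circles → Fin 2 // f P.special = 1} → _))) :=
    range_mulSpecial P
  have b' := b.map (LinearEquiv.ofEq _ _ h.symm)
  classical
  exact ⟨Module.Free.of_basis b', Module.Finite.of_basis b'⟩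

/-- For a single special surface this is the commutation with multiplication by `X`, and the image
is closed under integer combinations. -/
theorem coblFunctor_mem_range {P Q : PointedCircles} (f : P ⟶ Q) {x : APow P.circles}
    (hx : x ∈ LinearMap.range (mulSpecial P)) :
    (coblFunctor.map f.1).hom x ∈ LinearMap.range (mulSpecial Q) := by
  have ev : ∀ {φ ψ : coblFunctor.obj P.circles.obj ⟶ coblFunctor.obj Q.circles.obj},
      φ = ψ → φ.hom x = ψ.hom x := fun h => h ▸ rfl
  obtain ⟨f, hf⟩ := f
  induction hf using AddSubgroup.closure_induction with
  | mem f hf =>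
    obtain ⟨A, hA, rfl⟩ := hf
    obtain ⟨y, rfl⟩ := hx
    refine ⟨A.tensorMap y, (tensorMap_mulSpecial A hA y).symm.trans ?_⟩
    exact (coblFunctor_mor_apply A _).symm
  | zero => exact (ev (coblFunctor.map_zero _ _)).symm ▸ zero_mem _
  | add f g _ _ hf hg => exact (ev (coblFunctor.map_add (f := f) (g := g))).symm ▸ add_mem hf hg
  | neg f _ hf => exact (ev (coblFunctor.map_neg (f := f))).symm ▸ neg_mem hf

/-- The restriction of the map of tensor powers to the images of multiplication by `X`. -/
def coreducedMap {P Q : PointedCircles} (f : P ⟶ Q) :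
    LinearMap.range (mulSpecial P) →ₗ[RH] LinearMap.range (mulSpecial Q) :=
  (coblFunctor.map f.1).hom.restrict fun _ hx => coblFunctor_mem_range f hx

/-- The co-reduced theory as a functor. -/
def coreducedFunctor : PointedCircles ⥤ FreeModules where
  obj P := ⟨ModuleCat.of RH (LinearMap.range (mulSpecial P)), isFreeModule_range P⟩
  map f := ObjectProperty.homMk (ModuleCat.ofHom (coreducedMap f))
  map_id P := by
    refine ObjectProperty.hom_ext _ (ModuleCat.hom_ext (LinearMap.ext fun x => Subtype.ext ?_))
    exact congrArg (fun f => (ModuleCat.Hom.hom f) x.1) (coblFunctor.map_id P.circles.obj)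
  map_comp f g := by
    refine ObjectProperty.hom_ext _ (ModuleCat.hom_ext (LinearMap.ext fun x => Subtype.ext ?_))
    exact congrArg (fun f => (ModuleCat.Hom.hom f) x.1) (coblFunctor.map_comp f.1 g.1)

/-- The co-reduced theory of the TQFT of the Frobenius system `A_H`. -/
def coreducedTheory : CoreducedTheory frobeniusTQFT where
  F := coreducedFunctor
  additive :=
    { map_add := fun {P Q f g} => by
        refine ObjectProperty.hom_ext _ (ModuleCat.hom_ext (LinearMap.ext fun x => Subtype.ext ?_))
        exact congrArg (fun f => (ModuleCat.Hom.hom f) x.1)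
          (coblFunctor.map_add (f := f.1) (g := g.1)) }
  incl P := (LinearMap.range (mulSpecial P)).subtype
  incl_injective P := Subtype.val_injective
  range_incl P := Submodule.range_subtype _
  incl_map f x := rfl

end Coreduced

end LinkHom
end

/-! ### The main theorem -/

theorem theorem6p2 :
    -- the theory exists
    (∃ T : LinkHom.FrobeniusTQFT, Nonempty (LinkHom.CoreducedTheory T)) ∧
    ∀ (T : LinkHom.FrobeniusTQFT) (K : LinkHom.CoreducedTheory T),
      -- it sees everything that the geometric complex of a marked link diagram sees
      (∀ (D D' : LinkHom.LinkDiagram) (p : D.Point) (p' : D'.Point),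
        Nonempty (HomotopyEquiv (LinkHom.LinkDiagram.pointedComplex p)
            (LinkHom.LinkDiagram.pointedComplex p')) ↔
          Nonempty (HomotopyEquiv
            (LinkHom.applyFunctor K.F (LinkHom.LinkDiagram.pointedComplex p))
            (LinkHom.applyFunctor K.F (LinkHom.LinkDiagram.pointedComplex p')))) ∧
      ∀ {A : Type u} [CategoryTheory.Category.{v} A] [CategoryTheory.Preadditive A]
        [CategoryTheory.Limits.HasFiniteBiproducts A],
        -- functors on circles with a special circle factor, in a unique way
        (∀ (F : CategoryTheory.Functor LinkHom.PointedCircles A) [F.Additive],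
          (∃ (G : CategoryTheory.Functor LinkHom.FreeModules A) (_ : G.Additive),
            Nonempty (F ≅ K.F.comp G) ∧
            (∀ (G' : CategoryTheory.Functor LinkHom.FreeModules A) [G'.Additive],
              Nonempty (F ≅ K.F.comp G') → Nonempty (G' ≅ G)) ∧
            ∀ (D : LinkHom.LinkDiagram) (p : D.Point),
              Nonempty (LinkHom.applyFunctor F (LinkHom.LinkDiagram.pointedComplex p) ≅
                (G.mapHomologicalComplex (ComplexShape.up ℤ)).obj
                  (LinkHom.applyFunctor K.F (LinkHom.LinkDiagram.pointedComplex p)))) ∧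
          ∀ (D D' : LinkHom.LinkDiagram) (p : D.Point) (p' : D'.Point),
            Nonempty (HomotopyEquiv
              (LinkHom.applyFunctor K.F (LinkHom.LinkDiagram.pointedComplex p))
              (LinkHom.applyFunctor K.F (LinkHom.LinkDiagram.pointedComplex p'))) →
            Nonempty (HomotopyEquiv
              (LinkHom.applyFunctor F (LinkHom.LinkDiagram.pointedComplex p))
              (LinkHom.applyFunctor F (LinkHom.LinkDiagram.pointedComplex p')))) ∧
        -- functors on `Cob_{/l}` factor
        (∀ (F : CategoryTheory.Functor LinkHom.Cobl A) [F.Additive],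
          (∃ (G : CategoryTheory.Functor LinkHom.FreeModules A) (_ : G.Additive),
            Nonempty (LinkHom.forgetSpecial.comp F ≅ K.F.comp G) ∧
            ∀ (D : LinkHom.LinkDiagram) (p : D.Point),
              Nonempty (LinkHom.applyFunctor F D.geometricComplex ≅
                (G.mapHomologicalComplex (ComplexShape.up ℤ)).obj
                  (LinkHom.applyFunctor K.F (LinkHom.LinkDiagram.pointedComplex p)))) ∧
          ∀ (D D' : LinkHom.LinkDiagram) (p : D.Point) (p' : D'.Point),
            Nonempty (HomotopyEquiv
              (LinkHom.applyFunctor K.F (LinkHom.LinkDiagram.pointedComplex p))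
              (LinkHom.applyFunctor K.F (LinkHom.LinkDiagram.pointedComplex p'))) →
            Nonempty (HomotopyEquiv
              (LinkHom.applyFunctor F D.geometricComplex)
              (LinkHom.applyFunctor F D'.geometricComplex))) := by
  refine ⟨⟨LinkHom.frobeniusTQFT, ⟨LinkHom.coreducedTheory⟩⟩, fun T K => ?_⟩
  refine ⟨fun D D' p p' => LinkHom.homotopyEquiv_iff (K := K.F) _ _, ?_⟩
  intro A _ _ _
  -- In both factorizations `G` is the extension along `K.F`; a functor on `Cobl` is first
  -- restricted to circles with a special circle.
  refine ⟨fun F _ => ⟨⟨LinkHom.extension K.F F, inferInstance, ⟨LinkHom.extensionIso K.F F⟩, ?_, ?_⟩,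
    ?_⟩, fun F _ => ⟨⟨LinkHom.extension K.F (LinkHom.forgetSpecial ⋙ F), inferInstance,
      ⟨LinkHom.extensionIso K.F _⟩, ?_⟩, ?_⟩⟩
  · rintro G' _ ⟨α⟩
    exact LinkHom.extension_unique K.F F _ G' (LinkHom.extensionIso K.F F) α
  · exact fun D p => ⟨LinkHom.applyFunctorIso F _ (LinkHom.extensionIso K.F F) _⟩
  · rintro D D' p p' ⟨h⟩
    exact LinkHom.homotopyEquiv_of_factor F _ (LinkHom.extensionIso K.F F) _ _ h
  · intro D p
    obtain ⟨i⟩ := LinkHom.applyFunctor_forgetSpecial F D p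
    exact ⟨i ≪≫ LinkHom.applyFunctorIso (LinkHom.forgetSpecial ⋙ F) _
      (LinkHom.extensionIso K.F (LinkHom.forgetSpecial ⋙ F)) _⟩
  · rintro D D' p p' ⟨h⟩
    obtain ⟨i⟩ := LinkHom.applyFunctor_forgetSpecial F D p
    obtain ⟨i'⟩ := LinkHom.applyFunctor_forgetSpecial F D' p'
    obtain ⟨e⟩ := LinkHom.homotopyEquiv_of_factor (LinkHom.forgetSpecial ⋙ F) _
      (LinkHom.extensionIso K.F (LinkHom.forgetSpecial ⋙ F)) _ _ h
    exact ⟨((HomotopyEquiv.ofIso i).trans e).trans (HomotopyEquiv.ofIso i'.symm)⟩
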